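/- Let $d,T\ge 1$ and $m\ge 0$ be integers, $A^*\in\mathbb{R}^{d\times d}$, and let $\phi:\mathbb{R}\to\mathbb{R}$ be increasing and $1$-Lipschitz with $\phi(0)=0$ and $|\phi(x)-\phi(y)|\ge \zeta|x-y|$ for all $x,y\in\mathbb{R}$, for some $\zeta>0$; $\phi$ acts coordinatewise on vectors. Let $\mu$ be a probability law on $\mathbb{R}^d$ with mean zero, covariance $\sigma^2 I$ for some $\sigma>0$, and finite fourth moment $M_4:=\mathbb{E}_{\eta\sim\mu}\|\eta\|^4<\infty$. Assume that the system $x_{t+1}=\phi(A^*x_t)+\eta_t$ is exponentially regular with parameters $C_\rho\ge 1$ and $\rho\in(0,1)$: for all $k\ge 1$, all $x_0,x_0'\in\mathbb{R}^d$ and all $\eta_0,\dots,\eta_{k-1}\in\mathbb{R}^d$, the two trajectories started at $x_0$ and $x_0'$ and driven by these same vectors satisfy $\|x_k-x_k'\|\le C_\rho\rho^{k-1}\|x_0-x_0'\|$. Let $X_0,\dots,X_T$ be a stationary trajectory: $X_{t+1}=\phi(A^*X_t)+\eta_t$ for $0\le t<T$, where $\eta_0,\dots,\eta_{T-1}$ are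 i.i.d. with law $\mu$ and independent of $X_0$, and the law $\pi$ of $X_0$ is a stationary distribution of the system. Put $G:=\mathbb{E}_{X\sim\pi}[XX^\top]$ and $\hat G:=\frac1T\sum_{t=0}^{T-1}X_tX_t^\top$. Let $A_m$ be the $m$-th Quasi-Newton iterate with step size $\gamma=\frac14$: $A_m=0$ if $\hat G$ is not invertible; otherwise $A_0=0$ and $$A_{l+1}=A_l-2\gamma\Big(\frac1T\sum_{t=0}^{T-1}\big(\phi(A_lX_t)-X_{t+1}\big)X_t^\top\Big)\hat G^{-1}\qquad(0\le l<m).$$ There are universal constants $C,C_1,C_0>0$ (depending on nothing) such that, in every such setting, for every $\delta\in(0,\frac12)$, with $R^*:=\frac{4TdC_\rho^2\sigma^2}{(1-\rho)^2\delta}$, if $$T\ge C\,d\log\!\big(\tfrac1\delta\big)\log\!\big(\tfrac{R^*}{\sigma^2}\big)\max\!\left(\frac{4C_\rho^6M_4}{(1-\rho)^4(1-\rho^2)\sigma^4},\ \frac{\log\!\big(\tfrac{R^*C_1C_\rho}{\sigma^2}\big)}{\log(1/\rho)}\right)$$ and $$m\ge\frac{10}{\zeta}\log\!\left(\frac{\|A_0-A^*\|_F^2\,T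 R^*}{\sigma^2d^2}\right)\quad\text{with } A_0=0$$ (where for $A^*=0$ the latter condition is just $m\ge0$), then $\mathbb{E}_{X\sim\pi}\|X\|^2<\infty$ and there is an event $\mathcal W\in\sigma(X_0,\eta_0,\dots,\eta_{T-1})$ with $\mathbb{P}(\mathcal W)\ge 1-\delta$ and $$\mathbb{E}\big[\|A_m-A^*\|_F^2\,\mathbf 1(\mathcal W)\big]\le\frac{C_0\,d^2\sigma^2}{\zeta^2\,T\,\lambda_{\min}(G)}.$$ -/

import Mathlib

open MeasureTheory ProbabilityTheory

noncomputable section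

/-- The link function acting coordinatewise after the linear map: `x ↦ φ(A x)`. -/
def nldsMap {d : ℕ} (φ : ℝ → ℝ) (A : Matrix (Fin d) (Fin d) ℝ) (x : EuclideanSpace ℝ (Fin d)) :
    EuclideanSpace ℝ (Fin d) :=
  WithLp.toLp 2 fun i => φ (A.mulVec x.ofLp i)

/-- The state at time `t` of `x_{s+1} = φ(A x_s) + e_s` started at `x_0 = x`;
it depends on `e_0, …, e_{t-1}` only. -/
def nldsTraj {d : ℕ} (φ : ℝ → ℝ) (A : Matrix (Fin d) (Fin d) ℝ) (x : EuclideanSpace ℝ (Fin d))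
    (e : ℕ → EuclideanSpace ℝ (Fin d)) : ℕ → EuclideanSpace ℝ (Fin d)
  | 0 => x
  | t + 1 => nldsMap φ A (nldsTraj φ A x e t) + e t

/-- Increasing, `1`-Lipschitz, vanishing at `0`, and uniformly expansive with factor `ζ`. -/
structure IsExpansiveLink (φ : ℝ → ℝ) (ζ : ℝ) : Prop where
  mono : Monotone φ
  map_zero : φ 0 = 0
  lipschitz : LipschitzWith 1 φ
  zeta_pos : 0 < ζ
  expansive : ∀ x y : ℝ, ζ * |x - y| ≤ |φ x - φ y|

/-- `(C, ρ)` exponential regularity: after `k + 1` steps driven by the same noise, two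
trajectories differ by at most `C ρ ^ k` times their initial distance. -/
def IsExpRegular {d : ℕ} (φ : ℝ → ℝ) (A : Matrix (Fin d) (Fin d) ℝ) (C ρ : ℝ) : Prop :=
  ∀ (k : ℕ) (x x' : EuclideanSpace ℝ (Fin d)) (e : ℕ → EuclideanSpace ℝ (Fin d)),
    ‖nldsTraj φ A x e (k + 1) - nldsTraj φ A x' e (k + 1)‖ ≤ C * ρ ^ k * ‖x - x'‖

/-- A noise law with mean zero, covariance `σ² I` (where `σ > 0`) and finite fourth moment. -/
structure IsNoiseLaw {d : ℕ} (μ : Measure (EuclideanSpace ℝ (Fin d))) (σ : ℝ) : Prop where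
  prob : IsProbabilityMeasure μ
  sigma_pos : 0 < σ
  fourth_moment : Integrable (fun x => ‖x‖ ^ 4) μ
  mean_zero : ∀ i, ∫ x, x i ∂μ = 0
  covariance : ∀ i j, ∫ x, x i * x j ∂μ = if i = j then σ ^ 2 else 0

/-- `M₄`, the fourth moment of the norm of the noise. -/
def fourthMoment {d : ℕ} (μ : Measure (EuclideanSpace ℝ (Fin d))) : ℝ :=
  ∫ x, ‖x‖ ^ 4 ∂μ

/-- `π` is a stationary distribution of `X_{t+1} = φ(A X_t) + η_t` with noise law `μ`. -/
structure IsStationaryLaw {d : ℕ} (φ : ℝ → ℝ) (A : Matrix (Fin d) (Fin d) ℝ)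
    (μ π : Measure (EuclideanSpace ℝ (Fin d))) : Prop where
  prob : IsProbabilityMeasure π
  invariant : (π.prod μ).map (fun p => nldsMap φ A p.1 + p.2) = π

/-- `X₀` and the noise vectors `η 0, …, η (T - 1)` that drive the trajectory `X₀, …, X_T`:
`X₀` has law `π`, the noise vectors are i.i.d. with law `μ`, and they are jointly independent
of `X₀`. The values `η t` for `t ≥ T` are irrelevant. -/
structure IsDriving {d : ℕ} (T : ℕ) (μ π : Measure (EuclideanSpace ℝ (Fin d)))
    {Ω : Type*} [MeasurableSpace Ω] (P : Measure Ω)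
    (X₀ : Ω → EuclideanSpace ℝ (Fin d)) (η : ℕ → Ω → EuclideanSpace ℝ (Fin d)) : Prop where
  measurable_init : Measurable X₀
  measurable_noise : ∀ t < T, Measurable (η t)
  law_init : P.map X₀ = π
  law_noise : ∀ t < T, P.map (η t) = μ
  indep_noise : iIndepFun (fun t : Fin T => η t) P
  indep_init : IndepFun X₀ (fun ω (t : Fin T) => η t ω) P

/-- The second moment matrix `E[X Xᵀ]` for `X ∼ π`. -/
def secondMoment {d : ℕ} (π : Measure (EuclideanSpace ℝ (Fin d))) : Matrix (Fin d) (Fin d) ℝ :=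
  Matrix.of fun i j => ∫ x, x i * x j ∂π

/-- The empirical second moment matrix `(1/T) ∑_{t<T} x_t x_tᵀ`. -/
def empiricalSecondMoment {d : ℕ} (T : ℕ) (x : ℕ → EuclideanSpace ℝ (Fin d)) :
    Matrix (Fin d) (Fin d) ℝ :=
  (1 / (T : ℝ)) • ∑ t ∈ Finset.range T, Matrix.vecMulVec (x t).ofLp (x t).ofLp

/-- The gradient `(1/T) ∑_{t<T} (φ(A x_t) - x_{t+1}) x_tᵀ` of the convex proxy loss at `A`. -/
def proxyGrad {d : ℕ} (φ : ℝ → ℝ) (T : ℕ) (x : ℕ → EuclideanSpace ℝ (Fin d))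
    (A : Matrix (Fin d) (Fin d) ℝ) : Matrix (Fin d) (Fin d) ℝ :=
  (1 / (T : ℝ)) • ∑ t ∈ Finset.range T,
    Matrix.vecMulVec (nldsMap φ A (x t) - x (t + 1)).ofLp (x t).ofLp

/-- The Quasi-Newton recursion with step size `γ`, started at the zero matrix. -/
def quasiNewtonIter {d : ℕ} (φ : ℝ → ℝ) (T : ℕ) (γ : ℝ) (x : ℕ → EuclideanSpace ℝ (Fin d)) :
    ℕ → Matrix (Fin d) (Fin d) ℝ
  | 0 => 0
  | l + 1 => quasiNewtonIter φ T γ x l -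
      (2 * γ) • (proxyGrad φ T x (quasiNewtonIter φ T γ x l) * (empiricalSecondMoment T x)⁻¹)

open Classical in
/-- The output `A_m` of the Quasi-Newton method after `m` iterations on the data `x_0, …, x_T`;
it is the zero matrix if the empirical second moment matrix is not invertible. -/
def quasiNewton {d : ℕ} (φ : ℝ → ℝ) (T : ℕ) (γ : ℝ) (x : ℕ → EuclideanSpace ℝ (Fin d)) (m : ℕ) :
    Matrix (Fin d) (Fin d) ℝ :=
  if IsUnit (empiricalSecondMoment T x) then quasiNewtonIter φ T γ x m else 0

/-- The squared Frobenius norm. -/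
def frobeniusSq {d : ℕ} (M : Matrix (Fin d) (Fin d) ℝ) : ℝ :=
  ∑ i, ∑ j, M i j ^ 2

/-- The smallest eigenvalue of a symmetric matrix. -/
def lambdaMin {d : ℕ} (M : Matrix (Fin d) (Fin d) ℝ) : ℝ :=
  sInf (spectrum ℝ M)

/-- `R* = 4 T d C_ρ² σ² / ((1 - ρ)² δ)`. -/
def radiusStar (T d : ℕ) (Cρ σ ρ δ : ℝ) : ℝ :=
  4 * T * d * Cρ ^ 2 * σ ^ 2 / ((1 - ρ) ^ 2 * δ)

end

/-! The error of the iterates is measured in the empirical form v ↦ vᵀĜv (`empiricalForm`), the L²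
norm of ⟨v, ·⟩ over the observed states. A Quasi-Newton step turns a row e = b − a of the error into
half a noise term plus the L² projection, onto linear functionals, of the residual x ↦ ⟨e, x⟩ −
(φ⟨b, x⟩ − φ⟨a, x⟩)/2. Since the slopes of φ lie in [ζ, 1], this residual is at most (1 − ζ/2)|⟨e,
x⟩| pointwise, and projecting does not increase the norm. So the error contracts whatever the
conditioning of Ĝ, down to a floor ζ⁻² tr(N Ĝ⁻¹ Nᵀ), where N is the average of the η_t X_tᵀ
(`quasiNewtonIter_form_le`).

On an event W where Ĝ ≽ G/512, the floor is at most 512 ζ⁻² tr(N G⁻¹ Nᵀ) (`empiricalForm_noise_le`).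
This quantity is nonnegative and G is deterministic, so the indicator of W can be dropped; the η_t
X_tᵀ being martingale differences, the expectation of the trace is exactly d²σ²/T
(`integral_trace_noiseCorrelation`). Returning to the Frobenius norm costs a factor 512/λ_min(G),
and the condition on m makes the bias no larger than the noise term.

The event W (`exists_event`) requires only a lower tail. Time is cut into N blocks of length 2B, and
in each block the trajectory is restarted from 0. Restarted trajectories of different blocks use
disjoint noise, hence are independent, and by exponential regularity they are close to the true one
in the second half of the block. For a direction u with E⟨u, X⟩² = 1 the energy of a second half has
mean at least B/4 and second moment at most 440B², because products of its terms nearly decouple.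
For nonnegative variables two moments suffice for an exponential lower tail, so a fourth moment of
the noise is enough. Markov's inequality bounds all states, and a net of the ellipsoid E⟨u, X⟩² = 1
makes the bound uniform in u. -/

/-! ### Deterministic consequences of exponential regularity -/

section Trajectory

variable {d : ℕ} {φ : ℝ → ℝ} {A : Matrix (Fin d) (Fin d) ℝ}

lemma nldsMap_zero (h : φ 0 = 0) : nldsMap φ A 0 = 0 := by
  ext i; simp [nldsMap, h]

lemma continuous_nldsMap (h : Continuous φ) : Continuous (nldsMap φ A) := by
  unfold nldsMap
  refine (PiLp.continuous_toLp 2 _).comp (continuous_pi fun i => h.comp ?_)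
  unfold Matrix.mulVec dotProduct
  fun_prop

lemma nldsTraj_add (x : EuclideanSpace ℝ (Fin d)) (e : ℕ → EuclideanSpace ℝ (Fin d)) (a b : ℕ) :
    nldsTraj φ A x e (a + b) =
      nldsTraj φ A (nldsTraj φ A x e a) (fun i => e (a + i)) b := by
  induction b with
  | zero => rfl
  | succ b ih => rw [← add_assoc]; simp only [nldsTraj, ih]

lemma measurable_nldsTraj {Ω : Type*} {_ : MeasurableSpace Ω} (hφ : Continuous φ)
    {X : Ω → EuclideanSpace ℝ (Fin d)} {e : ℕ → Ω → EuclideanSpace ℝ (Fin d)} (hX : Measurable X)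
    {t : ℕ} (he : ∀ i < t, Measurable (e i)) :
    Measurable fun ω => nldsTraj φ A (X ω) (fun i => e i ω) t := by
  induction t with
  | zero => exact hX
  | succ t ih =>
    exact ((continuous_nldsMap hφ).measurable.comp (ih fun i hi => he i (by omega))).add
      (he t (by omega))

/-- The state reached from `0` after `k` steps driven by `e s, …, e (s + k - 1)`. -/
noncomputable def nldsRestart (φ : ℝ → ℝ) (A : Matrix (Fin d) (Fin d) ℝ) (e : ℕ → EuclideanSpace ℝ (Fin d))
    (s k : ℕ) : EuclideanSpace ℝ (Fin d) :=
  nldsTraj φ A 0 (fun i => e (s + i)) k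

lemma nldsRestart_add (e : ℕ → EuclideanSpace ℝ (Fin d)) (s a b : ℕ) :
    nldsRestart φ A e s (a + b) =
      nldsTraj φ A (nldsRestart φ A e s a) (fun i => e (s + a + i)) b := by
  unfold nldsRestart
  rw [nldsTraj_add]
  simp only [add_assoc]

lemma measurable_nldsRestart {Ω : Type*} {_ : MeasurableSpace Ω} (hφ : Continuous φ)
    {e : ℕ → Ω → EuclideanSpace ℝ (Fin d)} {s k : ℕ} (he : ∀ i < k, Measurable (e (s + i))) :
    Measurable fun ω => nldsRestart φ A (fun i => e i ω) s k :=
  measurable_nldsTraj (e := fun i => e (s + i)) hφ measurable_const he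

variable {C ρ : ℝ}

lemma IsExpRegular.norm_traj_sub_le (h : IsExpRegular φ A C ρ) {k : ℕ} (hk : 1 ≤ k)
    (x x' : EuclideanSpace ℝ (Fin d)) (e : ℕ → EuclideanSpace ℝ (Fin d)) :
    ‖nldsTraj φ A x e k - nldsTraj φ A x' e k‖ ≤ C * ρ ^ (k - 1) * ‖x - x'‖ := by
  obtain ⟨k, rfl⟩ := Nat.exists_eq_add_of_le' hk
  exact h k x x' e

lemma IsExpRegular.norm_traj_sub_restart_le (h : IsExpRegular φ A C ρ) {k : ℕ} (hk : 1 ≤ k) (s : ℕ)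
    (x : EuclideanSpace ℝ (Fin d)) (e : ℕ → EuclideanSpace ℝ (Fin d)) :
    ‖nldsTraj φ A x e (s + k) - nldsRestart φ A e s k‖ ≤
      C * ρ ^ (k - 1) * ‖nldsTraj φ A x e s‖ := by
  have := h.norm_traj_sub_le hk (nldsTraj φ A x e s) 0 (fun i => e (s + i))
  rwa [← nldsTraj_add, sub_zero] at this

lemma IsExpRegular.norm_restart_sub_restart_le (h : IsExpRegular φ A C ρ) {b : ℕ} (hb : 1 ≤ b)
    (s a : ℕ) (e : ℕ → EuclideanSpace ℝ (Fin d)) :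
    ‖nldsRestart φ A e s (a + b) - nldsRestart φ A e (s + a) b‖ ≤
      C * ρ ^ (b - 1) * ‖nldsRestart φ A e s a‖ := by
  have := h.norm_traj_sub_le hb (nldsRestart φ A e s a) 0 (fun i => e (s + a + i))
  rwa [← nldsRestart_add, sub_zero] at this

/-- Telescoping over the noise vectors, oldest first: discarding `e s` moves the final state by at
most one regularity bound applied to ‖e s‖. Truncated subtraction gives the last two vectors the
same weight C; for the very last one, which enters unpropagated, this needs 1 ≤ C. -/
lemma IsExpRegular.norm_restart_le (h : IsExpRegular φ A C ρ) (hφ : φ 0 = 0) (hC : 1 ≤ C)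
    (e : ℕ → EuclideanSpace ℝ (Fin d)) (s k : ℕ) :
    ‖nldsRestart φ A e s k‖ ≤
      ∑ i ∈ Finset.range k, C * ρ ^ (k - 1 - i - 1) * ‖e (s + i)‖ := by
  induction k generalizing s with
  | zero => simp [nldsRestart, nldsTraj]
  | succ k ih =>
    have h1 : nldsRestart φ A e s 1 = e s := by
      simp [nldsRestart, nldsTraj, nldsMap_zero hφ]
    have h2 : ‖nldsRestart φ A e s (1 + k) - nldsRestart φ A e (s + 1) k‖ ≤
        C * ρ ^ (k - 1) * ‖e s‖ := by
      rcases Nat.eq_zero_or_pos k with rfl | hk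
      · have : nldsRestart φ A e (s + 1) 0 = 0 := rfl
        rw [add_zero, this, h1]
        simpa using le_mul_of_one_le_left (norm_nonneg (e s)) hC
      · simpa [h1] using h.norm_restart_sub_restart_le hk s 1 e
    rw [Finset.sum_range_succ']
    have h3 := norm_add_le (nldsRestart φ A e s (1 + k) - nldsRestart φ A e (s + 1) k)
      (nldsRestart φ A e (s + 1) k)
    rw [sub_add_cancel, add_comm 1 k] at h3
    refine h3.trans ?_
    rw [add_comm]
    refine add_le_add ((ih (s + 1)).trans (le_of_eq (Finset.sum_congr rfl fun i _ => ?_))) ?_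
    · rw [show k + 1 - 1 - (i + 1) - 1 = k - 1 - i - 1 by omega,
        show s + 1 + i = s + (i + 1) by ring]
    · rw [add_comm 1 k] at h2; simpa using h2

/-- In reversed order the weights are C, C, Cρ, Cρ², …; the repeated first one is the reason for the
factor 2. -/
lemma sum_regularity_weights_le (hC : 0 ≤ C) (hρ : 0 < ρ) (hρ1 : ρ < 1) (k : ℕ) :
    ∑ i ∈ Finset.range k, C * ρ ^ (k - 1 - i - 1) ≤ 2 * C / (1 - ρ) := by
  rw [Finset.sum_range_reflect (fun j => C * ρ ^ (j - 1)) k]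
  have h1 : 0 < 1 - ρ := by linarith
  have hgeom : ∀ n : ℕ, ∑ j ∈ Finset.range n, ρ ^ j ≤ 1 / (1 - ρ) := fun n => by
    rw [geom_sum_eq hρ1.ne, ← neg_div_neg_eq, neg_sub, neg_sub]
    have := pow_nonneg hρ.le n
    gcongr
    linarith
  rcases k with _ | k
  · simp; positivity
  · rw [Finset.sum_range_succ']
    have h2 : ∑ j ∈ Finset.range k, C * ρ ^ (j + 1 - 1) ≤ C * (1 / (1 - ρ)) := by
      rw [← Finset.mul_sum]
      exact mul_le_mul_of_nonneg_left (hgeom k) hC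
    have h3 : C ≤ C * (1 / (1 - ρ)) :=
      le_mul_of_one_le_right hC (by rw [le_div_iff₀ h1]; linarith)
    have h4 : 2 * C / (1 - ρ) = C * (1 / (1 - ρ)) + C * (1 / (1 - ρ)) := by ring
    rw [h4]
    refine add_le_add h2 (by simpa using h3)

/-- Jensen's inequality for the normalised weights. -/
lemma pow_sum_mul_le {ι : Type*} (s : Finset ι) (w a : ι → ℝ) (hw : ∀ i ∈ s, 0 ≤ w i)
    (ha : ∀ i ∈ s, 0 ≤ a i) {S : ℝ} (hwS : ∑ i ∈ s, w i ≤ S) (p : ℕ) :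
    (∑ i ∈ s, w i * a i) ^ (p + 1) ≤ S ^ p * ∑ i ∈ s, w i * a i ^ (p + 1) := by
  have hW0 : 0 ≤ ∑ i ∈ s, w i := Finset.sum_nonneg hw
  rcases hW0.eq_or_lt with hW | hW
  · have hz : ∀ i ∈ s, w i = 0 := (Finset.sum_eq_zero_iff_of_nonneg hw).1 hW.symm
    rw [Finset.sum_eq_zero fun i hi => by rw [hz i hi, zero_mul],
      Finset.sum_eq_zero fun i hi => by rw [hz i hi, zero_mul]]
    simp
  · set W := ∑ i ∈ s, w i
    have h := Real.pow_arith_mean_le_arith_mean_pow s (fun i => w i / W) a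
      (fun i hi => div_nonneg (hw i hi) hW.le) (by rw [← Finset.sum_div, div_self hW.ne']) ha (p + 1)
    have e1 : ∑ i ∈ s, w i / W * a i = (∑ i ∈ s, w i * a i) / W := by
      rw [Finset.sum_div]; exact Finset.sum_congr rfl fun i _ => by ring
    have e2 : ∑ i ∈ s, w i / W * a i ^ (p + 1) = (∑ i ∈ s, w i * a i ^ (p + 1)) / W := by
      rw [Finset.sum_div]; exact Finset.sum_congr rfl fun i _ => by ring
    rw [e1, e2, div_pow, div_le_div_iff₀ (by positivity) hW] at h
    have hn : 0 ≤ ∑ i ∈ s, w i * a i ^ (p + 1) :=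
      Finset.sum_nonneg fun i hi => mul_nonneg (hw i hi) (pow_nonneg (ha i hi) _)
    have h' : (∑ i ∈ s, w i * a i) ^ (p + 1) ≤ W ^ p * ∑ i ∈ s, w i * a i ^ (p + 1) := by
      refine le_of_mul_le_mul_right ?_ hW
      calc _ ≤ _ := h
        _ = _ := by ring
    refine h'.trans (mul_le_mul_of_nonneg_right ?_ hn)
    gcongr

lemma IsExpRegular.norm_restart_pow_le (h : IsExpRegular φ A C ρ) (hφ : φ 0 = 0) (hC : 1 ≤ C)
    (hρ : 0 < ρ) (hρ1 : ρ < 1) (e : ℕ → EuclideanSpace ℝ (Fin d)) (s k p : ℕ) :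
    ‖nldsRestart φ A e s k‖ ^ (p + 1) ≤ (2 * C / (1 - ρ)) ^ p *
      ∑ i ∈ Finset.range k, C * ρ ^ (k - 1 - i - 1) * ‖e (s + i)‖ ^ (p + 1) := by
  have h1 : 0 < 1 - ρ := by linarith
  refine (pow_le_pow_left₀ (norm_nonneg _) (h.norm_restart_le hφ hC e s k) _).trans ?_
  exact pow_sum_mul_le _ _ _ (fun i _ => by positivity) (fun i _ => norm_nonneg _)
    (sum_regularity_weights_le (by linarith) hρ hρ1 k) p

end Trajectory

/-! ### Contraction of the Quasi-Newton iteration in the empirical form -/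

section QuasiNewton

open Matrix

variable {d : ℕ} {φ : ℝ → ℝ} {A : Matrix (Fin d) (Fin d) ℝ} {ζ : ℝ} {T : ℕ}
  {x : ℕ → EuclideanSpace ℝ (Fin d)}

/-- Increments of φ are between ζ and 1 times those of the argument, so half of one removes a
fraction between ζ/2 and 1/2. The half is 2γ. -/
lemma IsExpansiveLink.abs_sub_half_le (h : IsExpansiveLink φ ζ) (a b : ℝ) :
    |(a - b) - (φ a - φ b) / 2| ≤ (1 - ζ / 2) * |a - b| := by
  wlog hab : b ≤ a generalizing a b
  · have := this b a (by linarith)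
    rw [abs_sub_comm a b, ← abs_neg]
    convert this using 2
    ring
  have h1 := h.mono hab
  have h2 := h.expansive a b
  have h3 := h.lipschitz.dist_le_mul a b
  simp only [Real.dist_eq, NNReal.coe_one, one_mul] at h3
  rw [abs_of_nonneg (by linarith : 0 ≤ a - b), abs_of_nonneg (by linarith : 0 ≤ φ a - φ b)] at h2 h3
  rw [abs_of_nonneg (by linarith : 0 ≤ a - b), abs_of_nonneg (by linarith)]
  linarith

lemma IsExpansiveLink.zeta_le_one (h : IsExpansiveLink φ ζ) : ζ ≤ 1 := by
  have h2 := h.expansive 1 0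
  have h3 := h.lipschitz.dist_le_mul 1 0
  simp [Real.dist_eq] at h2 h3
  linarith

lemma mul_empiricalSecondMoment_apply (M : Matrix (Fin d) (Fin d) ℝ) (k j : Fin d) :
    (M * empiricalSecondMoment T x) k j =
      (1 / (T : ℝ)) * ∑ t ∈ Finset.range T, (M k ⬝ᵥ (x t).ofLp) * x t j := by
  simp only [empiricalSecondMoment, Matrix.mul_smul, Matrix.smul_apply, smul_eq_mul,
    Matrix.mul_sum, Matrix.sum_apply]
  congr 1
  refine Finset.sum_congr rfl fun t _ => ?_
  simp [Matrix.mul_apply, vecMulVec_apply, dotProduct, Finset.sum_mul, mul_assoc]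

lemma dotProduct_mul_empiricalSecondMoment (M : Matrix (Fin d) (Fin d) ℝ) (k : Fin d)
    (v : Fin d → ℝ) :
    (M * empiricalSecondMoment T x) k ⬝ᵥ v =
      (1 / (T : ℝ)) * ∑ t ∈ Finset.range T, (M k ⬝ᵥ (x t).ofLp) * (v ⬝ᵥ (x t).ofLp) := by
  have h : ∀ j, (M * empiricalSecondMoment T x) k j * v j =
      ∑ t ∈ Finset.range T, (1 / (T : ℝ)) * ((M k ⬝ᵥ (x t).ofLp) * (v j * x t j)) := fun j => by
    rw [mul_empiricalSecondMoment_apply, Finset.mul_sum, Finset.sum_mul]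
    exact Finset.sum_congr rfl fun t _ => by ring
  rw [dotProduct, Finset.sum_congr rfl fun j _ => h j, Finset.sum_comm, Finset.mul_sum]
  refine Finset.sum_congr rfl fun t _ => ?_
  rw [← Finset.mul_sum, ← Finset.mul_sum]
  rfl

/-- The empirical quadratic form `vᵀ Ĝ v`. -/
noncomputable def empiricalForm (T : ℕ) (x : ℕ → EuclideanSpace ℝ (Fin d)) (v : Fin d → ℝ) : ℝ :=
  (1 / (T : ℝ)) * ∑ t ∈ Finset.range T, (v ⬝ᵥ (x t).ofLp) ^ 2

/-- The average `(1/T) ∑_{t<T} (x_{t+1} - φ(A x_t)) x_tᵀ` of the noise against the states. -/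
noncomputable def noiseCorrelation (φ : ℝ → ℝ) (A : Matrix (Fin d) (Fin d) ℝ) (T : ℕ)
    (x : ℕ → EuclideanSpace ℝ (Fin d)) : Matrix (Fin d) (Fin d) ℝ :=
  (1 / (T : ℝ)) • ∑ t ∈ Finset.range T,
    Matrix.vecMulVec (x (t + 1) - nldsMap φ A (x t)).ofLp (x t).ofLp

lemma sq_avg_mul_le (T : ℕ) (a b : ℕ → ℝ) :
    ((1 / (T : ℝ)) * ∑ t ∈ Finset.range T, a t * b t) ^ 2 ≤
      ((1 / (T : ℝ)) * ∑ t ∈ Finset.range T, a t ^ 2) *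
        ((1 / (T : ℝ)) * ∑ t ∈ Finset.range T, b t ^ 2) := by
  have := Finset.sum_mul_sq_le_sq_mul_sq (Finset.range T) a b
  rw [mul_pow]
  calc _ ≤ (1 / (T : ℝ)) ^ 2 * ((∑ t ∈ Finset.range T, a t ^ 2) *
        ∑ t ∈ Finset.range T, b t ^ 2) := by gcongr
    _ = _ := by ring

lemma empiricalForm_nonneg (T : ℕ) (x : ℕ → EuclideanSpace ℝ (Fin d)) (v : Fin d → ℝ) :
    0 ≤ empiricalForm T x v := by
  unfold empiricalForm; positivity

lemma empiricalForm_row_eq (M : Matrix (Fin d) (Fin d) ℝ) (k : Fin d) :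
    empiricalForm T x (M k) = (M * empiricalSecondMoment T x) k ⬝ᵥ M k := by
  rw [dotProduct_mul_empiricalSecondMoment]
  simp only [empiricalForm, sq]

lemma proxyGrad_apply (B : Matrix (Fin d) (Fin d) ℝ) (k j : Fin d) :
    proxyGrad φ T x B k j = (1 / (T : ℝ)) * ∑ t ∈ Finset.range T,
      (φ (B k ⬝ᵥ (x t).ofLp) - φ (A k ⬝ᵥ (x t).ofLp)) * x t j - noiseCorrelation φ A T x k j := by
  simp only [proxyGrad, noiseCorrelation, Matrix.smul_apply, Matrix.sum_apply, vecMulVec_apply,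
    smul_eq_mul, ← mul_sub, ← Finset.sum_sub_distrib]
  congr 1
  refine Finset.sum_congr rfl fun t _ => ?_
  simp only [nldsMap, PiLp.sub_apply, Matrix.mulVec]
  ring

lemma sq_add_half_le {s : ℝ} (hs : 0 < s) (hs1 : s < 1) (a b : ℝ) :
    (a + b / 2) ^ 2 ≤ a ^ 2 / (1 - s) + b ^ 2 / (4 * s) := by
  have h1 : 0 < 1 - s := by linarith
  rw [div_add_div _ _ h1.ne' (by positivity), le_div_iff₀ (by positivity)]
  nlinarith [sq_nonneg (2 * s * a - (1 - s) * b)]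

lemma quasiNewton_step (h : IsExpansiveLink φ ζ) (hH : IsUnit (empiricalSecondMoment T x))
    (B : Matrix (Fin d) (Fin d) ℝ) (k : Fin d) :
    empiricalForm T x
        ((B - (2 * (1 / 4 : ℝ)) • (proxyGrad φ T x B * (empiricalSecondMoment T x)⁻¹) - A) k) ≤
      (1 - ζ / 2) * empiricalForm T x ((B - A) k) + 1 / (2 * ζ) * empiricalForm T x
        ((noiseCorrelation φ A T x * (empiricalSecondMoment T x)⁻¹) k) := by
  have hdet := (Matrix.isUnit_iff_isUnit_det _).1 hH
  set H := empiricalSecondMoment T x with hHdef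
  set N := noiseCorrelation φ A T x with hN
  set W := N * H⁻¹ with hW
  set E' := B - (2 * (1 / 4 : ℝ)) • (proxyGrad φ T x B * H⁻¹) - A with hE'
  -- Without its noise part the new error is the least-squares linear fit to the residuals `r`
  -- below; `hFH` and `hFHk` are the normal equations.
  set F := E' - (1 / 2 : ℝ) • W with hF
  have hζ := h.zeta_pos
  have hζ1 := h.zeta_le_one
  set r : ℕ → ℝ := fun t => (B - A) k ⬝ᵥ (x t).ofLp -
    (φ (B k ⬝ᵥ (x t).ofLp) - φ (A k ⬝ᵥ (x t).ofLp)) / 2 with hr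
  have hFH : F * H = (B - A) * H - (1 / 2 : ℝ) • (proxyGrad φ T x B + N) := by
    have e1 : proxyGrad φ T x B * H⁻¹ * H = proxyGrad φ T x B := by
      rw [Matrix.mul_assoc, Matrix.nonsing_inv_mul _ hdet, Matrix.mul_one]
    have e2 : N * H⁻¹ * H = N := by
      rw [Matrix.mul_assoc, Matrix.nonsing_inv_mul _ hdet, Matrix.mul_one]
    rw [hF, hE', hW]
    simp only [Matrix.sub_mul, Matrix.smul_mul, e1, e2, smul_add]
    norm_num
    abel
  have hFHk : ∀ j, (F * H) k j = (1 / (T : ℝ)) * ∑ t ∈ Finset.range T, r t * x t j := by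
    intro j
    rw [hFH, Matrix.sub_apply, mul_empiricalSecondMoment_apply, Matrix.smul_apply,
      Matrix.add_apply, proxyGrad_apply (A := A), hN, sub_add_cancel, smul_eq_mul,
      mul_left_comm, ← mul_sub, Finset.mul_sum, ← Finset.sum_sub_distrib]
    congr 1
    refine Finset.sum_congr rfl fun t _ => ?_
    simp only [hr]
    ring
  have hq : empiricalForm T x (F k) =
      (1 / (T : ℝ)) * ∑ t ∈ Finset.range T, r t * (F k ⬝ᵥ (x t).ofLp) := by
    rw [empiricalForm_row_eq]
    have : (F * H) k ⬝ᵥ F k = ∑ j, ((1 / (T : ℝ)) * ∑ t ∈ Finset.range T, r t * x t j) * F k j :=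
      Finset.sum_congr rfl fun j _ => by rw [hFHk]
    rw [this]
    simp only [dotProduct, Finset.mul_sum, Finset.sum_mul]
    rw [Finset.sum_comm]
    refine Finset.sum_congr rfl fun t _ => Finset.sum_congr rfl fun j _ => ?_
    ring
  have hravg : (1 / (T : ℝ)) * ∑ t ∈ Finset.range T, r t ^ 2 ≤
      (1 - ζ / 2) ^ 2 * empiricalForm T x ((B - A) k) := by
    unfold empiricalForm
    rw [mul_left_comm, Finset.mul_sum _ _ ((1 - ζ / 2) ^ 2)]
    refine mul_le_mul_of_nonneg_left (Finset.sum_le_sum fun t _ => ?_)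
      (by positivity : (0 : ℝ) ≤ 1 / (T : ℝ))
    have := h.abs_sub_half_le (B k ⬝ᵥ (x t).ofLp) (A k ⬝ᵥ (x t).ofLp)
    have hBA : (B - A) k ⬝ᵥ (x t).ofLp = B k ⬝ᵥ (x t).ofLp - A k ⬝ᵥ (x t).ofLp := by
      rw [← sub_dotProduct]; rfl
    simp only [hr, hBA]
    rw [← mul_pow, sq_le_sq, abs_mul, abs_of_nonneg (by linarith : 0 ≤ 1 - ζ / 2)]
    exact this
  -- A projection does not increase the norm: Cauchy–Schwarz in `hq`, then cancellation of one
  -- factor.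
  have hqF : empiricalForm T x (F k) ≤ (1 - ζ / 2) ^ 2 * empiricalForm T x ((B - A) k) := by
    refine le_trans ?_ hravg
    have hcs := sq_avg_mul_le T r fun t => F k ⬝ᵥ (x t).ofLp
    rw [← hq] at hcs
    change _ ≤ _ * empiricalForm T x (F k) at hcs
    rcases (empiricalForm_nonneg T x (F k)).eq_or_lt with h0 | h0
    · rw [← h0]; positivity
    · rw [sq] at hcs
      exact le_of_mul_le_mul_right hcs h0
  have hsplit : empiricalForm T x (E' k) ≤ empiricalForm T x (F k) / (1 - ζ / 2) +
      empiricalForm T x (W k) / (4 * (ζ / 2)) := by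
    unfold empiricalForm
    rw [mul_div_assoc, mul_div_assoc, ← mul_add, Finset.sum_div, Finset.sum_div,
      ← Finset.sum_add_distrib]
    gcongr with t _
    have hE'k : E' k ⬝ᵥ (x t).ofLp = F k ⬝ᵥ (x t).ofLp + (W k ⬝ᵥ (x t).ofLp) / 2 := by
      have : E' k = F k + (1 / 2 : ℝ) • W k := by
        rw [hF]; ext j; simp
      rw [this, add_dotProduct, smul_dotProduct, smul_eq_mul]; ring
    rw [hE'k]
    -- With s = ζ/2, one of the two factors 1 − ζ/2 in `hqF` pays for separating the noise and the
    -- other remains as the contraction rate.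
    exact sq_add_half_le (by linarith) (by linarith) _ _
  refine hsplit.trans (add_le_add ?_ (le_of_eq (by ring)))
  rw [div_le_iff₀ (by linarith)]
  refine hqF.trans (le_of_eq (by ring))

/-- The coefficient 1/ζ² is the fixed point of c ↦ (1 − ζ/2)c + 1/(2ζ). -/
lemma quasiNewtonIter_form_le (h : IsExpansiveLink φ ζ)
    (hH : IsUnit (empiricalSecondMoment T x)) (m : ℕ) (k : Fin d) :
    empiricalForm T x ((quasiNewtonIter φ T (1 / 4) x m - A) k) ≤
      (1 - ζ / 2) ^ m * empiricalForm T x (A k) + 1 / ζ ^ 2 * empiricalForm T x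
        ((noiseCorrelation φ A T x * (empiricalSecondMoment T x)⁻¹) k) := by
  have hζ := h.zeta_pos
  have hζ1 := h.zeta_le_one
  set q := empiricalForm T x
        ((noiseCorrelation φ A T x * (empiricalSecondMoment T x)⁻¹) k) with hq
  have hq0 : 0 ≤ q := empiricalForm_nonneg _ _ _
  induction m with
  | zero =>
    have : empiricalForm T x ((quasiNewtonIter φ T (1 / 4) x 0 - A) k) = empiricalForm T x (A k) := by
      have : (quasiNewtonIter φ T (1 / 4) x 0 - A) k = - A k := by
        ext j; simp [quasiNewtonIter]
      rw [this]; simp [empiricalForm]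
    rw [this]
    have : 0 ≤ 1 / ζ ^ 2 * q := by positivity
    linarith
  | succ m ih =>
    refine (quasiNewton_step h hH _ k).trans ?_
    rw [← hq]
    have h1 : 0 ≤ 1 - ζ / 2 := by linarith
    calc _ ≤ (1 - ζ / 2) * ((1 - ζ / 2) ^ m * empiricalForm T x (A k) + 1 / ζ ^ 2 * q) +
          1 / (2 * ζ) * q := by gcongr
      _ = _ := by field_simp; ring

lemma empiricalForm_row_le (v : Fin d → ℝ) :
    empiricalForm T x v ≤ (∑ j, v j ^ 2) * ((1 / (T : ℝ)) * ∑ t ∈ Finset.range T, ‖x t‖ ^ 2) := by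
  unfold empiricalForm
  rw [mul_left_comm, Finset.mul_sum _ _ (∑ j, v j ^ 2)]
  refine mul_le_mul_of_nonneg_left (Finset.sum_le_sum fun t _ => ?_)
      (by positivity : (0 : ℝ) ≤ 1 / (T : ℝ))
  rw [EuclideanSpace.norm_sq_eq]
  simp only [Real.norm_eq_abs, sq_abs]
  exact Finset.sum_mul_sq_le_sq_mul_sq _ _ _

/-- Row by row, this is Ĝ ≽ cG ⇒ Ĝ⁻¹ ≼ c⁻¹G⁻¹. It comes from expanding the G-norm of cW − G⁻¹N,
where W is a row of NĜ⁻¹. -/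
lemma empiricalForm_noise_le {G : Matrix (Fin d) (Fin d) ℝ} (hG : G.PosDef) {c : ℝ} (hc : 0 < c)
    (hGH : ∀ v : Fin d → ℝ, c * (v ⬝ᵥ G *ᵥ v) ≤ empiricalForm T x v)
    (hH : IsUnit (empiricalSecondMoment T x)) (N : Matrix (Fin d) (Fin d) ℝ) (k : Fin d) :
    empiricalForm T x ((N * (empiricalSecondMoment T x)⁻¹) k) ≤
      1 / c * (N k ⬝ᵥ G⁻¹ *ᵥ N k) := by
  have hdet := (Matrix.isUnit_iff_isUnit_det _).1 hH
  have hGdet := (Matrix.isUnit_iff_isUnit_det _).1 hG.isUnit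
  set W := N * (empiricalSecondMoment T x)⁻¹ with hW
  have hWH : W * empiricalSecondMoment T x = N := by
    rw [hW, Matrix.mul_assoc, Matrix.nonsing_inv_mul _ hdet, Matrix.mul_one]
  set q := empiricalForm T x (W k) with hq
  have hqN : q = N k ⬝ᵥ W k := by rw [hq, empiricalForm_row_eq, hWH]
  set y := G⁻¹ *ᵥ N k with hy
  have hGy : G *ᵥ y = N k := by
    rw [hy, mulVec_mulVec, Matrix.mul_nonsing_inv _ hGdet, one_mulVec]
  have hsymm : ∀ u v : Fin d → ℝ, u ⬝ᵥ G *ᵥ v = v ⬝ᵥ G *ᵥ u := by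
    intro u v
    have hT : Gᵀ = G := by simpa [conjTranspose_eq_transpose_of_trivial] using hG.1.eq
    rw [dotProduct_mulVec, ← mulVec_transpose, hT, dotProduct_comm]
  have hpos : ∀ v : Fin d → ℝ, 0 ≤ v ⬝ᵥ G *ᵥ v := fun v => by
    simpa using hG.posSemidef.dotProduct_mulVec_nonneg v
  have hWy : W k ⬝ᵥ G *ᵥ y = q := by rw [hGy, hqN, dotProduct_comm]
  have hyy : y ⬝ᵥ G *ᵥ y = N k ⬝ᵥ y := by rw [hGy, dotProduct_comm]
  set α := W k ⬝ᵥ G *ᵥ W k with hα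
  have hαq : c * α ≤ q := hGH _
  have hsq : 0 ≤ (c • W k - y) ⬝ᵥ G *ᵥ (c • W k - y) := hpos _
  have hexp : (c • W k - y) ⬝ᵥ G *ᵥ (c • W k - y) = c ^ 2 * α - 2 * c * q + N k ⬝ᵥ y := by
    simp only [mulVec_sub, mulVec_smul, sub_dotProduct, dotProduct_sub, smul_dotProduct,
      dotProduct_smul, smul_eq_mul]
    rw [hsymm y (W k), hWy, hyy]
    ring
  rw [hexp] at hsq
  rw [div_mul_eq_mul_div, one_mul, le_div_iff₀ hc]
  nlinarith

lemma quasiNewton_error_le (h : IsExpansiveLink φ ζ) {G : Matrix (Fin d) (Fin d) ℝ}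
    (hG : G.PosDef) {c l : ℝ} (hc : 0 < c) (hl : 0 < l)
    (hGH : ∀ v : Fin d → ℝ, c * (v ⬝ᵥ G *ᵥ v) ≤ empiricalForm T x v)
    (hlG : ∀ v : Fin d → ℝ, l * ∑ j, v j ^ 2 ≤ v ⬝ᵥ G *ᵥ v) (m : ℕ) :
    frobeniusSq (quasiNewton φ T (1 / 4) x m - A) ≤ 1 / (c * l) *
      ((1 - ζ / 2) ^ m * (frobeniusSq A * ((1 / (T : ℝ)) * ∑ t ∈ Finset.range T, ‖x t‖ ^ 2)) +
        1 / (c * ζ ^ 2) * (noiseCorrelation φ A T x * G⁻¹ * (noiseCorrelation φ A T x)ᵀ).trace) := by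
  have hζ := h.zeta_pos
  have hζ1 := h.zeta_le_one
  -- The two lower bounds already force Ĝ to be invertible, so the default value 0 of the method
  -- does not occur.
  have hH : IsUnit (empiricalSecondMoment T x) := by
    refine Matrix.vecMul_injective_iff_isUnit.1 ?_
    intro v w hvw
    by_contra hne
    obtain ⟨k, hk⟩ := Function.ne_iff.1 (sub_ne_zero.2 hne)
    have h0 : empiricalForm T x (v - w) = 0 := by
      have := empiricalForm_row_eq (T := T) (x := x) (Matrix.of fun _ => v - w) k
      rw [Matrix.mul_apply_eq_vecMul] at this
      change empiricalForm T x (v - w) = ((v - w) ᵥ* _) ⬝ᵥ (v - w) at this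
      rw [this, Matrix.sub_vecMul, sub_eq_zero.2 hvw, zero_dotProduct]
    have h1 := hGH (v - w)
    have h2 := hlG (v - w)
    have h3 : 0 < ∑ j, (v - w) j ^ 2 :=
      Finset.sum_pos' (fun _ _ => sq_nonneg _) ⟨k, Finset.mem_univ _,
        (sq_nonneg _).lt_of_ne' (pow_ne_zero 2 hk)⟩
    have h4 := mul_pos hl h3
    have h5 := mul_pos hc (h4.trans_le h2)
    linarith
  have hrow : ∀ k, ∑ j, (quasiNewton φ T (1 / 4) x m - A) k j ^ 2 ≤ 1 / (c * l) *
      ((1 - ζ / 2) ^ m * ((∑ j, A k j ^ 2) * ((1 / (T : ℝ)) * ∑ t ∈ Finset.range T, ‖x t‖ ^ 2)) +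
        1 / (c * ζ ^ 2) * (noiseCorrelation φ A T x k ⬝ᵥ G⁻¹ *ᵥ noiseCorrelation φ A T x k)) := by
    intro k
    have hqn : quasiNewton φ T (1 / 4) x m = quasiNewtonIter φ T (1 / 4) x m := if_pos hH
    rw [hqn]
    have h1 := hlG ((quasiNewtonIter φ T (1 / 4) x m - A) k)
    have h2 := hGH ((quasiNewtonIter φ T (1 / 4) x m - A) k)
    have h3 := quasiNewtonIter_form_le (A := A) h hH m k
    have h4 := empiricalForm_noise_le hG hc hGH hH (noiseCorrelation φ A T x) k
    have h5 := empiricalForm_row_le (T := T) (x := x) (A k)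
    have h6 : 0 ≤ (1 - ζ / 2) ^ m := pow_nonneg (by linarith) _
    rw [div_mul_eq_mul_div, one_mul, le_div_iff₀ (by positivity)]
    calc _ = c * (l * ∑ j, (quasiNewtonIter φ T (1 / 4) x m - A) k j ^ 2) := by ring
      _ ≤ _ := mul_le_mul_of_nonneg_left h1 hc.le
      _ ≤ _ := h2
      _ ≤ _ := h3
      _ ≤ (1 - ζ / 2) ^ m * ((∑ j, A k j ^ 2) *
            ((1 / (T : ℝ)) * ∑ t ∈ Finset.range T, ‖x t‖ ^ 2)) + 1 / ζ ^ 2 *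
            (1 / c * (noiseCorrelation φ A T x k ⬝ᵥ G⁻¹ *ᵥ noiseCorrelation φ A T x k)) := by
          gcongr
      _ = _ := by field_simp
  refine (Finset.sum_le_sum fun k _ => hrow k).trans (le_of_eq ?_)
  rw [← Finset.mul_sum, Finset.sum_add_distrib, ← Finset.mul_sum, ← Finset.sum_mul,
    ← Finset.mul_sum]
  congr 3
  simp only [Matrix.trace, Matrix.diag, Matrix.mul_assoc]
  refine Finset.sum_congr rfl fun k _ => ?_
  rw [Matrix.mul_apply]
  refine Finset.sum_congr rfl fun i _ => ?_
  simp [mulVec, dotProduct, Matrix.mul_apply]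

end QuasiNewton

/-! ### σ-algebras generated by sets of noise vectors -/

section NoiseSigma

variable {d : ℕ} {φ : ℝ → ℝ} {A : Matrix (Fin d) (Fin d) ℝ} {Ω : Type*}
  {X₀ : Ω → EuclideanSpace ℝ (Fin d)} {η : ℕ → Ω → EuclideanSpace ℝ (Fin d)}

/-- The σ-algebra generated by the noise vectors with index in `I`. -/
abbrev noiseSigma (η : ℕ → Ω → EuclideanSpace ℝ (Fin d)) (I : Set ℕ) : MeasurableSpace Ω :=
  ⨆ t ∈ I, MeasurableSpace.comap (η t) inferInstance

lemma measurable_noiseSigma {I : Set ℕ} {t : ℕ} (ht : t ∈ I) : Measurable[noiseSigma η I] (η t) :=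
  Measurable.of_comap_le (le_iSup₂_of_le t ht le_rfl)

lemma measurable_traj_sigma (hφ : Continuous φ) (t : ℕ) :
    Measurable[MeasurableSpace.comap X₀ inferInstance ⊔ noiseSigma η (Set.Iio t)]
      fun ω => nldsTraj φ A (X₀ ω) (fun s => η s ω) t := by
  set m := MeasurableSpace.comap X₀ inferInstance ⊔ noiseSigma η (Set.Iio t)
  have h0 : Measurable[m] X₀ := Measurable.of_comap_le le_sup_left
  have h1 : ∀ i < t, Measurable[m] (η i) := fun i hi =>
    Measurable.of_comap_le ((measurable_noiseSigma (I := Set.Iio t) hi).comap_le.trans le_sup_right)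
  exact measurable_nldsTraj (e := η) hφ h0 h1

lemma measurable_restart_sigma (hφ : Continuous φ) (s k : ℕ) :
    Measurable[noiseSigma η (Set.Ico s (s + k))]
      fun ω => nldsRestart φ A (fun i => η i ω) s k := by
  set m := noiseSigma η (Set.Ico s (s + k))
  have h1 : ∀ i < k, Measurable[m] (η (s + i)) := fun i hi =>
    measurable_noiseSigma (I := Set.Ico s (s + k)) ⟨by omega, by omega⟩
  exact measurable_nldsRestart (e := η) hφ h1

end NoiseSigma

/-! ### Independence and stationarity along the trajectory -/

section Driving

variable {d : ℕ} {φ : ℝ → ℝ} {A : Matrix (Fin d) (Fin d) ℝ} {T : ℕ}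
  {μ π : Measure (EuclideanSpace ℝ (Fin d))}
  {Ω : Type*} [mΩ : MeasurableSpace Ω] {P : Measure Ω}
  {X₀ : Ω → EuclideanSpace ℝ (Fin d)} {η : ℕ → Ω → EuclideanSpace ℝ (Fin d)}

/-- Adjoining the initial state to the noise as index `none` gives a single independent family, to
which the independence of disjoint index sets applies. -/
lemma iIndepFun_option [IsProbabilityMeasure P] {β ι : Type*} [Fintype ι] [DecidableEq ι]
    [MeasurableSpace β] {X : Ω → β} {Y : ι → Ω → β}
    (hY : iIndepFun Y P) (hXY : IndepFun X (fun ω i => Y i ω) P) :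
    iIndepFun (fun (o : Option ι) => o.elim X Y) P := by
  classical
  rw [iIndepFun_iff_measure_inter_preimage_eq_mul]
  intro S sets hsets
  set s : Option ι → Set β := fun i => if i ∈ S then sets i else Set.univ with hs
  have hsm : ∀ i, MeasurableSet (s i) := fun i => by
    by_cases hi : i ∈ S
    · simpa [hs, hi] using hsets i hi
    · simp [hs, hi]
  set f : Option ι → Ω → β := fun o => o.elim X Y with hf
  have h1 : ⋂ i ∈ S, f i ⁻¹' sets i =
      X ⁻¹' s none ∩ (fun ω i => Y i ω) ⁻¹' (Set.univ.pi fun i => s (some i)) := by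
    ext ω
    simp only [Set.mem_iInter, Set.mem_preimage, Set.mem_inter_iff, Set.mem_univ_pi]
    constructor
    · intro h
      refine ⟨?_, fun i => ?_⟩
      · by_cases hi : none ∈ S
        · simpa [hs, hf, hi] using h none hi
        · simp [hs, hi]
      · by_cases hi : some i ∈ S
        · simpa [hs, hf, hi] using h (some i) hi
        · simp [hs, hi]
    · rintro ⟨h0, h1⟩ (_ | i) hi
      · simpa [hs, hf, hi] using h0
      · simpa [hs, hf, hi] using h1 i
  have h2 : (fun ω i => Y i ω) ⁻¹' (Set.univ.pi fun i => s (some i)) =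
      ⋂ i ∈ (Finset.univ : Finset ι), Y i ⁻¹' s (some i) := by
    ext ω; simp
  have h3 : ∏ i ∈ S, P (f i ⁻¹' sets i) = ∏ i : Option ι, P (f i ⁻¹' s i) := by
    rw [← Finset.prod_subset (Finset.subset_univ S)]
    · exact Finset.prod_congr rfl fun i hi => by simp [hs, hi]
    · intro i _ hi; simp [hs, hi]
  rw [h1, hXY.measure_inter_preimage_eq_mul _ _ (hsm none) (MeasurableSet.univ_pi fun i => hsm _),
    h2, hY.measure_inter_preimage_eq_mul Finset.univ (fun i _ => hsm (some i)), h3,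
    Fintype.prod_option]
  rfl

lemma IsDriving.indep [IsProbabilityMeasure P] (h : IsDriving T μ π P X₀ η) {I J : Set ℕ}
    (hI : ∀ t ∈ I, t < T) (hJ : ∀ t ∈ J, t < T) (hIJ : Disjoint I J) :
    Indep (MeasurableSpace.comap X₀ inferInstance ⊔ noiseSigma η I) (noiseSigma η J) P := by
  have hind := iIndepFun_option (X := X₀) (Y := fun t : Fin T => η t) h.indep_noise h.indep_init
  have hle : ∀ o : Option (Fin T), MeasurableSpace.comap
      (o.elim X₀ (fun t : Fin T => η t)) inferInstance ≤ mΩ := by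
    rintro (_ | t)
    · exact h.measurable_init.comap_le
    · exact (h.measurable_noise t t.2).comap_le
  have key := indep_iSup_of_disjoint (m := fun o : Option (Fin T) => MeasurableSpace.comap
      (o.elim X₀ (fun t : Fin T => η t)) inferInstance) hle hind
      (S := {o : Option (Fin T) | ∀ t, o = some t → (t : ℕ) ∈ I}) (T := {o : Option (Fin T) | ∃ t, o = some t ∧ (t : ℕ) ∈ J}) (by
        rw [Set.disjoint_left]
        rintro o ho ⟨t, rfl, ht⟩
        exact Set.disjoint_left.1 hIJ (ho t rfl) ht)
  refine indep_of_indep_of_le_left (indep_of_indep_of_le_right key ?_) ?_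
  · refine iSup₂_le fun t ht => ?_
    exact le_iSup₂_of_le (f := fun (o : Option (Fin T)) (_ : o ∈ {o : Option (Fin T) | ∃ t, o = some t ∧ (t : ℕ) ∈ J})
      => MeasurableSpace.comap (o.elim X₀ (fun t : Fin T => η t)) inferInstance)
      (some ⟨t, hJ t ht⟩) ⟨_, rfl, ht⟩ le_rfl
  · refine sup_le ?_ (iSup₂_le fun t ht => ?_)
    · exact le_iSup₂_of_le (f := fun (o : Option (Fin T))
        (_ : o ∈ {o : Option (Fin T) | ∀ t, o = some t → (t : ℕ) ∈ I})
        => MeasurableSpace.comap (o.elim X₀ (fun t : Fin T => η t)) inferInstance)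
        none (by simp) le_rfl
    · exact le_iSup₂_of_le (f := fun (o : Option (Fin T))
        (_ : o ∈ {o : Option (Fin T) | ∀ t, o = some t → (t : ℕ) ∈ I})
        => MeasurableSpace.comap (o.elim X₀ (fun t : Fin T => η t)) inferInstance)
        (some ⟨t, hI t ht⟩) (by rintro _ ⟨⟩; exact ht) le_rfl

lemma IsDriving.indepFun [IsProbabilityMeasure P] (h : IsDriving T μ π P X₀ η) {I J : Set ℕ}
    (hI : ∀ t ∈ I, t < T) (hJ : ∀ t ∈ J, t < T) (hIJ : Disjoint I J) {β γ : Type*}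
    [MeasurableSpace β] [MeasurableSpace γ] {f : Ω → β} {g : Ω → γ}
    (hf : Measurable[MeasurableSpace.comap X₀ inferInstance ⊔ noiseSigma η I] f)
    (hg : Measurable[noiseSigma η J] g) : IndepFun f g P :=
  indep_of_indep_of_le_left (indep_of_indep_of_le_right (h.indep hI hJ hIJ) hg.comap_le) hf.comap_le

lemma IsDriving.measurable_traj (h : IsDriving T μ π P X₀ η) (hφ : Continuous φ) {t : ℕ}
    (ht : t ≤ T) : Measurable fun ω => nldsTraj φ A (X₀ ω) (fun s => η s ω) t :=
  measurable_nldsTraj hφ h.measurable_init fun i hi => h.measurable_noise i (by omega)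

lemma IsDriving.measurable_restart (h : IsDriving T μ π P X₀ η) (hφ : Continuous φ) {s k : ℕ}
    (ht : s + k ≤ T) : Measurable fun ω => nldsRestart φ A (fun i => η i ω) s k :=
  measurable_nldsRestart hφ fun i hi => h.measurable_noise (s + i) (by omega)

lemma IsDriving.law_traj [IsProbabilityMeasure P] (h : IsDriving T μ π P X₀ η) (hφ : Continuous φ)
    (hπ : IsStationaryLaw φ A μ π) {t : ℕ} (ht : t ≤ T) :
    P.map (fun ω => nldsTraj φ A (X₀ ω) (fun s => η s ω) t) = π := by
  induction t with
  | zero => exact h.law_init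
  | succ t ih =>
    have hind : IndepFun (fun ω => nldsTraj φ A (X₀ ω) (fun s => η s ω) t) (η t) P :=
      h.indepFun (I := Set.Iio t) (J := {t}) (fun s hs => by simp at hs; omega)
        (fun s hs => by simp at hs; omega) (by simp) (measurable_traj_sigma hφ t)
        (measurable_noiseSigma rfl)
    have hm := h.measurable_traj (A := A) hφ (show t ≤ T by omega)
    have hn := h.measurable_noise t (by omega)
    rw [indepFun_iff_map_prod_eq_prod_map_map hm.aemeasurable hn.aemeasurable,
      ih (by omega), h.law_noise t (by omega)] at hind
    conv_rhs => rw [← hπ.invariant, ← hind]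
    rw [Measure.map_map _ (hm.prodMk hn)]
    · rfl
    · exact ((continuous_nldsMap hφ).measurable.comp measurable_fst).add measurable_snd

/-- An auxiliary noise sequence of unlimited length: the moment bounds for π let the number of steps
tend to infinity, whereas the given trajectory has only T of them. -/
lemma exists_isDriving (μ π : Measure (EuclideanSpace ℝ (Fin d))) [IsProbabilityMeasure μ]
    [IsProbabilityMeasure π] : ∃ (P : Measure (ℕ → EuclideanSpace ℝ (Fin d)))
      (_ : IsProbabilityMeasure P) (X₀ : (ℕ → EuclideanSpace ℝ (Fin d)) → EuclideanSpace ℝ (Fin d))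
      (η : ℕ → (ℕ → EuclideanSpace ℝ (Fin d)) → EuclideanSpace ℝ (Fin d)),
      ∀ T, IsDriving T μ π P X₀ η := by
  let ν : ℕ → Measure (EuclideanSpace ℝ (Fin d)) := fun n => if n = 0 then π else μ
  have hν : ∀ n, IsProbabilityMeasure (ν n) := fun n => by
    by_cases hn : n = 0 <;> simp only [ν, hn, if_true, if_false] <;> infer_instance
  have hind : iIndepFun (fun (i : ℕ) (ω : ℕ → EuclideanSpace ℝ (Fin d)) => ω i)
      (Measure.infinitePi ν) :=
    iIndepFun_infinitePi (P := ν) (X := fun _ x => x) (fun _ => measurable_id)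
  refine ⟨Measure.infinitePi ν, inferInstance, fun ω => ω 0, fun t ω => ω (t + 1), fun T => ?_⟩
  refine ⟨by fun_prop, fun t _ => by fun_prop, ?_, fun t _ => ?_, ?_, ?_⟩
  · exact Measure.infinitePi_map_eval ν 0
  · exact Measure.infinitePi_map_eval ν (t + 1)
  · exact hind.precomp (g := fun t : Fin T => (t : ℕ) + 1) fun a b hab => by
      simpa [Fin.ext_iff] using hab
  · have := hind.indepFun_finset {0} (Finset.Ico 1 (T + 1)) (by simp) (fun i => by fun_prop)
    exact this.comp (φ := fun f : ({0} : Finset ℕ) → EuclideanSpace ℝ (Fin d) => f ⟨0, by simp⟩)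
      (ψ := fun (f : (Finset.Ico 1 (T + 1)) → EuclideanSpace ℝ (Fin d)) (t : Fin T) =>
        f ⟨t + 1, by simp⟩) (by fun_prop) (by fun_prop)

end Driving

/-! ### Moments of restarted and of stationary states -/

section Moments

variable {d : ℕ} {φ : ℝ → ℝ} {A : Matrix (Fin d) (Fin d) ℝ} {T : ℕ} {C ρ : ℝ}
  {μ π : Measure (EuclideanSpace ℝ (Fin d))}
  {Ω : Type*} [mΩ : MeasurableSpace Ω] {P : Measure Ω} [IsProbabilityMeasure P]
  {X₀ : Ω → EuclideanSpace ℝ (Fin d)} {η : ℕ → Ω → EuclideanSpace ℝ (Fin d)}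

omit [IsProbabilityMeasure P] in
lemma IsDriving.integrable_noise_comp (h : IsDriving T μ π P X₀ η) {t : ℕ} (ht : t < T)
    {f : EuclideanSpace ℝ (Fin d) → ℝ} (hf : Integrable f μ) :
    Integrable (fun ω => f (η t ω)) P := by
  rw [← h.law_noise t ht] at hf
  exact hf.comp_measurable (h.measurable_noise t ht)

omit [IsProbabilityMeasure P] in
lemma IsDriving.integral_noise_comp (h : IsDriving T μ π P X₀ η) {t : ℕ} (ht : t < T)
    {f : EuclideanSpace ℝ (Fin d) → ℝ} (hf : Measurable f) :
    ∫ ω, f (η t ω) ∂P = ∫ x, f x ∂μ := by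
  rw [← h.law_noise t ht, integral_map (h.measurable_noise t ht).aemeasurable
    hf.aestronglyMeasurable]

lemma IsDriving.integrable_traj_comp (h : IsDriving T μ π P X₀ η) (hφ : Continuous φ)
    (hπ : IsStationaryLaw φ A μ π) {t : ℕ} (ht : t ≤ T)
    {f : EuclideanSpace ℝ (Fin d) → ℝ} (hf : Integrable f π) :
    Integrable (fun ω => f (nldsTraj φ A (X₀ ω) (fun s => η s ω) t)) P := by
  rw [← h.law_traj hφ hπ ht] at hf
  exact hf.comp_measurable (h.measurable_traj hφ ht)

lemma IsDriving.integral_traj_comp (h : IsDriving T μ π P X₀ η) (hφ : Continuous φ)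
    (hπ : IsStationaryLaw φ A μ π) {t : ℕ} (ht : t ≤ T)
    {f : EuclideanSpace ℝ (Fin d) → ℝ} (hf : Measurable f) :
    ∫ ω, f (nldsTraj φ A (X₀ ω) (fun s => η s ω) t) ∂P = ∫ x, f x ∂π := by
  rw [← h.law_traj hφ hπ ht, integral_map (h.measurable_traj hφ ht).aemeasurable
    hf.aestronglyMeasurable]

omit [IsProbabilityMeasure P] in
lemma IsDriving.restart_moment (h : IsDriving T μ π P X₀ η) (hφ : Continuous φ) (hφ0 : φ 0 = 0)
    (hreg : IsExpRegular φ A C ρ) (hC : 1 ≤ C) (hρ : 0 < ρ) (hρ1 : ρ < 1) {p : ℕ}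
    (hp : Integrable (fun x : EuclideanSpace ℝ (Fin d) => ‖x‖ ^ (p + 1)) μ) {s k : ℕ}
    (hsk : s + k ≤ T) :
    Integrable (fun ω => ‖nldsRestart φ A (fun i => η i ω) s k‖ ^ (p + 1)) P ∧
      ∫ ω, ‖nldsRestart φ A (fun i => η i ω) s k‖ ^ (p + 1) ∂P ≤
        (2 * C / (1 - ρ)) ^ (p + 1) * ∫ x, ‖x‖ ^ (p + 1) ∂μ := by
  have h1ρ : 0 < 1 - ρ := by linarith
  set S := 2 * C / (1 - ρ) with hS
  have hS0 : 0 ≤ S := by positivity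
  have hb : ∀ ω, ‖nldsRestart φ A (fun i => η i ω) s k‖ ^ (p + 1) ≤ S ^ p *
      ∑ i ∈ Finset.range k, C * ρ ^ (k - 1 - i - 1) * ‖η (s + i) ω‖ ^ (p + 1) := fun ω =>
    hreg.norm_restart_pow_le hφ0 hC hρ hρ1 (fun i => η i ω) s k p
  have hint1 : ∀ i ∈ Finset.range k, Integrable (fun ω =>
      C * ρ ^ (k - 1 - i - 1) * ‖η (s + i) ω‖ ^ (p + 1)) P := fun i hi =>
    (h.integrable_noise_comp (by simp at hi; omega) hp).const_mul _
  have hint : Integrable (fun ω => S ^ p *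
      ∑ i ∈ Finset.range k, C * ρ ^ (k - 1 - i - 1) * ‖η (s + i) ω‖ ^ (p + 1)) P :=
    (integrable_finsetSum _ hint1).const_mul _
  have hm := h.measurable_restart (A := A) hφ hsk
  have hmp : Integrable (fun ω => ‖nldsRestart φ A (fun i => η i ω) s k‖ ^ (p + 1)) P := by
    refine hint.mono' (hm.norm.pow_const _).aestronglyMeasurable (ae_of_all _ fun ω => ?_)
    rw [Real.norm_of_nonneg (by positivity)]
    exact hb ω
  refine ⟨hmp, (integral_mono hmp hint hb).trans ?_⟩
  rw [integral_const_mul, integral_finsetSum _ hint1]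
  have hμ0 : 0 ≤ ∫ x, ‖x‖ ^ (p + 1) ∂μ := integral_nonneg fun _ => by positivity
  have : ∑ i ∈ Finset.range k, ∫ ω, C * ρ ^ (k - 1 - i - 1) * ‖η (s + i) ω‖ ^ (p + 1) ∂P =
      (∑ i ∈ Finset.range k, C * ρ ^ (k - 1 - i - 1)) * ∫ x, ‖x‖ ^ (p + 1) ∂μ := by
    rw [Finset.sum_mul]
    refine Finset.sum_congr rfl fun i hi => ?_
    rw [integral_const_mul, h.integral_noise_comp (t := s + i) (f := fun x => ‖x‖ ^ (p + 1))
      (by simp at hi; omega) (by fun_prop)]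
  rw [this, pow_succ S p, mul_assoc]
  gcongr
  exact sum_regularity_weights_le (by linarith) hρ hρ1 k

/-- Monotone convergence along truncations; it serves where integrability is not known beforehand.
-/
lemma integrable_of_integral_min_le {α : Type*} [MeasurableSpace α] {ν : Measure α}
    [IsFiniteMeasure ν] {f : α → ℝ} (hf : Measurable f) (h0 : ∀ x, 0 ≤ f x) {K : ℝ}
    (hK : ∀ M : ℕ, ∫ x, min (f x) M ∂ν ≤ K) : Integrable f ν ∧ ∫ x, f x ∂ν ≤ K := by
  have hmin : ∀ M : ℕ, Measurable fun x => min (f x) (M : ℝ) := fun M => by fun_prop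
  have hmin0 : ∀ (M : ℕ) x, 0 ≤ min (f x) (M : ℝ) := fun M x => le_min (h0 x) M.cast_nonneg
  have hint : ∀ M : ℕ, Integrable (fun x => min (f x) (M : ℝ)) ν := fun M =>
    Integrable.of_bound (hmin M).aestronglyMeasurable (M : ℝ) (ae_of_all _ fun x => by
      rw [Real.norm_of_nonneg (hmin0 M x)]; exact min_le_right _ _)
  have hK0 : 0 ≤ K := (integral_nonneg (hmin0 0)).trans (hK 0)
  have hlim : Filter.Tendsto (fun M : ℕ => ∫⁻ x, ENNReal.ofReal (min (f x) M) ∂ν) Filter.atTop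
      (nhds (∫⁻ x, ENNReal.ofReal (f x) ∂ν)) := by
    refine lintegral_tendsto_of_tendsto_of_monotone
      (fun M => (hmin M).ennreal_ofReal.aemeasurable) (ae_of_all _ fun x M M' hM => ?_)
      (ae_of_all _ fun x => ?_)
    · exact ENNReal.ofReal_le_ofReal (min_le_min le_rfl (by exact_mod_cast hM))
    · refine tendsto_const_nhds.congr' ?_
      obtain ⟨M₀, hM₀⟩ := exists_nat_ge (f x)
      filter_upwards [Filter.eventually_ge_atTop M₀] with M hM
      rw [min_eq_left (hM₀.trans (by exact_mod_cast hM))]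
  have hle : ∫⁻ x, ENNReal.ofReal (f x) ∂ν ≤ ENNReal.ofReal K := by
    refine le_of_tendsto' hlim fun M => ?_
    rw [← ofReal_integral_eq_lintegral_ofReal (hint M) (ae_of_all _ (hmin0 M))]
    exact ENNReal.ofReal_le_ofReal (hK M)
  have hfi : Integrable f ν :=
    ⟨hf.aestronglyMeasurable, by
      rw [hasFiniteIntegral_iff_ofReal (ae_of_all _ h0)]
      exact hle.trans_lt ENNReal.ofReal_lt_top⟩
  refine ⟨hfi, ?_⟩
  rwa [← ofReal_integral_eq_lintegral_ofReal hfi (ae_of_all _ h0),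
    ENNReal.ofReal_le_ofReal_iff hK0] at hle

/-- No moment of π is assumed. By stationarity π is also the law of the state after k + 1 steps,
which is within Cρᵏ‖X₀‖ of the state restarted from 0. Once truncated at M, the contribution of X₀
vanishes as k → ∞ by dominated convergence. -/
lemma IsStationaryLaw.moment [IsProbabilityMeasure μ] (hπ : IsStationaryLaw φ A μ π)
    (hφ : Continuous φ) (hφ0 : φ 0 = 0)
    (hreg : IsExpRegular φ A C ρ) (hC : 1 ≤ C) (hρ : 0 < ρ) (hρ1 : ρ < 1) {p : ℕ}
    (hp : Integrable (fun x : EuclideanSpace ℝ (Fin d) => ‖x‖ ^ (p + 1)) μ) :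
    Integrable (fun x : EuclideanSpace ℝ (Fin d) => ‖x‖ ^ (p + 1)) π ∧
      ∫ x, ‖x‖ ^ (p + 1) ∂π ≤
        2 ^ p * ((2 * C / (1 - ρ)) ^ (p + 1) * ∫ x, ‖x‖ ^ (p + 1) ∂μ) := by
  have := hπ.prob
  obtain ⟨P, hP, X₀, η, hD⟩ := exists_isDriving μ π
  refine integrable_of_integral_min_le (by fun_prop) (fun x => by positivity) fun M => ?_
  set K := (2 * C / (1 - ρ)) ^ (p + 1) * ∫ x, ‖x‖ ^ (p + 1) ∂μ with hK
  set b : ℕ → (ℕ → EuclideanSpace ℝ (Fin d)) → ℝ := fun k ω =>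
    min (2 ^ p * (C * ρ ^ k * ‖X₀ ω‖) ^ (p + 1)) M with hb
  have hX₀ := (hD 0).measurable_init
  have hbm : ∀ k, Measurable (b k) := fun k => by
    have := hX₀.norm
    simp only [hb]; fun_prop
  have hb0 : ∀ k ω, 0 ≤ b k ω := fun k ω => le_min (by positivity) M.cast_nonneg
  have hbM : ∀ k ω, ‖b k ω‖ ≤ M := fun k ω => by
    rw [Real.norm_of_nonneg (hb0 k ω)]; exact min_le_right _ _
  have hbi : ∀ k, Integrable (b k) P := fun k =>
    Integrable.of_bound (hbm k).aestronglyMeasurable (M : ℝ) (ae_of_all _ (hbM k))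
  have hstep : ∀ k : ℕ, ∫ x, min (‖x‖ ^ (p + 1)) (M : ℝ) ∂π ≤ 2 ^ p * K + ∫ ω, b k ω ∂P := by
    intro k
    have hY := (hD (k + 1)).restart_moment hφ hφ0 hreg hC hρ hρ1 hp (s := 0) (k := k + 1) (by simp)
    rw [← (hD (k + 1)).integral_traj_comp (f := fun x => min (‖x‖ ^ (p + 1)) (M : ℝ)) hφ hπ le_rfl
      (by fun_prop)]
    have hmX := (hD (k + 1)).measurable_traj (A := A) hφ (le_refl (k + 1))
    refine (integral_mono (Integrable.of_bound (C := (M : ℝ))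
      ((hmX.norm.pow_const _).min measurable_const).aestronglyMeasurable
      (ae_of_all _ fun ω => ?_)) ((hY.1.const_mul (2 ^ p)).add (hbi k)) fun ω => ?_).trans ?_
    · rw [Real.norm_of_nonneg (le_min (by positivity) M.cast_nonneg)]
      exact min_le_right _ _
    · have h1 := hreg.norm_traj_sub_restart_le (Nat.le_add_left 1 k) 0 (X₀ ω) (fun i => η i ω)
      rw [zero_add, Nat.add_sub_cancel] at h1
      change _ ≤ C * ρ ^ k * ‖X₀ ω‖ at h1
      have h2 : ‖nldsTraj φ A (X₀ ω) (fun s => η s ω) (k + 1)‖ ≤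
          ‖nldsRestart φ A (fun i => η i ω) 0 (k + 1)‖ + C * ρ ^ k * ‖X₀ ω‖ := by
        have := norm_le_norm_add_norm_sub' (nldsTraj φ A (X₀ ω) (fun s => η s ω) (k + 1))
          (nldsRestart φ A (fun i => η i ω) 0 (k + 1))
        linarith
      have h3 : ‖nldsTraj φ A (X₀ ω) (fun s => η s ω) (k + 1)‖ ^ (p + 1) ≤ 2 ^ p *
          (‖nldsRestart φ A (fun i => η i ω) 0 (k + 1)‖ ^ (p + 1) +
            (C * ρ ^ k * ‖X₀ ω‖) ^ (p + 1)) :=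
        (pow_le_pow_left₀ (norm_nonneg _) h2 _).trans
          (add_pow_le (norm_nonneg _) (by positivity) (p + 1))
      -- Only the part due to X₀ keeps the truncation: min(y + z, M) ≤ y + min(z, M) for y ≥ 0.
      have h4 : 0 ≤ 2 ^ p * ‖nldsRestart φ A (fun i => η i ω) 0 (k + 1)‖ ^ (p + 1) := by positivity
      simp only [Pi.add_apply, hb]
      rw [← min_add_add_left]
      exact min_le_min (by linarith) (by linarith)
    · rw [integral_add' (hY.1.const_mul (2 ^ p)) (hbi k), integral_const_mul]
      have := hY.2
      gcongr
  have hlim : Filter.Tendsto (fun k => 2 ^ p * K + ∫ ω, b k ω ∂P) Filter.atTop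
      (nhds (2 ^ p * K + ∫ _, (0 : ℝ) ∂P)) := by
    refine tendsto_const_nhds.add (tendsto_integral_of_dominated_convergence (fun _ => (M : ℝ))
      (fun k => (hbm k).aestronglyMeasurable) (integrable_const _)
      (fun k => ae_of_all _ (hbM k)) (ae_of_all _ fun ω => ?_))
    have h0 : Filter.Tendsto (fun k : ℕ => C * ρ ^ k * ‖X₀ ω‖) Filter.atTop (nhds 0) := by
      simpa using ((tendsto_pow_atTop_nhds_zero_of_lt_one hρ.le hρ1).const_mul C).mul_const ‖X₀ ω‖
    have h1 : Filter.Tendsto (fun k => b k ω) Filter.atTop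
        (nhds (min (2 ^ p * 0 ^ (p + 1)) (M : ℝ))) :=
      ((h0.pow (p + 1)).const_mul _).min tendsto_const_nhds
    simpa using h1
  simpa using ge_of_tendsto' hlim hstep

end Moments

/-! ### The second moment matrix and G ≽ σ²I -/

section SecondMoment

open Matrix

variable {d : ℕ} {φ : ℝ → ℝ} {A : Matrix (Fin d) (Fin d) ℝ} {T : ℕ} {C ρ σ : ℝ}
  {μ π : Measure (EuclideanSpace ℝ (Fin d))}
  {Ω : Type*} [mΩ : MeasurableSpace Ω] {P : Measure Ω} [IsProbabilityMeasure P]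
  {X₀ : Ω → EuclideanSpace ℝ (Fin d)} {η : ℕ → Ω → EuclideanSpace ℝ (Fin d)}

lemma dotProduct_sq_le (u : Fin d → ℝ) (x : EuclideanSpace ℝ (Fin d)) :
    (u ⬝ᵥ x.ofLp) ^ 2 ≤ (∑ j, u j ^ 2) * ‖x‖ ^ 2 := by
  rw [EuclideanSpace.norm_sq_eq]
  simp only [Real.norm_eq_abs, sq_abs]
  exact Finset.sum_mul_sq_le_sq_mul_sq _ _ _

lemma measurable_dotProduct_ofLp (u : Fin d → ℝ) :
    Measurable fun x : EuclideanSpace ℝ (Fin d) => u ⬝ᵥ x.ofLp := by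
  unfold dotProduct; fun_prop

lemma integrable_dotProduct_sq {ν : Measure (EuclideanSpace ℝ (Fin d))}
    (hν : Integrable (fun x => ‖x‖ ^ 2) ν) (u : Fin d → ℝ) :
    Integrable (fun x => (u ⬝ᵥ x.ofLp) ^ 2) ν :=
  (hν.const_mul (∑ j, u j ^ 2)).mono'
    ((measurable_dotProduct_ofLp u).pow_const 2).aestronglyMeasurable (ae_of_all _ fun x => by
      rw [Real.norm_of_nonneg (sq_nonneg _)]; exact dotProduct_sq_le u x)

lemma integrable_norm_of_sq {ν : Measure (EuclideanSpace ℝ (Fin d))} [IsFiniteMeasure ν]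
    (hν : Integrable (fun x => ‖x‖ ^ 2) ν) : Integrable (fun x => ‖x‖) ν :=
  (hν.add (integrable_const 1)).mono' measurable_norm.aestronglyMeasurable
    (ae_of_all _ fun x => by
      rw [norm_norm, Pi.add_apply]; nlinarith [sq_nonneg (‖x‖ - 1)])

lemma integrable_coord_mul {ν : Measure (EuclideanSpace ℝ (Fin d))}
    (hν : Integrable (fun x => ‖x‖ ^ 2) ν) (i j : Fin d) :
    Integrable (fun x => x i * x j) ν :=
  hν.mono' (by fun_prop) (ae_of_all _ fun x => by
    rw [norm_mul, sq]
    gcongr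
    · exact PiLp.norm_apply_le x i
    · exact PiLp.norm_apply_le x j)

lemma secondMoment_form {ν : Measure (EuclideanSpace ℝ (Fin d))}
    (hν : Integrable (fun x => ‖x‖ ^ 2) ν) (u : Fin d → ℝ) :
    u ⬝ᵥ secondMoment ν *ᵥ u = ∫ x, (u ⬝ᵥ x.ofLp) ^ 2 ∂ν := by
  have h : ∀ x : EuclideanSpace ℝ (Fin d), (u ⬝ᵥ x.ofLp) ^ 2 =
      ∑ i, ∑ j, u i * u j * (x i * x j) := fun x => by
    rw [sq, dotProduct, Finset.sum_mul_sum]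
    exact Finset.sum_congr rfl fun i _ => Finset.sum_congr rfl fun j _ => by ring
  have hi : ∀ i j, Integrable (fun x : EuclideanSpace ℝ (Fin d) => u i * u j * (x i * x j)) ν :=
    fun i j => (integrable_coord_mul hν i j).const_mul _
  simp_rw [h]
  rw [integral_finsetSum _ fun i _ => integrable_finsetSum _ fun j _ => hi i j]
  rw [dotProduct]
  refine Finset.sum_congr rfl fun i _ => ?_
  rw [integral_finsetSum _ fun j _ => hi i j, mulVec, dotProduct, Finset.mul_sum]
  refine Finset.sum_congr rfl fun j _ => ?_
  rw [integral_const_mul]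
  simp only [secondMoment, Matrix.of_apply]
  ring

lemma IsNoiseLaw.integrable_sq (h : IsNoiseLaw μ σ) : Integrable (fun x => ‖x‖ ^ 2) μ := by
  have := h.prob
  refine (h.fourth_moment.add (integrable_const 1)).mono' (by fun_prop) (ae_of_all _ fun x => ?_)
  rw [Real.norm_of_nonneg (by positivity), Pi.add_apply]
  nlinarith [sq_nonneg (‖x‖ ^ 2 - 1)]

lemma IsNoiseLaw.form (h : IsNoiseLaw μ σ) (u : Fin d → ℝ) :
    ∫ x, (u ⬝ᵥ x.ofLp) ^ 2 ∂μ = σ ^ 2 * ∑ i, u i ^ 2 := by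
  have h1 : secondMoment μ = σ ^ 2 • (1 : Matrix (Fin d) (Fin d) ℝ) := by
    ext i j
    simp [secondMoment, h.covariance, Matrix.one_apply]
  rw [← secondMoment_form h.integrable_sq, h1, smul_mulVec, one_mulVec, dotProduct_smul,
    smul_eq_mul]
  simp [dotProduct, sq]

lemma IsNoiseLaw.integral_norm_sq (h : IsNoiseLaw μ σ) : ∫ x, ‖x‖ ^ 2 ∂μ = d * σ ^ 2 := by
  simp_rw [EuclideanSpace.norm_sq_eq, Real.norm_eq_abs, sq_abs, sq]
  rw [integral_finsetSum _ fun i _ => integrable_coord_mul h.integrable_sq i i]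
  simp [h.covariance, sq]

lemma sq_integral_norm_sq_le {ν : Measure (EuclideanSpace ℝ (Fin d))} [IsProbabilityMeasure ν]
    (h2 : Integrable (fun x => ‖x‖ ^ 2) ν) (h4 : Integrable (fun x => ‖x‖ ^ 4) ν) :
    (∫ x, ‖x‖ ^ 2 ∂ν) ^ 2 ≤ ∫ x, ‖x‖ ^ 4 ∂ν := by
  set a := ∫ x, ‖x‖ ^ 2 ∂ν with ha
  have h : ∫ x : EuclideanSpace ℝ (Fin d), (2 * a * ‖x‖ ^ 2 - a ^ 2) ∂ν ≤ ∫ x, ‖x‖ ^ 4 ∂ν :=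
    integral_mono ((h2.const_mul _).sub (integrable_const _)) h4 fun x => by
      nlinarith [sq_nonneg (‖x‖ ^ 2 - a)]
  rw [integral_sub (h2.const_mul _) (integrable_const _), integral_const_mul, ← ha] at h
  simp at h
  nlinarith

/-- This lets M₄ absorb the second-moment terms in the choice of the block length. -/
lemma IsNoiseLaw.sq_le_fourthMoment (h : IsNoiseLaw μ σ) :
    (d : ℝ) ^ 2 * σ ^ 4 ≤ fourthMoment μ := by
  have := h.prob
  have h1 := sq_integral_norm_sq_le h.integrable_sq h.fourth_moment
  rw [h.integral_norm_sq] at h1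
  calc _ = (d * σ ^ 2) ^ 2 := by ring
    _ ≤ _ := h1

lemma IsExpRegular.norm_nldsMap_le (hreg : IsExpRegular φ A C ρ) (hφ0 : φ 0 = 0)
    (x : EuclideanSpace ℝ (Fin d)) : ‖nldsMap φ A x‖ ≤ C * ‖x‖ := by
  simpa [nldsTraj, nldsMap_zero hφ0] using hreg 0 x 0 0

/-- X has the law of φ(AX) + η. The cross term integrates to zero by independence and centring, and
the square of the first summand is discarded. -/
lemma IsStationaryLaw.sq_le_form (hπ : IsStationaryLaw φ A μ π) (hμ : IsNoiseLaw μ σ)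
    (hφ : Continuous φ) (hφ0 : φ 0 = 0) (hreg : IsExpRegular φ A C ρ)
    (h2 : Integrable (fun x => ‖x‖ ^ 2) π) (u : Fin d → ℝ) :
    σ ^ 2 * ∑ i, u i ^ 2 ≤ ∫ x, (u ⬝ᵥ x.ofLp) ^ 2 ∂π := by
  have := hπ.prob
  have := hμ.prob
  have hf := (continuous_nldsMap (A := A) hφ).measurable
  have hdot : ∀ x : EuclideanSpace ℝ (Fin d), |u ⬝ᵥ x.ofLp| ≤ √(∑ j, u j ^ 2) * ‖x‖ := fun x =>
    abs_le_of_sq_le_sq (by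
      rw [mul_pow, Real.sq_sqrt (Finset.sum_nonneg fun _ _ => sq_nonneg _)]
      exact dotProduct_sq_le u x) (by positivity)
  have hi1 : Integrable (fun x : EuclideanSpace ℝ (Fin d) => u ⬝ᵥ (nldsMap φ A x).ofLp) π := by
    refine ((integrable_norm_of_sq h2).const_mul (√(∑ j, u j ^ 2) * C)).mono'
      ((measurable_dotProduct_ofLp u).comp hf).aestronglyMeasurable (ae_of_all _ fun x => ?_)
    rw [mul_assoc]
    exact (hdot _).trans (mul_le_mul_of_nonneg_left (hreg.norm_nldsMap_le hφ0 x) (Real.sqrt_nonneg _))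
  have hi2 : Integrable (fun x : EuclideanSpace ℝ (Fin d) => u ⬝ᵥ x.ofLp) μ :=
    ((integrable_norm_of_sq hμ.integrable_sq).const_mul (√(∑ j, u j ^ 2))).mono'
      (measurable_dotProduct_ofLp u).aestronglyMeasurable (ae_of_all _ hdot)
  have hmean : ∫ x, u ⬝ᵥ x.ofLp ∂μ = 0 := by
    simp only [dotProduct]
    rw [integral_finsetSum]
    · simp [integral_const_mul, hμ.mean_zero]
    · intro i _
      refine ((integrable_norm_of_sq hμ.integrable_sq).mono' (by fun_prop)
        (ae_of_all _ fun x => PiLp.norm_apply_le x i)).const_mul _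
  have hmap : Measurable fun p : EuclideanSpace ℝ (Fin d) × EuclideanSpace ℝ (Fin d) =>
      nldsMap φ A p.1 + p.2 := (hf.comp measurable_fst).add measurable_snd
  have hsq := integrable_dotProduct_sq h2 u
  rw [← hπ.invariant] at hsq
  have hsq' := hsq.comp_measurable hmap
  have hcross := hi1.mul_prod hi2
  have hnoise : Integrable (fun p : EuclideanSpace ℝ (Fin d) × EuclideanSpace ℝ (Fin d) =>
      (u ⬝ᵥ p.2.ofLp) ^ 2) (π.prod μ) :=
    (integrable_dotProduct_sq hμ.integrable_sq u).comp_snd π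
  rw [← hμ.form u, ← hπ.invariant, integral_map hmap.aemeasurable
    ((measurable_dotProduct_ofLp u).pow_const 2).aestronglyMeasurable]
  have hle : ∫ p, (2 * ((u ⬝ᵥ (nldsMap φ A p.1).ofLp) * (u ⬝ᵥ p.2.ofLp)) + (u ⬝ᵥ p.2.ofLp) ^ 2)
      ∂(π.prod μ) ≤ ∫ p, (u ⬝ᵥ (nldsMap φ A p.1 + p.2).ofLp) ^ 2 ∂(π.prod μ) := by
    refine integral_mono ((hcross.const_mul 2).add hnoise) hsq' fun p => ?_
    simp only [WithLp.ofLp_add, dotProduct_add]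
    nlinarith [sq_nonneg (u ⬝ᵥ (nldsMap φ A p.1).ofLp)]
  refine le_trans (le_of_eq ?_) hle
  rw [integral_add (hcross.const_mul 2) hnoise, integral_const_mul,
    integral_prod_mul (fun x : EuclideanSpace ℝ (Fin d) => u ⬝ᵥ (nldsMap φ A x).ofLp)
      (fun x : EuclideanSpace ℝ (Fin d) => u ⬝ᵥ x.ofLp), hmean,
    integral_fun_snd (μ := π) (ν := μ) (fun x : EuclideanSpace ℝ (Fin d) => (u ⬝ᵥ x.ofLp) ^ 2)]
  simp

lemma posDef_secondMoment {ν : Measure (EuclideanSpace ℝ (Fin d))}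
    (hν : Integrable (fun x => ‖x‖ ^ 2) ν) (hσ : 0 < σ)
    (h : ∀ u : Fin d → ℝ, σ ^ 2 * ∑ i, u i ^ 2 ≤ ∫ x, (u ⬝ᵥ x.ofLp) ^ 2 ∂ν) :
    (secondMoment ν).PosDef := by
  refine Matrix.PosDef.of_dotProduct_mulVec_pos ?_ fun u hu => ?_
  · ext i j
    simp [secondMoment, mul_comm]
  · rw [star_trivial, secondMoment_form hν]
    refine lt_of_lt_of_le ?_ (h u)
    obtain ⟨k, hk⟩ := Function.ne_iff.1 hu
    exact mul_pos (by positivity) (Finset.sum_pos' (fun _ _ => sq_nonneg _) ⟨k, Finset.mem_univ _,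
        (sq_nonneg _).lt_of_ne' (pow_ne_zero 2 hk)⟩)

lemma Matrix.PosDef.lambdaMin_pos {G : Matrix (Fin d) (Fin d) ℝ} (hG : G.PosDef) (hd : 1 ≤ d) :
    0 < lambdaMin G := by
  have : Nonempty (Fin d) := ⟨⟨0, hd⟩⟩
  have hfin : (spectrum ℝ G).Finite := by
    rw [hG.1.spectrum_real_eq_range_eigenvalues]; exact Set.finite_range _
  have hne : (spectrum ℝ G).Nonempty := by
    rw [hG.1.spectrum_real_eq_range_eigenvalues]; exact Set.range_nonempty _
  have hmem := hne.csInf_mem hfin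
  rw [hG.1.spectrum_real_eq_range_eigenvalues] at hmem
  obtain ⟨i, hi⟩ := hmem
  unfold lambdaMin
  rw [hG.1.spectrum_real_eq_range_eigenvalues, ← hi]
  exact hG.eigenvalues_pos i

lemma Matrix.IsHermitian.lambdaMin_mul_le {G : Matrix (Fin d) (Fin d) ℝ} (hG : G.IsHermitian)
    (u : Fin d → ℝ) : lambdaMin G * ∑ i, u i ^ 2 ≤ u ⬝ᵥ G *ᵥ u := by
  have hfin : (spectrum ℝ G).Finite := by
    rw [hG.spectrum_real_eq_range_eigenvalues]; exact Set.finite_range _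
  have hpsd : (G - algebraMap ℝ (Matrix (Fin d) (Fin d) ℝ) (lambdaMin G)).PosSemidef := by
    rw [Matrix.posSemidef_iff_isHermitian_and_spectrum_nonneg]
    refine ⟨hG.sub ?_, ?_⟩
    · rw [Algebra.algebraMap_eq_smul_one]
      ext i j
      simp [Matrix.one_apply, eq_comm]
    · rw [← spectrum.sub_singleton_eq]
      rintro _ ⟨a, ha, _, rfl, rfl⟩
      exact sub_nonneg.2 (csInf_le hfin.bddBelow ha)
  have := hpsd.dotProduct_mulVec_nonneg u
  rw [star_trivial, Matrix.sub_mulVec, dotProduct_sub, Algebra.algebraMap_eq_smul_one,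
    smul_mulVec, one_mulVec, dotProduct_smul, smul_eq_mul] at this
  have h2 : u ⬝ᵥ u = ∑ i, u i ^ 2 := Finset.sum_congr rfl fun i _ => (sq _).symm
  rw [h2] at this
  linarith

end SecondMoment

/-! ### Measurability of products of coordinates -/

section Coordinates

variable {d : ℕ} {Ω : Type*} {m : MeasurableSpace Ω} {a b c : Ω → EuclideanSpace ℝ (Fin d)}

lemma measurable_coord (ha : Measurable a) (k : Fin d) : Measurable fun ω => a ω k :=
  (by fun_prop : Measurable fun x : EuclideanSpace ℝ (Fin d) => x k).comp ha

lemma measurable_coord_mul_mul (ha : Measurable a) (hb : Measurable b) (hc : Measurable c)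
    (k i j : Fin d) : Measurable fun ω => (a ω k * b ω i) * c ω j :=
  ((measurable_coord ha k).mul (measurable_coord hb i)).mul (measurable_coord hc j)

lemma measurable_noise_coord_sigma {Ω : Type*} {η : ℕ → Ω → EuclideanSpace ℝ (Fin d)} (t : ℕ)
    (k : Fin d) : Measurable[noiseSigma η {t}] fun ω => η t ω k :=
  measurable_coord (m := noiseSigma η {t}) (measurable_noiseSigma rfl) k

lemma measurable_noise_state_state {Ω : Type*} {φ : ℝ → ℝ} {A : Matrix (Fin d) (Fin d) ℝ}
    {X₀ : Ω → EuclideanSpace ℝ (Fin d)} {η : ℕ → Ω → EuclideanSpace ℝ (Fin d)}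
    (hφ : Continuous φ) {s t : ℕ} (hst : s < t) (k i j : Fin d) :
    Measurable[MeasurableSpace.comap X₀ inferInstance ⊔ noiseSigma η (Set.Iio t)]
      fun ω => (η s ω k * nldsTraj φ A (X₀ ω) (fun s => η s ω) s i) *
        nldsTraj φ A (X₀ ω) (fun s => η s ω) t j := by
  refine measurable_coord_mul_mul
    (m := MeasurableSpace.comap X₀ inferInstance ⊔ noiseSigma η (Set.Iio t))
    (a := η s) (b := fun ω => nldsTraj φ A (X₀ ω) (fun s => η s ω) s)
    (c := fun ω => nldsTraj φ A (X₀ ω) (fun s => η s ω) t) ?_ ?_ (measurable_traj_sigma hφ t) k i j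
  · exact Measurable.of_comap_le
      ((measurable_noiseSigma (I := Set.Iio t) hst).comap_le.trans le_sup_right)
  · exact Measurable.of_comap_le ((measurable_traj_sigma hφ s).comap_le.trans
      (sup_le_sup_left (biSup_mono fun r hr => lt_trans hr hst) _))

end Coordinates

/-! ### Exact covariance of the noise correlation -/

section NoiseCorrelation

open Matrix

variable {d : ℕ} {φ : ℝ → ℝ} {A : Matrix (Fin d) (Fin d) ℝ} {T : ℕ} {σ : ℝ}
  {μ π : Measure (EuclideanSpace ℝ (Fin d))}
  {Ω : Type*} [mΩ : MeasurableSpace Ω] {P : Measure Ω} [IsProbabilityMeasure P]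
  {X₀ : Ω → EuclideanSpace ℝ (Fin d)} {η : ℕ → Ω → EuclideanSpace ℝ (Fin d)}

lemma IsDriving.indepFun_traj_noise (h : IsDriving T μ π P X₀ η) (hφ : Continuous φ) {t : ℕ}
    (ht : t < T) :
    IndepFun (fun ω => nldsTraj φ A (X₀ ω) (fun s => η s ω) t) (η t) P :=
  h.indepFun (I := Set.Iio t) (J := {t}) (fun s hs => by simp at hs; omega)
    (fun s hs => by simp at hs; omega) (by simp) (measurable_traj_sigma hφ t)
    (measurable_noiseSigma rfl)

lemma IsDriving.integrable_noise_mul_state_sq (h : IsDriving T μ π P X₀ η) (hφ : Continuous φ)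
    (hπ : IsStationaryLaw φ A μ π) (hμ2 : Integrable (fun x => ‖x‖ ^ 2) μ)
    (hπ2 : Integrable (fun x => ‖x‖ ^ 2) π) {t : ℕ} (ht : t < T) (k i j : Fin d) :
    Integrable (fun ω => (η t ω k * η t ω k) *
      (nldsTraj φ A (X₀ ω) (fun s => η s ω) t i * nldsTraj φ A (X₀ ω) (fun s => η s ω) t j)) P ∧
    ∫ ω, (η t ω k * η t ω k) *
      (nldsTraj φ A (X₀ ω) (fun s => η s ω) t i * nldsTraj φ A (X₀ ω) (fun s => η s ω) t j) ∂P =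
      (∫ x, x k * x k ∂μ) * secondMoment π i j := by
  have hind := ((h.indepFun_traj_noise (A := A) hφ ht).comp
    (φ := fun x : EuclideanSpace ℝ (Fin d) => x i * x j)
    (ψ := fun x : EuclideanSpace ℝ (Fin d) => x k * x k) (by fun_prop) (by fun_prop)).symm
  have h1 := h.integrable_noise_comp ht (integrable_coord_mul hμ2 k k)
  have h2 := h.integrable_traj_comp hφ hπ ht.le (integrable_coord_mul hπ2 i j)
  refine ⟨hind.integrable_mul h1 h2, ?_⟩
  refine (hind.integral_mul_eq_mul_integral h1.1 h2.1).trans ?_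
  rw [← h.integral_noise_comp ht (f := fun x => x k * x k) (by fun_prop)]
  congr 1
  exact h.integral_traj_comp hφ hπ ht.le (f := fun x => x i * x j) (by fun_prop)

omit [IsProbabilityMeasure P] in
lemma integrable_mul_of_integrable_sq {a b : Ω → ℝ} (ha : AEStronglyMeasurable a P)
    (hb : AEStronglyMeasurable b P) (ha2 : Integrable (fun ω => a ω ^ 2) P)
    (hb2 : Integrable (fun ω => b ω ^ 2) P) : Integrable (fun ω => a ω * b ω) P :=
  (ha2.add hb2).mono' (ha.mul hb) (ae_of_all _ fun ω => by
    rw [Pi.add_apply, Real.norm_eq_abs, abs_mul, ← sq_abs (a ω), ← sq_abs (b ω)]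
    nlinarith [sq_nonneg (|a ω| - |b ω|), sq_nonneg (|a ω|), sq_nonneg (|b ω|)])

/-- Orthogonality of martingale differences: for s < t the vector η_t is centred and independent of
X₀, η_0, …, η_{t−1}, which determine the other three factors. Integrability of the products follows
from the diagonal terms. -/
lemma IsDriving.noise_state_covariance (h : IsDriving T μ π P X₀ η) (hφ : Continuous φ)
    (hπ : IsStationaryLaw φ A μ π) (hμ : IsNoiseLaw μ σ)
    (hπ2 : Integrable (fun x => ‖x‖ ^ 2) π) {s t : ℕ} (hs : s < T) (ht : t < T) (k i j : Fin d) :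
    Integrable (fun ω => (η s ω k * nldsTraj φ A (X₀ ω) (fun s => η s ω) s i) *
      (η t ω k * nldsTraj φ A (X₀ ω) (fun s => η s ω) t j)) P ∧
    ∫ ω, (η s ω k * nldsTraj φ A (X₀ ω) (fun s => η s ω) s i) *
      (η t ω k * nldsTraj φ A (X₀ ω) (fun s => η s ω) t j) ∂P =
      if s = t then σ ^ 2 * secondMoment π i j else 0 := by
  have hη : ∀ t < T, ∀ k : Fin d, Measurable fun ω => η t ω k := fun t ht k =>
    measurable_coord (h.measurable_noise t ht) k
  have hX : ∀ t < T, ∀ i : Fin d,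
      Measurable fun ω => nldsTraj φ A (X₀ ω) (fun s => η s ω) t i := fun t ht i =>
    measurable_coord (h.measurable_traj hφ ht.le) i
  have hsq : ∀ t < T, ∀ i : Fin d,
      Integrable (fun ω => (η t ω k * nldsTraj φ A (X₀ ω) (fun s => η s ω) t i) ^ 2) P := by
    intro t ht i
    refine (h.integrable_noise_mul_state_sq hφ hπ hμ.integrable_sq hπ2 ht k i i).1.congr
      (ae_of_all _ fun ω => ?_)
    ring
  have hint : ∀ s < T, ∀ t < T, ∀ i j : Fin d,
      Integrable (fun ω => (η s ω k * nldsTraj φ A (X₀ ω) (fun s => η s ω) s i) *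
      (η t ω k * nldsTraj φ A (X₀ ω) (fun s => η s ω) t j)) P := fun s hs t ht i j =>
    integrable_mul_of_integrable_sq ((hη s hs k).mul (hX s hs i)).aestronglyMeasurable
      ((hη t ht k).mul (hX t ht j)).aestronglyMeasurable (hsq s hs i) (hsq t ht j)
  have hlt : ∀ s < T, ∀ t < T, s < t → ∀ i j : Fin d,
      ∫ ω, (η s ω k * nldsTraj φ A (X₀ ω) (fun s => η s ω) s i) *
      (η t ω k * nldsTraj φ A (X₀ ω) (fun s => η s ω) t j) ∂P = 0 := by
    intro s hs t ht hst i j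
    have hind := h.indepFun (I := Set.Iio t) (J := {t}) (fun s hs => by simp at hs; omega)
      (fun s hs => by simp at hs; omega) (by simp)
      (measurable_noise_state_state (A := A) hφ hst k i j) (measurable_noise_coord_sigma t k)
    have h0 : ∫ ω, η t ω k ∂P = 0 := by
      rw [h.integral_noise_comp ht (f := fun x => x k) (by fun_prop), hμ.mean_zero]
    have := hind.integral_mul_eq_mul_integral
      (((hη s hs k).mul (hX s hs i)).mul (hX t ht j)).aestronglyMeasurable
      (hη t ht k).aestronglyMeasurable
    rw [h0, mul_zero] at this
    rw [← this]
    refine integral_congr_ae (ae_of_all _ fun ω => ?_)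
    simp only [Pi.mul_apply]
    ring
  refine ⟨hint s hs t ht i j, ?_⟩
  rcases lt_trichotomy s t with hst | rfl | hst
  · rw [if_neg hst.ne, hlt s hs t ht hst]
  · rw [if_pos rfl]
    have := (h.integrable_noise_mul_state_sq hφ hπ hμ.integrable_sq hπ2 ht k i j).2
    rw [hμ.covariance, if_pos rfl] at this
    rw [← this]
    refine integral_congr_ae (ae_of_all _ fun ω => ?_)
    ring
  · rw [if_neg hst.ne', ← hlt t ht s hs hst j i]
    refine integral_congr_ae (ae_of_all _ fun ω => ?_)
    ring

lemma noiseCorrelation_traj (x : EuclideanSpace ℝ (Fin d)) (e : ℕ → EuclideanSpace ℝ (Fin d))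
    (k i : Fin d) : noiseCorrelation φ A T (nldsTraj φ A x e) k i =
      (1 / (T : ℝ)) * ∑ t ∈ Finset.range T, e t k * nldsTraj φ A x e t i := by
  simp [noiseCorrelation, Matrix.sum_apply, vecMulVec_apply, nldsTraj]

lemma IsDriving.noiseCorrelation_covariance (h : IsDriving T μ π P X₀ η) (hφ : Continuous φ)
    (hπ : IsStationaryLaw φ A μ π) (hμ : IsNoiseLaw μ σ)
    (hπ2 : Integrable (fun x => ‖x‖ ^ 2) π) (hT : 1 ≤ T) (k i j : Fin d) :
    Integrable (fun ω => noiseCorrelation φ A T (nldsTraj φ A (X₀ ω) fun s => η s ω) k i *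
      noiseCorrelation φ A T (nldsTraj φ A (X₀ ω) fun s => η s ω) k j) P ∧
    ∫ ω, noiseCorrelation φ A T (nldsTraj φ A (X₀ ω) fun s => η s ω) k i *
      noiseCorrelation φ A T (nldsTraj φ A (X₀ ω) fun s => η s ω) k j ∂P =
      σ ^ 2 / T * secondMoment π i j := by
  have hT0 : (T : ℝ) ≠ 0 := by positivity
  have hexp : ∀ ω, noiseCorrelation φ A T (nldsTraj φ A (X₀ ω) fun s => η s ω) k i *
      noiseCorrelation φ A T (nldsTraj φ A (X₀ ω) fun s => η s ω) k j =
      (1 / (T : ℝ)) ^ 2 * ∑ s ∈ Finset.range T, ∑ t ∈ Finset.range T,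
        (η s ω k * nldsTraj φ A (X₀ ω) (fun s => η s ω) s i) *
      (η t ω k * nldsTraj φ A (X₀ ω) (fun s => η s ω) t j) := by
    intro ω
    rw [noiseCorrelation_traj, noiseCorrelation_traj, ← Finset.sum_mul_sum]
    ring
  simp_rw [hexp]
  have hc := fun s (hs : s ∈ Finset.range T) t (ht : t ∈ Finset.range T) =>
    h.noise_state_covariance hφ hπ hμ hπ2 (Finset.mem_range.1 hs) (Finset.mem_range.1 ht) k i j
  have hi : ∀ s ∈ Finset.range T, Integrable (fun ω => ∑ t ∈ Finset.range T,
        (η s ω k * nldsTraj φ A (X₀ ω) (fun s => η s ω) s i) *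
      (η t ω k * nldsTraj φ A (X₀ ω) (fun s => η s ω) t j)) P := fun s hs =>
    integrable_finsetSum _ fun t ht => (hc s hs t ht).1
  refine ⟨(integrable_finsetSum _ hi).const_mul _, ?_⟩
  rw [integral_const_mul, integral_finsetSum _ hi]
  have : ∀ s ∈ Finset.range T, ∫ ω, ∑ t ∈ Finset.range T,
        (η s ω k * nldsTraj φ A (X₀ ω) (fun s => η s ω) s i) *
      (η t ω k * nldsTraj φ A (X₀ ω) (fun s => η s ω) t j) ∂P = σ ^ 2 * secondMoment π i j := by
    intro s hs
    rw [integral_finsetSum _ fun t ht => (hc s hs t ht).1,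
      Finset.sum_congr rfl fun t ht => (hc s hs t ht).2, Finset.sum_ite_eq, if_pos hs]
  rw [Finset.sum_congr rfl this, Finset.sum_const, Finset.card_range, nsmul_eq_mul]
  field_simp

/-- Each of the d rows of N has second moment matrix (σ²/T)G and contributes (σ²/T) tr(GG⁻¹) =
dσ²/T. -/
lemma IsDriving.integral_trace_noiseCorrelation (h : IsDriving T μ π P X₀ η) (hφ : Continuous φ)
    (hπ : IsStationaryLaw φ A μ π) (hμ : IsNoiseLaw μ σ)
    (hπ2 : Integrable (fun x => ‖x‖ ^ 2) π) (hT : 1 ≤ T) (hG : (secondMoment π).PosDef) :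
    Integrable (fun ω => (noiseCorrelation φ A T (nldsTraj φ A (X₀ ω) fun s => η s ω) *
      (secondMoment π)⁻¹ *
      (noiseCorrelation φ A T (nldsTraj φ A (X₀ ω) fun s => η s ω))ᵀ).trace) P ∧
    ∫ ω, (noiseCorrelation φ A T (nldsTraj φ A (X₀ ω) fun s => η s ω) * (secondMoment π)⁻¹ *
      (noiseCorrelation φ A T (nldsTraj φ A (X₀ ω) fun s => η s ω))ᵀ).trace ∂P =
      d ^ 2 * σ ^ 2 / T := by
  have hGdet := (Matrix.isUnit_iff_isUnit_det _).1 hG.isUnit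
  set G := secondMoment π with hGdef
  have hexp : ∀ N : Matrix (Fin d) (Fin d) ℝ, (N * G⁻¹ * Nᵀ).trace =
      ∑ k, ∑ i, ∑ j, G⁻¹ j i * (N k j * N k i) := by
    intro N
    simp only [Matrix.trace, Matrix.diag, Matrix.mul_apply, Matrix.transpose_apply,
      Finset.sum_mul]
    refine Finset.sum_congr rfl fun k _ => Finset.sum_congr rfl fun i _ =>
      Finset.sum_congr rfl fun j _ => by ring
  simp_rw [hexp]
  have hc := fun k i j => h.noiseCorrelation_covariance hφ hπ hμ hπ2 hT k i j
  have hi3 := fun k i j => (hc k j i).1.const_mul (G⁻¹ j i)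
  have hi2 := fun k i => integrable_finsetSum Finset.univ fun j _ => hi3 k i j
  have hi1 := fun k => integrable_finsetSum Finset.univ fun i _ => hi2 k i
  refine ⟨integrable_finsetSum Finset.univ fun k _ => hi1 k, ?_⟩
  rw [integral_finsetSum _ fun k _ => hi1 k]
  have hk : ∀ k, ∫ ω, ∑ i, ∑ j, G⁻¹ j i *
      (noiseCorrelation φ A T (nldsTraj φ A (X₀ ω) fun s => η s ω) k j *
        noiseCorrelation φ A T (nldsTraj φ A (X₀ ω) fun s => η s ω) k i) ∂P =
      σ ^ 2 / T * d := by
    intro k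
    rw [integral_finsetSum _ fun i _ => hi2 k i]
    have hi : ∀ i, ∫ ω, ∑ j, G⁻¹ j i *
      (noiseCorrelation φ A T (nldsTraj φ A (X₀ ω) fun s => η s ω) k j *
        noiseCorrelation φ A T (nldsTraj φ A (X₀ ω) fun s => η s ω) k i) ∂P =
        σ ^ 2 / T * ∑ j, G i j * G⁻¹ j i := by
      intro i
      rw [integral_finsetSum _ fun j _ => hi3 k i j, Finset.mul_sum]
      refine Finset.sum_congr rfl fun j _ => ?_
      have hs : G j i = G i j := by simp [hGdef, secondMoment, mul_comm]
      rw [integral_const_mul, (hc k j i).2, ← hGdef, hs]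
      ring
    simp_rw [hi]
    rw [← Finset.mul_sum]
    have h1 : ∀ i, ∑ j, G i j * G⁻¹ j i = 1 := fun i => by
      rw [← Matrix.mul_apply, Matrix.mul_nonsing_inv _ hGdet, Matrix.one_apply_eq]
    simp [h1]
  simp_rw [hk]
  simp
  ring

end NoiseCorrelation

/-! ### An exponential lower tail from two moments -/

section LowerTail

variable {Ω : Type*} [mΩ : MeasurableSpace Ω] {P : Measure Ω} [IsProbabilityMeasure P]

lemma integrable_of_integrable_sq {V : Ω → ℝ} (hm : Measurable V)
    (h2 : Integrable (fun ω => V ω ^ 2) P) : Integrable V P :=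
  (h2.add (integrable_const 1)).mono' hm.aestronglyMeasurable (ae_of_all _ fun ω => by
    rw [Real.norm_eq_abs, Pi.add_apply, ← sq_abs]
    nlinarith [sq_nonneg (|V ω| - 1), abs_nonneg (V ω)])

lemma integrable_exp_neg_mul {V : Ω → ℝ} (hm : Measurable V) (h0 : ∀ ω, 0 ≤ V ω) {l : ℝ}
    (hl : 0 ≤ l) : Integrable (fun ω => Real.exp (-l * V ω)) P :=
  Integrable.of_bound (C := 1) (by fun_prop) (ae_of_all _ fun ω => by
    rw [Real.norm_of_nonneg (Real.exp_nonneg _), Real.exp_le_one_iff]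
    have := mul_nonneg hl (h0 ω)
    linarith)

/-- (1 − x + x²/2)(1 + x + x²/2) = 1 + x⁴/4 ≥ 1, and the second factor is at most eˣ. -/
lemma exp_neg_le_quadratic {x : ℝ} (hx : 0 ≤ x) : Real.exp (-x) ≤ 1 - x + x ^ 2 / 2 := by
  have h := Real.quadratic_le_exp_of_nonneg hx
  rw [Real.exp_neg]
  have hpos : 0 < 1 - x + x ^ 2 / 2 := by nlinarith [sq_nonneg (x - 1)]
  rw [inv_le_comm₀ (Real.exp_pos _) hpos]
  refine le_trans ?_ h
  rw [inv_le_iff_one_le_mul₀ hpos]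
  nlinarith [sq_nonneg (x ^ 2)]

lemma mgf_neg_le {V : Ω → ℝ} (hm : Measurable V) (h0 : ∀ ω, 0 ≤ V ω)
    (h2 : Integrable (fun ω => V ω ^ 2) P) {a b l : ℝ} (hl : 0 ≤ l) (ha : a ≤ ∫ ω, V ω ∂P)
    (hb : ∫ ω, V ω ^ 2 ∂P ≤ b) : mgf V P (-l) ≤ Real.exp (-l * a + l ^ 2 * b / 2) := by
  have h1 := integrable_of_integrable_sq hm h2
  have hi0 : Integrable (fun ω => 1 - l * V ω) P := (integrable_const 1).sub (h1.const_mul l)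
  have hi : Integrable (fun ω => 1 - l * V ω + l ^ 2 / 2 * V ω ^ 2) P :=
    hi0.add (h2.const_mul _)
  have hle : mgf V P (-l) ≤ ∫ ω, (1 - l * V ω + l ^ 2 / 2 * V ω ^ 2) ∂P := by
    refine integral_mono (integrable_exp_neg_mul hm h0 hl) hi fun ω => ?_
    have := exp_neg_le_quadratic (mul_nonneg hl (h0 ω))
    simp only [neg_mul]
    refine this.trans (le_of_eq ?_)
    ring
  rw [integral_add hi0 (h2.const_mul _),
    integral_sub (integrable_const 1) (h1.const_mul l), integral_const_mul, integral_const_mul]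
    at hle
  simp only [integral_const, probReal_univ, smul_eq_mul, mul_one] at hle
  refine hle.trans (le_trans ?_ (Real.add_one_le_exp _))
  have e1 := mul_le_mul_of_nonneg_left ha hl
  have e2 := mul_le_mul_of_nonneg_left hb (by positivity : 0 ≤ l ^ 2 / 2)
  linarith

lemma measurable_range_sum {Ω : Type*} {m : MeasurableSpace Ω} {V : ℕ → Ω → ℝ} {n : ℕ}
    (hm : ∀ j < n, Measurable (V j)) : Measurable (∑ j ∈ Finset.range n, V j) := by
  have := Finset.measurable_sum (f := V) (Finset.range n) fun j hj => hm j (Finset.mem_range.1 hj)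
  convert this using 1
  ext ω
  simp

/-- A lower tail bound for sums of independent nonnegative random variables with bounded second
moments. -/
lemma measure_sum_le_le_exp {V : ℕ → Ω → ℝ} {N : ℕ} (hm : ∀ j < N, Measurable (V j))
    (h0 : ∀ j ω, 0 ≤ V j ω) (h2 : ∀ j < N, Integrable (fun ω => V j ω ^ 2) P) {a b : ℝ}
    (ha0 : 0 ≤ a) (hb0 : 0 < b)
    (ha : ∀ j < N, a ≤ ∫ ω, V j ω ∂P) (hb : ∀ j < N, ∫ ω, V j ω ^ 2 ∂P ≤ b)
    (hind : ∀ n < N, IndepFun (∑ j ∈ Finset.range n, V j) (V n) P) :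
    P.real {ω | ∑ j ∈ Finset.range N, V j ω ≤ N * a / 2} ≤
      Real.exp (-(N * a ^ 2 / (8 * b))) := by
  -- The minimiser of −la/2 + l²b/2, the Chernoff exponent per summand at the level a/2; the minimum
  -- is −a²/(8b).
  set l := a / (2 * b) with hl
  have hl0 : 0 ≤ l := by positivity
  have hmgf : ∀ n ≤ N, mgf (∑ j ∈ Finset.range n, V j) P (-l) ≤
      Real.exp (n * (-l * a + l ^ 2 * b / 2)) := by
    intro n hn
    induction n with
    | zero => simp [mgf]
    | succ n ih =>
      have hms : Measurable (∑ j ∈ Finset.range n, V j) :=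
        measurable_range_sum fun j hj => hm j (by omega)
      have hs0 : ∀ ω, 0 ≤ (∑ j ∈ Finset.range n, V j) ω := fun ω => by
        rw [Finset.sum_apply]; exact Finset.sum_nonneg fun j _ => h0 j ω
      rw [Finset.sum_range_succ, (hind n (by omega)).mgf_add
        (integrable_exp_neg_mul hms hs0 hl0).aestronglyMeasurable
        (integrable_exp_neg_mul (hm n (by omega)) (h0 n) hl0).aestronglyMeasurable]
      have e : ((n + 1 : ℕ) : ℝ) * (-l * a + l ^ 2 * b / 2) =
          n * (-l * a + l ^ 2 * b / 2) + (-l * a + l ^ 2 * b / 2) := by push_cast; ring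
      rw [e, Real.exp_add]
      exact mul_le_mul (ih (by omega)) (mgf_neg_le (hm n (by omega)) (h0 n) (h2 n (by omega)) hl0
        (ha n (by omega)) (hb n (by omega))) mgf_nonneg (Real.exp_nonneg _)
  have hms : Measurable (∑ j ∈ Finset.range N, V j) :=
    measurable_range_sum hm
  have hs0 : ∀ ω, 0 ≤ (∑ j ∈ Finset.range N, V j) ω := fun ω => by
    rw [Finset.sum_apply]; exact Finset.sum_nonneg fun j _ => h0 j ω
  have hch := measure_le_le_exp_mul_mgf (μ := P) (X := ∑ j ∈ Finset.range N, V j)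
    (N * a / 2) (neg_nonpos.2 hl0) (integrable_exp_neg_mul hms hs0 hl0)
  simp only [Finset.sum_apply] at hch
  refine hch.trans ((mul_le_mul_of_nonneg_left (hmgf N le_rfl) (Real.exp_nonneg _)).trans ?_)
  rw [← Real.exp_add]
  refine Real.exp_le_exp.2 (le_of_eq ?_)
  rw [hl]
  field_simp
  ring

end LowerTail

/-! ### Restarted states compared with stationary ones -/

section Blocks

variable {d : ℕ} {φ : ℝ → ℝ} {A : Matrix (Fin d) (Fin d) ℝ} {T : ℕ} {C ρ σ : ℝ}
  {μ π : Measure (EuclideanSpace ℝ (Fin d))}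
  {Ω : Type*} [mΩ : MeasurableSpace Ω] {P : Measure Ω} [IsProbabilityMeasure P]
  {X₀ : Ω → EuclideanSpace ℝ (Fin d)} {η : ℕ → Ω → EuclideanSpace ℝ (Fin d)}

lemma sq_dotProduct_le_of_norm_sub_le {u : Fin d → ℝ} {U b : ℝ} (hU : ∑ i, u i ^ 2 ≤ U)
    {x y : EuclideanSpace ℝ (Fin d)} (hxy : ‖x - y‖ ≤ b) :
    (u ⬝ᵥ x.ofLp) ^ 2 ≤ 2 * (u ⬝ᵥ y.ofLp) ^ 2 + 2 * (U * b ^ 2) := by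
  have h1 := dotProduct_sq_le u (x - y)
  have h2 : ‖x - y‖ ^ 2 ≤ b ^ 2 := pow_le_pow_left₀ (norm_nonneg _) hxy 2
  have hU0 : 0 ≤ U := (Finset.sum_nonneg fun _ _ => sq_nonneg _).trans hU
  have h3 : (∑ i, u i ^ 2) * ‖x - y‖ ^ 2 ≤ U * b ^ 2 := by gcongr
  rw [WithLp.ofLp_sub, dotProduct_sub] at h1
  nlinarith [sq_nonneg (u ⬝ᵥ x.ofLp - 2 * (u ⬝ᵥ y.ofLp))]

/-- The hypotheses on the system that are in force throughout the concentration argument. -/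
structure IsRegularSystem (φ : ℝ → ℝ) (A : Matrix (Fin d) (Fin d) ℝ) (C ρ σ : ℝ)
    (μ π : Measure (EuclideanSpace ℝ (Fin d))) : Prop where
  continuous : Continuous φ
  map_zero : φ 0 = 0
  regular : IsExpRegular φ A C ρ
  one_le : 1 ≤ C
  rho_pos : 0 < ρ
  rho_lt_one : ρ < 1
  noise : IsNoiseLaw μ σ
  stationary : IsStationaryLaw φ A μ π

/-- The bound `(2C/(1-ρ))² d σ²` for the second moment of the state started at `0`. -/
noncomputable def stateSecondMomentBound (d : ℕ) (C ρ σ : ℝ) : ℝ :=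
  (2 * C / (1 - ρ)) ^ 2 * (d * σ ^ 2)

/-- The bound `(2C/(1-ρ))⁴ M₄` for the fourth moment of the state started at `0`. -/
noncomputable def stateFourthMomentBound (C ρ : ℝ) (μ : Measure (EuclideanSpace ℝ (Fin d))) : ℝ :=
  (2 * C / (1 - ρ)) ^ 4 * fourthMoment μ

namespace IsRegularSystem

variable (hs : IsRegularSystem φ A C ρ σ μ π) (h : IsDriving T μ π P X₀ η)
include hs

lemma stationary_sq : Integrable (fun x => ‖x‖ ^ 2) π ∧
    ∫ x, ‖x‖ ^ 2 ∂π ≤ 2 * stateSecondMomentBound d C ρ σ := by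
  have := hs.noise.prob
  have := hs.stationary.moment hs.continuous hs.map_zero hs.regular hs.one_le hs.rho_pos
    hs.rho_lt_one (p := 1) hs.noise.integrable_sq
  simpa [hs.noise.integral_norm_sq, stateSecondMomentBound] using this

include h

omit [IsProbabilityMeasure P] in
lemma restart_fourth {s k : ℕ} (hsk : s + k ≤ T) :
    Integrable (fun ω => ‖nldsRestart φ A (fun i => η i ω) s k‖ ^ 4) P ∧
      ∫ ω, ‖nldsRestart φ A (fun i => η i ω) s k‖ ^ 4 ∂P ≤ stateFourthMomentBound C ρ μ :=
  h.restart_moment hs.continuous hs.map_zero hs.regular hs.one_le hs.rho_pos hs.rho_lt_one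
    (p := 3) hs.noise.fourth_moment hsk

omit [IsProbabilityMeasure P] in
lemma measurable_restart_form {s k : ℕ} (hsk : s + k ≤ T) (u : Fin d → ℝ) :
    Measurable fun ω => (u ⬝ᵥ (nldsRestart φ A (fun i => η i ω) s k).ofLp) ^ 2 :=
  ((measurable_dotProduct_ofLp u).comp (h.measurable_restart hs.continuous hsk)).pow_const 2

omit [IsProbabilityMeasure P] in
lemma integrable_restart_form_sq {s k : ℕ} (hsk : s + k ≤ T) (u : Fin d → ℝ) :
    Integrable (fun ω => ((u ⬝ᵥ (nldsRestart φ A (fun i => η i ω) s k).ofLp) ^ 2) ^ 2) P := by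
  refine ((hs.restart_fourth h hsk).1.const_mul ((∑ i, u i ^ 2) ^ 2)).mono'
    ((hs.measurable_restart_form h hsk u).pow_const 2).aestronglyMeasurable
    (ae_of_all _ fun ω => ?_)
  rw [Real.norm_of_nonneg (by positivity)]
  refine (pow_le_pow_left₀ (sq_nonneg _) (dotProduct_sq_le u _) 2).trans (le_of_eq ?_)
  ring

lemma integrable_restart_form {s k : ℕ} (hsk : s + k ≤ T) (u : Fin d → ℝ) :
    Integrable (fun ω => (u ⬝ᵥ (nldsRestart φ A (fun i => η i ω) s k).ofLp) ^ 2) P :=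
  integrable_of_integrable_sq (hs.measurable_restart_form h hsk u)
    (hs.integrable_restart_form_sq h hsk u)

variable {u : Fin d → ℝ} {U : ℝ} (hU : ∑ i, u i ^ 2 ≤ U)
  (hu : ∫ x, (u ⬝ᵥ x.ofLp) ^ 2 ∂π = 1)
include hU hu

/-- The stationary state has form 1 in direction u, and the restarted state differs from it by at
most Cρ^(k−1)‖X_s‖. The remainder is kept explicit because the upper bound is also needed at short
times k, where it is not small. -/
lemma restart_form_bounds {s k : ℕ} (hk : 1 ≤ k) (hsk : s + k ≤ T) :
    ∫ ω, (u ⬝ᵥ (nldsRestart φ A (fun i => η i ω) s k).ofLp) ^ 2 ∂P ≤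
      2 + 4 * U * stateSecondMomentBound d C ρ σ * C ^ 2 * (ρ ^ (k - 1)) ^ 2 ∧
    1 ≤ 2 * ∫ ω, (u ⬝ᵥ (nldsRestart φ A (fun i => η i ω) s k).ofLp) ^ 2 ∂P +
      4 * U * stateSecondMomentBound d C ρ σ * C ^ 2 * (ρ ^ (k - 1)) ^ 2 := by
  have hC := hs.one_le
  have hρ := hs.rho_pos
  have hU0 : 0 ≤ U := (Finset.sum_nonneg fun _ _ => sq_nonneg _).trans hU
  have hi1 := h.integrable_traj_comp hs.continuous hs.stationary hsk
    (integrable_dotProduct_sq hs.stationary_sq.1 u)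
  have hi2 := h.integrable_traj_comp hs.continuous hs.stationary (show s ≤ T by omega)
    hs.stationary_sq.1
  have hi3 := hs.integrable_restart_form h hsk u
  have he1 := h.integral_traj_comp hs.continuous hs.stationary hsk
    (f := fun x => (u ⬝ᵥ x.ofLp) ^ 2) ((measurable_dotProduct_ofLp u).pow_const 2)
  have he2 := h.integral_traj_comp hs.continuous hs.stationary (show s ≤ T by omega)
    (f := fun x => ‖x‖ ^ 2) (by fun_prop)
  rw [hu] at he1
  have hb : ∀ ω, _ := fun ω => hs.regular.norm_traj_sub_restart_le hk s (X₀ ω) (fun i => η i ω)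
  have hrem : 2 * (U * ((C * ρ ^ (k - 1)) ^ 2 * ∫ x, ‖x‖ ^ 2 ∂π)) ≤
      4 * U * stateSecondMomentBound d C ρ σ * C ^ 2 * (ρ ^ (k - 1)) ^ 2 := by
    calc _ ≤ 2 * (U * ((C * ρ ^ (k - 1)) ^ 2 * (2 * stateSecondMomentBound d C ρ σ))) := by
          have := hs.stationary_sq.2
          gcongr
      _ = _ := by ring
  have hi4 := ((hi2.const_mul ((C * ρ ^ (k - 1)) ^ 2)).const_mul U).const_mul 2
  constructor
  · have hle := integral_mono hi3 ((hi1.const_mul 2).add hi4) fun ω => by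
      have := sq_dotProduct_le_of_norm_sub_le hU ((norm_sub_rev _ _).trans_le (hb ω))
      simpa only [Pi.add_apply, mul_pow] using this
    rw [integral_add' (hi1.const_mul 2) hi4] at hle
    simp only [integral_const_mul] at hle
    rw [he1, he2] at hle
    linarith
  · have hle := integral_mono hi1 ((hi3.const_mul 2).add hi4) fun ω => by
      have := sq_dotProduct_le_of_norm_sub_le hU (hb ω)
      simpa only [Pi.add_apply, mul_pow] using this
    rw [integral_add' (hi3.const_mul 2) hi4] at hle
    simp only [integral_const_mul] at hle
    rw [he1, he2] at hle
    linarith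

omit hu in
-- Approximate decoupling at lag l: restarting afresh at time r + k makes the second factor
-- independent of the first. The replacement costs Cρ^(l−1) times the norm of the state at r + k,
-- which is why a fourth moment appears.
lemma restart_form_mul_le {r k l : ℕ} (hl : 1 ≤ l) (hT : r + (k + l) ≤ T) :
    ∫ ω, (u ⬝ᵥ (nldsRestart φ A (fun i => η i ω) r k).ofLp) ^ 2 *
        (u ⬝ᵥ (nldsRestart φ A (fun i => η i ω) r (k + l)).ofLp) ^ 2 ∂P ≤
      2 * ((∫ ω, (u ⬝ᵥ (nldsRestart φ A (fun i => η i ω) r k).ofLp) ^ 2 ∂P) *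
        ∫ ω, (u ⬝ᵥ (nldsRestart φ A (fun i => η i ω) (r + k) l).ofLp) ^ 2 ∂P) +
      2 * U ^ 2 * C ^ 2 * (ρ ^ (l - 1)) ^ 2 * stateFourthMomentBound C ρ μ := by
  have hC := hs.one_le
  have hρ := hs.rho_pos
  have hU0 : 0 ≤ U := (Finset.sum_nonneg fun _ _ => sq_nonneg _).trans hU
  have hk : r + k ≤ T := by omega
  have hkl : r + k + l ≤ T := by omega
  have hi := fun {s k : ℕ} (hsk : s + k ≤ T) => hs.integrable_restart_form h hsk u
  have hprod : Integrable (fun ω => (u ⬝ᵥ (nldsRestart φ A (fun i => η i ω) r k).ofLp) ^ 2 *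
        (u ⬝ᵥ (nldsRestart φ A (fun i => η i ω) r (k + l)).ofLp) ^ 2) P :=
    integrable_mul_of_integrable_sq (hi hk).1 (hi hT).1
      (hs.integrable_restart_form_sq h hk u) (hs.integrable_restart_form_sq h hT u)
  have hprod' : Integrable (fun ω => (u ⬝ᵥ (nldsRestart φ A (fun i => η i ω) r k).ofLp) ^ 2 *
        (u ⬝ᵥ (nldsRestart φ A (fun i => η i ω) (r + k) l).ofLp) ^ 2) P :=
    integrable_mul_of_integrable_sq (hi hk).1 (hi hkl).1
      (hs.integrable_restart_form_sq h hk u) (hs.integrable_restart_form_sq h hkl u)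
  have hind : IndepFun (fun ω => nldsRestart φ A (fun i => η i ω) r k)
      (fun ω => nldsRestart φ A (fun i => η i ω) (r + k) l) P :=
    h.indepFun (I := Set.Ico r (r + k)) (J := Set.Ico (r + k) (r + k + l))
      (fun t ht => by simp at ht; omega) (fun t ht => by simp at ht; omega)
      (by rw [Set.disjoint_left]; intro t ht ht'; simp at ht ht'; omega)
      (Measurable.of_comap_le ((measurable_restart_sigma hs.continuous r k).comap_le.trans
        le_sup_right))
      (measurable_restart_sigma hs.continuous (r + k) l)
  have hmul : ∫ ω, (u ⬝ᵥ (nldsRestart φ A (fun i => η i ω) r k).ofLp) ^ 2 *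
        (u ⬝ᵥ (nldsRestart φ A (fun i => η i ω) (r + k) l).ofLp) ^ 2 ∂P =
      (∫ ω, (u ⬝ᵥ (nldsRestart φ A (fun i => η i ω) r k).ofLp) ^ 2 ∂P) *
        ∫ ω, (u ⬝ᵥ (nldsRestart φ A (fun i => η i ω) (r + k) l).ofLp) ^ 2 ∂P :=
    (hind.comp ((measurable_dotProduct_ofLp u).pow_const 2)
      ((measurable_dotProduct_ofLp u).pow_const 2)).integral_mul_eq_mul_integral
      (hi hk).1 (hi hkl).1
  have h4 := hs.restart_fourth h hk
  have hi4 := h4.1.const_mul (2 * U ^ 2 * C ^ 2 * (ρ ^ (l - 1)) ^ 2)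
  have hle := integral_mono hprod ((hprod'.const_mul 2).add hi4) fun ω => by
    have e1 := sq_dotProduct_le_of_norm_sub_le hU
      (hs.regular.norm_restart_sub_restart_le hl r k (fun i => η i ω))
    have e2 := dotProduct_sq_le u (nldsRestart φ A (fun i => η i ω) r k)
    have e3 : (u ⬝ᵥ (nldsRestart φ A (fun i => η i ω) r k).ofLp) ^ 2 ≤
        U * ‖nldsRestart φ A (fun i => η i ω) r k‖ ^ 2 := e2.trans (by gcongr)
    set y := nldsRestart φ A (fun i => η i ω) r k
    have e4 := mul_le_mul_of_nonneg_left e1 (sq_nonneg (u ⬝ᵥ y.ofLp))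
    have e5 := mul_le_mul_of_nonneg_right e3
      (by positivity : 0 ≤ 2 * (U * (C * ρ ^ (l - 1) * ‖y‖) ^ 2))
    simp only [Pi.add_apply]
    refine e4.trans ?_
    rw [mul_add]
    refine (add_le_add_right e5 _).trans (le_of_eq ?_)
    ring
  rw [integral_add' (hprod'.const_mul 2) hi4] at hle
  simp only [integral_const_mul] at hle
  rw [hmul] at hle
  refine hle.trans (add_le_add le_rfl (mul_le_mul_of_nonneg_left h4.2 (by positivity)))

end IsRegularSystem

end Blocks

/-! ### Energy of a block -/

section BlockEnergy

variable {d : ℕ} {φ : ℝ → ℝ} {A : Matrix (Fin d) (Fin d) ℝ}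

/-- The energy `∑ ⟪u, y_s⟫²` over the second half of a block of length `2B` started at time `r`,
where `y` is the trajectory restarted from `0` at time `r`. -/
noncomputable def blockEnergy (φ : ℝ → ℝ) (A : Matrix (Fin d) (Fin d) ℝ)
    (e : ℕ → EuclideanSpace ℝ (Fin d)) (u : Fin d → ℝ) (B r : ℕ) : ℝ :=
  ∑ i ∈ Finset.range B, (u ⬝ᵥ (nldsRestart φ A e r (B + i)).ofLp) ^ 2

lemma blockEnergy_nonneg (e : ℕ → EuclideanSpace ℝ (Fin d)) (u : Fin d → ℝ) (B r : ℕ) :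
    0 ≤ blockEnergy φ A e u B r :=
  Finset.sum_nonneg fun _ _ => sq_nonneg _

lemma measurable_blockEnergy {Ω : Type*} {_ : MeasurableSpace Ω} (hφ : Continuous φ)
    {e : ℕ → Ω → EuclideanSpace ℝ (Fin d)} (u : Fin d → ℝ) {B r : ℕ}
    (he : ∀ t, r ≤ t → t < r + 2 * B → Measurable (e t)) :
    Measurable fun ω => blockEnergy φ A (fun i => e i ω) u B r :=
  Finset.measurable_sum _ fun i hi => ((measurable_dotProduct_ofLp u).comp
    (measurable_nldsRestart hφ fun j hj => he (r + j) (by omega)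
      (by simp at hi; omega))).pow_const 2

lemma measurable_blockEnergy_sigma {Ω : Type*} {η : ℕ → Ω → EuclideanSpace ℝ (Fin d)}
    (hφ : Continuous φ) (u : Fin d → ℝ) (B r : ℕ) :
    Measurable[noiseSigma η (Set.Ico r (r + 2 * B))]
      fun ω => blockEnergy φ A (fun i => η i ω) u B r :=
  measurable_blockEnergy (e := η) hφ u fun _ h1 h2 =>
    measurable_noiseSigma (I := Set.Ico r (r + 2 * B)) ⟨h1, h2⟩

lemma measurable_sum_blockEnergy_sigma {Ω : Type*} {η : ℕ → Ω → EuclideanSpace ℝ (Fin d)}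
    (hφ : Continuous φ) (u : Fin d → ℝ) (B n : ℕ) :
    Measurable[noiseSigma η (Set.Iio (2 * B * n))]
      (∑ j ∈ Finset.range n, fun ω => blockEnergy φ A (fun i => η i ω) u B (2 * B * j)) := by
  refine measurable_range_sum (m := noiseSigma η (Set.Iio (2 * B * n))) fun j hj =>
    measurable_blockEnergy (e := η) hφ u fun t h1 h2 =>
      measurable_noiseSigma (I := Set.Iio (2 * B * n)) ?_
  have : 2 * B * (j + 1) ≤ 2 * B * n := Nat.mul_le_mul_left _ hj
  simp only [Set.mem_Iio]
  linarith

lemma sq_sum_range_eq (a : ℕ → ℝ) (n : ℕ) :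
    (∑ j ∈ Finset.range n, a j) ^ 2 =
      ∑ j ∈ Finset.range n, (a j ^ 2 + 2 * ∑ i ∈ Finset.range j, a i * a j) := by
  induction n with
  | zero => simp
  | succ n ih =>
    rw [Finset.sum_range_succ, Finset.sum_range_succ, ← ih, ← Finset.sum_mul]
    ring

end BlockEnergy

/-! ### Moments and lower tail of the block energies -/

section BlockMoments

variable {d : ℕ} {φ : ℝ → ℝ} {A : Matrix (Fin d) (Fin d) ℝ} {T : ℕ} {C ρ σ : ℝ}
  {μ π : Measure (EuclideanSpace ℝ (Fin d))}
  {Ω : Type*} [mΩ : MeasurableSpace Ω] {P : Measure Ω} [IsProbabilityMeasure P]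
  {X₀ : Ω → EuclideanSpace ℝ (Fin d)} {η : ℕ → Ω → EuclideanSpace ℝ (Fin d)}

namespace IsRegularSystem

variable (hs : IsRegularSystem φ A C ρ σ μ π) (h : IsDriving T μ π P X₀ η)
  {u : Fin d → ℝ} {U : ℝ} (hU : ∑ i, u i ^ 2 ≤ U)
  (hu : ∫ x, (u ⬝ᵥ x.ofLp) ^ 2 ∂π = 1) {B : ℕ}
  (hB1 : 4 * U * stateSecondMomentBound d C ρ σ * C ^ 2 * (ρ ^ (B - 1)) ^ 2 ≤ 1 / 2)
include hs h hU hu hB1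

lemma restart_form_mem {s k : ℕ} (hB : 1 ≤ B) (hk : B ≤ k) (hsk : s + k ≤ T) :
    1 / 4 ≤ ∫ ω, (u ⬝ᵥ (nldsRestart φ A (fun i => η i ω) s k).ofLp) ^ 2 ∂P ∧
    ∫ ω, (u ⬝ᵥ (nldsRestart φ A (fun i => η i ω) s k).ofLp) ^ 2 ∂P ≤ 3 := by
  have hU0 : 0 ≤ U := (Finset.sum_nonneg fun _ _ => sq_nonneg _).trans hU
  have hD : 0 ≤ stateSecondMomentBound d C ρ σ := by unfold stateSecondMomentBound; positivity
  obtain ⟨h1, h2⟩ := hs.restart_form_bounds h hU hu (hB.trans hk) hsk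
  have h3 : 4 * U * stateSecondMomentBound d C ρ σ * C ^ 2 * (ρ ^ (k - 1)) ^ 2 ≤
      4 * U * stateSecondMomentBound d C ρ σ * C ^ 2 * (ρ ^ (B - 1)) ^ 2 := by
    have := pow_le_pow_of_le_one hs.rho_pos.le hs.rho_lt_one.le (show B - 1 ≤ k - 1 by omega)
    have := hs.rho_pos
    gcongr
  constructor <;> linarith

lemma le_integral_blockEnergy {r : ℕ} (hB : 1 ≤ B) (hr : r + 2 * B ≤ T) :
    (B : ℝ) / 4 ≤ ∫ ω, blockEnergy φ A (fun i => η i ω) u B r ∂P := by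
  unfold blockEnergy
  rw [integral_finsetSum _ fun i hi => hs.integrable_restart_form h
    (by simp at hi; omega) u]
  have : ∑ i ∈ Finset.range B, (1 / 4 : ℝ) = (B : ℝ) / 4 := by simp; ring
  rw [← this]
  exact Finset.sum_le_sum fun i hi => (hs.restart_form_mem h hU hu hB1 hB (by omega)
    (by simp at hi; omega)).1

/-- Products at lag l are at most 12 plus a multiple H of ρ^(2(l−1)). The corrections in a row sum
to at most H/(1 − ρ²), which `hB2` absorbs into the block length; a diagonal term and twice its row
then total at most 104B + 2(12B + 104B) ≤ 440B. -/
lemma integral_blockEnergy_sq_le {r : ℕ} (hB : 1 ≤ B) (hr : r + 2 * B ≤ T)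
    (hB2 : (24 * U * stateSecondMomentBound d C ρ σ * C ^ 2 +
      2 * U ^ 2 * C ^ 2 * stateFourthMomentBound C ρ μ) / (1 - ρ ^ 2) ≤ 104 * B) :
    Integrable (fun ω => blockEnergy φ A (fun i => η i ω) u B r ^ 2) P ∧
    ∫ ω, blockEnergy φ A (fun i => η i ω) u B r ^ 2 ∂P ≤ 440 * (B : ℝ) ^ 2 := by
  have hU0 : 0 ≤ U := (Finset.sum_nonneg fun _ _ => sq_nonneg _).trans hU
  have hC := hs.one_le
  have hρ := hs.rho_pos
  have hρ1 := hs.rho_lt_one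
  have hD : 0 ≤ stateSecondMomentBound d C ρ σ := by unfold stateSecondMomentBound; positivity
  have hF : 0 ≤ stateFourthMomentBound C ρ μ :=
    (integral_nonneg fun _ => by positivity).trans (hs.restart_fourth h (s := 0) (k := 0) (by simp)).2
  have hρ2 : 0 < 1 - ρ ^ 2 := by nlinarith
  set κ := 4 * U * stateSecondMomentBound d C ρ σ * C ^ 2 with hκ
  set F := stateFourthMomentBound C ρ μ with hFdef
  set H := 24 * U * stateSecondMomentBound d C ρ σ * C ^ 2 + 2 * U ^ 2 * C ^ 2 * F with hH
  have hH0 : 0 ≤ H := by positivity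
  set a : ℕ → Ω → ℝ := fun i ω => (u ⬝ᵥ (nldsRestart φ A (fun i => η i ω) r (B + i)).ofLp) ^ 2
    with ha
  have hsplit : ∀ ω, blockEnergy φ A (fun i => η i ω) u B r ^ 2 =
      ∑ j ∈ Finset.range B, (a j ω ^ 2 + 2 * ∑ i ∈ Finset.range j, a i ω * a j ω) := fun ω =>
    sq_sum_range_eq (fun i => a i ω) B
  have hmem : ∀ i < B, r + (B + i) ≤ T := fun i hi => by omega
  have hi2 : ∀ i < B, Integrable (fun ω => a i ω ^ 2) P := fun i hi =>
    hs.integrable_restart_form_sq h (hmem i hi) u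
  have hi1 : ∀ i < B, Integrable (a i) P := fun i hi =>
    hs.integrable_restart_form h (hmem i hi) u
  have hip : ∀ i < B, ∀ j < B, Integrable (fun ω => a i ω * a j ω) P := fun i hi j hj =>
    integrable_mul_of_integrable_sq (hi1 i hi).1 (hi1 j hj).1 (hi2 i hi) (hi2 j hj)
  have his : ∀ j < B, Integrable (fun ω => ∑ i ∈ Finset.range j, a i ω * a j ω) P := fun j hj =>
    integrable_finsetSum _ fun i hi => hip i (by simp at hi; omega) j hj
  have hij : ∀ j ∈ Finset.range B,
      Integrable (fun ω => a j ω ^ 2 + 2 * ∑ i ∈ Finset.range j, a i ω * a j ω) P := fun j hj =>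
    (hi2 j (by simpa using hj)).add ((his j (by simpa using hj)).const_mul 2)
  simp_rw [hsplit]
  refine ⟨integrable_finsetSum _ hij, ?_⟩
  rw [integral_finsetSum _ hij]
  have hdiag : ∀ j < B, ∫ ω, a j ω ^ 2 ∂P ≤ H / (1 - ρ ^ 2) := by
    intro j hj
    have h4 := hs.restart_fourth h (hmem j hj)
    have hle : ∫ ω, a j ω ^ 2 ∂P ≤
        ∫ ω, U ^ 2 * ‖nldsRestart φ A (fun i => η i ω) r (B + j)‖ ^ 4 ∂P := by
      refine integral_mono (hi2 j hj) (h4.1.const_mul _) fun ω => ?_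
      have e := (dotProduct_sq_le u (nldsRestart φ A (fun i => η i ω) r (B + j))).trans
        (mul_le_mul_of_nonneg_right hU (sq_nonneg _))
      refine (pow_le_pow_left₀ (sq_nonneg _) e 2).trans (le_of_eq ?_)
      ring
    rw [integral_const_mul] at hle
    have e1 : U ^ 2 * F ≤ H := by
      have h1 : 0 ≤ U ^ 2 * F := by positivity
      have h2 : 1 ≤ C ^ 2 := one_le_pow₀ hC
      have h3 : 0 ≤ 24 * U * stateSecondMomentBound d C ρ σ * C ^ 2 := by positivity
      nlinarith
    have e2 : H ≤ H / (1 - ρ ^ 2) := by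
      rw [le_div_iff₀ hρ2]
      nlinarith [mul_nonneg hH0 (sq_nonneg ρ)]
    have e3 := mul_le_mul_of_nonneg_left h4.2 (by positivity : 0 ≤ U ^ 2)
    linarith
  have hoff : ∀ j < B, ∀ i < j, ∫ ω, a i ω * a j ω ∂P ≤ 12 + H * (ρ ^ 2) ^ (j - 1 - i) := by
    intro j hj i hi
    have hl : 1 ≤ j - i := by omega
    have hjl : B + j = (B + i) + (j - i) := by omega
    have e1 := hs.restart_form_mul_le h hU hl (r := r) (k := B + i) (by omega)
    rw [← hjl] at e1
    obtain ⟨e2, -⟩ := hs.restart_form_bounds h hU hu hl (s := r + (B + i)) (by omega)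
    obtain ⟨e3, e4⟩ := hs.restart_form_mem h hU hu hB1 hB (s := r) (k := B + i) (by omega)
      (by omega)
    rw [← hκ] at e2
    have hpw : (ρ ^ (j - i - 1)) ^ 2 = (ρ ^ 2) ^ (j - 1 - i) := by
      rw [← pow_mul, ← pow_mul, mul_comm, show j - i - 1 = j - 1 - i by omega]
    rw [hpw] at e1 e2
    set w := (ρ ^ 2) ^ (j - 1 - i) with hw
    have hw0 : 0 ≤ w := by positivity
    -- Twice this product is 2·3·(2 + κw) = 12 + 6κw, and 6κ is the first part of H.
    have e5 := mul_le_mul e4 e2 (integral_nonneg fun _ => sq_nonneg _) (by norm_num)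
    refine e1.trans ?_
    rw [hH]
    have : 24 * U * stateSecondMomentBound d C ρ σ * C ^ 2 = 6 * κ := by rw [hκ]; ring
    rw [this]
    nlinarith
  have hrow : ∀ j ∈ Finset.range B,
      ∫ ω, (a j ω ^ 2 + 2 * ∑ i ∈ Finset.range j, a i ω * a j ω) ∂P ≤ 440 * (B : ℝ) := by
    intro j hj
    have hj' : j < B := by simpa using hj
    rw [integral_add (hi2 j hj') ((his j hj').const_mul 2), integral_const_mul,
      integral_finsetSum _ fun i hi => hip i (by simp at hi; omega) j hj']
    have e1 : ∑ i ∈ Finset.range j, ∫ ω, a i ω * a j ω ∂P ≤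
        ∑ i ∈ Finset.range j, (12 + H * (ρ ^ 2) ^ (j - 1 - i)) :=
      Finset.sum_le_sum fun i hi => hoff j hj' i (by simpa using hi)
    rw [Finset.sum_add_distrib, ← Finset.mul_sum,
      Finset.sum_range_reflect (fun i => (ρ ^ 2) ^ i) j, Finset.sum_const, Finset.card_range,
      nsmul_eq_mul] at e1
    have e2 : ∑ i ∈ Finset.range j, (ρ ^ 2) ^ i ≤ 1 / (1 - ρ ^ 2) := by
      rw [geom_sum_eq (by nlinarith), ← neg_div_neg_eq, neg_sub, neg_sub]
      have := pow_nonneg (sq_nonneg ρ) j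
      gcongr
      linarith
    have e3 : H * ∑ i ∈ Finset.range j, (ρ ^ 2) ^ i ≤ H / (1 - ρ ^ 2) := by
      rw [div_eq_mul_one_div]; gcongr
    have e4 : (j : ℝ) ≤ B := by exact_mod_cast hj'.le
    have e5 := hdiag j hj'
    linarith
  refine (Finset.sum_le_sum hrow).trans (le_of_eq ?_)
  simp
  ring

lemma measure_sum_blockEnergy_le {N : ℕ} (hB : 1 ≤ B) (hN : 2 * B * N ≤ T)
    (hB2 : (24 * U * stateSecondMomentBound d C ρ σ * C ^ 2 +
      2 * U ^ 2 * C ^ 2 * stateFourthMomentBound C ρ μ) / (1 - ρ ^ 2) ≤ 104 * B) :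
    P.real {ω | ∑ j ∈ Finset.range N, blockEnergy φ A (fun i => η i ω) u B (2 * B * j) ≤
      N * B / 8} ≤ Real.exp (-(N / 56320)) := by
  have hend : ∀ j < N, 2 * B * j + 2 * B ≤ T := fun j hj => by
    have : 2 * B * (j + 1) ≤ 2 * B * N := Nat.mul_le_mul_left _ hj
    linarith
  have hB0 : (0 : ℝ) < B := by exact_mod_cast hB
  have key := measure_sum_le_le_exp (P := P) (N := N)
    (V := fun j ω => blockEnergy φ A (fun i => η i ω) u B (2 * B * j))
    (a := (B : ℝ) / 4) (b := 440 * (B : ℝ) ^ 2)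
    (fun j hj => measurable_blockEnergy hs.continuous u fun t _ ht =>
      h.measurable_noise t (by have := hend j hj; omega))
    (fun j ω => blockEnergy_nonneg _ _ _ _)
    (fun j hj => (hs.integral_blockEnergy_sq_le h hU hu hB1 hB (hend j hj) hB2).1)
    (by positivity) (by positivity)
    (fun j hj => hs.le_integral_blockEnergy h hU hu hB1 hB (hend j hj))
    (fun j hj => (hs.integral_blockEnergy_sq_le h hU hu hB1 hB (hend j hj) hB2).2)
    (fun n hn => h.indepFun (I := Set.Iio (2 * B * n))
      (J := Set.Ico (2 * B * n) (2 * B * n + 2 * B))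
      (fun t ht => by have := hend n hn; simp at ht; omega)
      (fun t ht => by have := hend n hn; simp at ht; omega)
      (by rw [Set.disjoint_left]; intro t ht ht'; simp at ht ht'; omega)
      (Measurable.of_comap_le ((measurable_sum_blockEnergy_sigma hs.continuous u B n).comap_le.trans
        le_sup_right))
      (measurable_blockEnergy_sigma hs.continuous u B _))
  have e1 : (N : ℝ) * (B / 4) / 2 = N * B / 8 := by ring
  -- 56320 = 16 · 8 · 440.
  have e2 : (N : ℝ) * (B / 4) ^ 2 / (8 * (440 * (B : ℝ) ^ 2)) = N / 56320 := by
    field_simp; ring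
  rwa [e1, e2] at key

end IsRegularSystem

end BlockMoments

/-! ### Covering numbers -/

section Net

variable {d : ℕ}

/-- A bounded subset of a Euclidean space has an `ε`-net of controlled cardinality. -/
lemma exists_finset_net {s : Set (EuclideanSpace ℝ (Fin d))} {R ε : ℝ} (hR : 0 ≤ R) (hε : 0 < ε)
    (hs : ∀ x ∈ s, ‖x‖ ≤ R) : ∃ N : Finset (EuclideanSpace ℝ (Fin d)), (N : Set _) ⊆ s ∧
      (∀ x ∈ s, ∃ y ∈ N, ‖x - y‖ ≤ ε) ∧ (N.card : ℝ) ≤ (1 + 2 * R / ε) ^ d := by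
  classical
  -- Volume comparison: the balls of radius ε/2 about ε-separated points are disjoint and lie in a
  -- ball of radius R + ε/2.
  have hcard : ∀ N : Finset (EuclideanSpace ℝ (Fin d)), (N : Set _) ⊆ s →
      (∀ x ∈ N, ∀ y ∈ N, x ≠ y → ε ≤ ‖x - y‖) → (N.card : ℝ) ≤ (1 + 2 * R / ε) ^ d := by
    intro N hN hsep
    have hvol : ∀ (x : EuclideanSpace ℝ (Fin d)) {r : ℝ}, 0 < r →
        volume.real (Metric.ball x r) =
          r ^ d * volume.real (Metric.ball (0 : EuclideanSpace ℝ (Fin d)) 1) := by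
      intro x r hr
      rw [Measure.real, Measure.addHaar_ball_of_pos _ _ hr, ENNReal.toReal_mul,
        ENNReal.toReal_ofReal (by positivity)]
      simp [Measure.real]
    have hdisj : (N : Set (EuclideanSpace ℝ (Fin d))).PairwiseDisjoint
        fun x => Metric.ball x (ε / 2) := by
      intro x hx y hy hxy
      refine Metric.ball_disjoint_ball ?_
      rw [dist_eq_norm]
      linarith [hsep x hx y hy hxy]
    have hsub : ⋃ x ∈ N, Metric.ball x (ε / 2) ⊆
        Metric.ball (0 : EuclideanSpace ℝ (Fin d)) (R + ε / 2) := by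
      refine Set.iUnion₂_subset fun x hx => Metric.ball_subset_ball' ?_
      rw [dist_zero_right]
      linarith [hs x (hN hx)]
    have h1 : volume.real (⋃ x ∈ N, Metric.ball x (ε / 2)) ≤
        volume.real (Metric.ball (0 : EuclideanSpace ℝ (Fin d)) (R + ε / 2)) :=
      measureReal_mono hsub measure_ball_lt_top.ne
    rw [measureReal_biUnion_finset hdisj (fun _ _ => measurableSet_ball)
      (fun _ _ => measure_ball_lt_top.ne), hvol 0 (by positivity),
      Finset.sum_congr rfl fun x _ => hvol x (by positivity : 0 < ε / 2), Finset.sum_const,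
      nsmul_eq_mul, ← mul_assoc] at h1
    have hb : 0 < volume.real (Metric.ball (0 : EuclideanSpace ℝ (Fin d)) 1) :=
      ENNReal.toReal_pos (Metric.measure_ball_pos _ _ one_pos).ne' measure_ball_lt_top.ne
    have h2 := le_of_mul_le_mul_right h1 hb
    rw [← le_div_iff₀ (by positivity), ← div_pow] at h2
    refine h2.trans (le_of_eq ?_)
    congr 1
    field_simp
    ring
  -- Cardinalities of separated subsets of `s` are bounded by `hcard`, so a largest one exists;
  -- being maximal, it is a net.
  obtain ⟨N, ⟨hN1, hN2⟩, hmax⟩ : ∃ N : Finset (EuclideanSpace ℝ (Fin d)),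
      ((N : Set _) ⊆ s ∧ ∀ x ∈ N, ∀ y ∈ N, x ≠ y → ε ≤ ‖x - y‖) ∧
      ∀ N' : Finset (EuclideanSpace ℝ (Fin d)),
        ((N' : Set _) ⊆ s ∧ ∀ x ∈ N', ∀ y ∈ N', x ≠ y → ε ≤ ‖x - y‖) → N'.card ≤ N.card := by
    set Q : ℕ → Prop := fun n => ∃ N : Finset (EuclideanSpace ℝ (Fin d)),
      ((N : Set _) ⊆ s ∧ ∀ x ∈ N, ∀ y ∈ N, x ≠ y → ε ≤ ‖x - y‖) ∧ N.card = n with hQ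
    have hbd : ∀ n, Q n → n ≤ ⌊(1 + 2 * R / ε) ^ d⌋₊ := by
      rintro n ⟨N, ⟨h1, h2⟩, rfl⟩
      exact Nat.le_floor (hcard N h1 h2)
    have h0 : Q 0 := ⟨∅, by simp, by simp⟩
    obtain ⟨N, hN, hNc⟩ := Nat.findGreatest_spec (P := Q) (Nat.zero_le _) h0
    refine ⟨N, hN, fun N' hN' => ?_⟩
    rw [hNc]
    exact Nat.le_findGreatest (hbd _ ⟨N', hN', rfl⟩) ⟨N', hN', rfl⟩
  refine ⟨N, hN1, fun x hx => ?_, hcard N hN1 hN2⟩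
  by_contra! hfar
  have hxN : x ∉ N := fun hxN => by
    have := hfar x hxN
    rw [sub_self, norm_zero] at this
    linarith
  have := hmax (insert x N) ⟨by
    rw [Finset.coe_insert]; exact Set.insert_subset hx hN1, ?_⟩
  · rw [Finset.card_insert_of_notMem hxN] at this
    omega
  · intro y hy z hz hyz
    rw [Finset.mem_insert] at hy hz
    rcases hy with rfl | hy <;> rcases hz with rfl | hz
    · exact absurd rfl hyz
    · exact (hfar z hz).le
    · rw [norm_sub_rev]; exact (hfar y hy).le
    · exact hN2 y hy z hz hyz

end Net

/-! ### From block energies to the empirical form -/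

section EmpiricalLowerBound

variable {d : ℕ} {φ : ℝ → ℝ} {A : Matrix (Fin d) (Fin d) ℝ} {T : ℕ} {C ρ : ℝ}

lemma sum_second_halves_le (f : ℕ → ℝ) (hf : ∀ t, 0 ≤ f t) (B N : ℕ) :
    ∑ j ∈ Finset.range N, ∑ i ∈ Finset.range B, f (2 * B * j + (B + i)) ≤
      ∑ t ∈ Finset.range (2 * B * N), f t := by
  induction N with
  | zero => simp
  | succ N ih =>
    rw [Finset.sum_range_succ, show 2 * B * (N + 1) = 2 * B * N + (B + B) by ring,
      Finset.sum_range_add, Finset.sum_range_add]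
    have : 0 ≤ ∑ i ∈ Finset.range B, f (2 * B * N + i) := Finset.sum_nonneg fun _ _ => hf _
    linarith

/-- Passing back to the true states leaves an energy of at least (NB/8 − NB/16)/2 = NB/32 ≥ T/128.
The comparison is pathwise, hence the bound R on the states in place of a moment. -/
lemma le_empiricalForm_of_blockEnergy (hreg : IsExpRegular φ A C ρ) (hC : 1 ≤ C) (hρ : 0 < ρ)
    (hρ1 : ρ < 1) {x : EuclideanSpace ℝ (Fin d)} {e : ℕ → EuclideanSpace ℝ (Fin d)}
    {u : Fin d → ℝ} {U R : ℝ} (hU : ∑ i, u i ^ 2 ≤ U) {B N : ℕ} (hB : 1 ≤ B)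
    (hT : 1 ≤ T) (hN : 2 * B * N ≤ T) (hN' : T ≤ 4 * B * N)
    (hR : ∀ t < T, ‖nldsTraj φ A x e t‖ ^ 2 ≤ R) (hUR : U * (C * ρ ^ (B - 1)) ^ 2 * R ≤ 1 / 32)
    (hV : N * B / 8 ≤ ∑ j ∈ Finset.range N, blockEnergy φ A e u B (2 * B * j)) :
    1 / 128 ≤ empiricalForm T (nldsTraj φ A x e) u := by
  have hU0 : 0 ≤ U := (Finset.sum_nonneg fun _ _ => sq_nonneg _).trans hU
  have hterm : ∀ j < N, ∀ i < B, (u ⬝ᵥ (nldsRestart φ A e (2 * B * j) (B + i)).ofLp) ^ 2 ≤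
      2 * (u ⬝ᵥ (nldsTraj φ A x e (2 * B * j + (B + i))).ofLp) ^ 2 + 1 / 16 := by
    intro j hj i hi
    have h1 := hreg.norm_traj_sub_restart_le (show 1 ≤ B + i by omega) (2 * B * j) x e
    have h2 := sq_dotProduct_le_of_norm_sub_le hU ((norm_sub_rev _ _).trans_le h1)
    refine h2.trans (add_le_add le_rfl ?_)
    have h3 : 2 * B * j < T := by
      have : 2 * B * (j + 1) ≤ 2 * B * N := Nat.mul_le_mul_left _ hj
      linarith
    have h4 : ρ ^ (B + i - 1) ≤ ρ ^ (B - 1) := pow_le_pow_of_le_one hρ.le hρ1.le (by omega)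
    calc _ = 2 * (U * (C * ρ ^ (B + i - 1)) ^ 2 * ‖nldsTraj φ A x e (2 * B * j)‖ ^ 2) := by ring
      _ ≤ 2 * (U * (C * ρ ^ (B - 1)) ^ 2 * R) := by
          have := hR _ h3
          gcongr
      _ ≤ _ := by linarith
  have hsum : ∑ j ∈ Finset.range N, blockEnergy φ A e u B (2 * B * j) ≤
      2 * ∑ j ∈ Finset.range N, ∑ i ∈ Finset.range B,
        (u ⬝ᵥ (nldsTraj φ A x e (2 * B * j + (B + i))).ofLp) ^ 2 + N * B / 16 := by
    have : (N : ℝ) * B / 16 = ∑ j ∈ Finset.range N, ∑ i ∈ Finset.range B, (1 / 16 : ℝ) := by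
      simp; ring
    rw [this, Finset.mul_sum, ← Finset.sum_add_distrib]
    refine Finset.sum_le_sum fun j hj => ?_
    rw [Finset.mul_sum, ← Finset.sum_add_distrib]
    exact Finset.sum_le_sum fun i hi => hterm j (by simpa using hj) i (by simpa using hi)
  have h1 := sum_second_halves_le (fun t => (u ⬝ᵥ (nldsTraj φ A x e t).ofLp) ^ 2)
    (fun _ => sq_nonneg _) B N
  have h2 : ∑ t ∈ Finset.range (2 * B * N), (u ⬝ᵥ (nldsTraj φ A x e t).ofLp) ^ 2 ≤
      ∑ t ∈ Finset.range T, (u ⬝ᵥ (nldsTraj φ A x e t).ofLp) ^ 2 :=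
    Finset.sum_le_sum_of_subset_of_nonneg (Finset.range_mono hN) fun _ _ _ => sq_nonneg _
  have hT0 : (0 : ℝ) < T := by exact_mod_cast hT
  have hN'' : (T : ℝ) ≤ 4 * B * N := by exact_mod_cast hN'
  unfold empiricalForm
  rw [div_mul_eq_mul_div, one_mul, le_div_iff₀ hT0]
  linarith

lemma empiricalForm_smul (x : ℕ → EuclideanSpace ℝ (Fin d)) (a : ℝ) (v : Fin d → ℝ) :
    empiricalForm T x (a • v) = a ^ 2 * empiricalForm T x v := by
  simp only [empiricalForm, smul_dotProduct, smul_eq_mul, mul_pow, ← Finset.mul_sum]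
  ring

lemma empiricalForm_le_add (x : ℕ → EuclideanSpace ℝ (Fin d)) (u v : Fin d → ℝ) :
    empiricalForm T x u ≤ 2 * empiricalForm T x v + 2 * empiricalForm T x (v - u) := by
  simp only [empiricalForm, sub_dotProduct]
  rw [mul_left_comm, mul_left_comm 2, ← mul_add, Finset.mul_sum _ _ 2, Finset.mul_sum _ _ 2,
    ← Finset.sum_add_distrib]
  refine mul_le_mul_of_nonneg_left (Finset.sum_le_sum fun t _ => ?_)
    (by positivity : (0 : ℝ) ≤ 1 / (T : ℝ))
  nlinarith [sq_nonneg (2 * (v ⬝ᵥ (x t).ofLp) - u ⬝ᵥ (x t).ofLp)]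

/-- Moving from u to v changes the form by at most ε²R up to factors 2: (1/128 − 2/512)/2 = 1/512.
-/
lemma le_empiricalForm_of_net {x : ℕ → EuclideanSpace ℝ (Fin d)} {R ε : ℝ}
    (hT : 1 ≤ T) (hR : ∀ t < T, ‖x t‖ ^ 2 ≤ R) (hεR : ε ^ 2 * R ≤ 1 / 512)
    {v u : EuclideanSpace ℝ (Fin d)} (huv : ‖v - u‖ ≤ ε)
    (hu : 1 / 128 ≤ empiricalForm T x u.ofLp) : 1 / 512 ≤ empiricalForm T x v.ofLp := by
  have h1 := empiricalForm_le_add (T := T) x u.ofLp v.ofLp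
  have h2 := empiricalForm_row_le (T := T) (x := x) (v.ofLp - u.ofLp)
  have h3 : ∑ j, (v.ofLp - u.ofLp) j ^ 2 = ‖v - u‖ ^ 2 := by
    rw [EuclideanSpace.norm_sq_eq]
    simp only [Real.norm_eq_abs, sq_abs]
    rfl
  have hT0 : (0 : ℝ) < T := by exact_mod_cast hT
  have h4 : (1 / (T : ℝ)) * ∑ t ∈ Finset.range T, ‖x t‖ ^ 2 ≤ R := by
    rw [div_mul_eq_mul_div, one_mul, div_le_iff₀ hT0]
    refine (Finset.sum_le_sum fun t ht => hR t (by simpa using ht)).trans (le_of_eq ?_)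
    simp [mul_comm]
  have h5 : ‖v - u‖ ^ 2 * ((1 / (T : ℝ)) * ∑ t ∈ Finset.range T, ‖x t‖ ^ 2) ≤ ε ^ 2 * R := by
    have h50 : 0 ≤ (1 / (T : ℝ)) * ∑ t ∈ Finset.range T, ‖x t‖ ^ 2 :=
      mul_nonneg (one_div_nonneg.2 hT0.le) (Finset.sum_nonneg fun _ _ => sq_nonneg _)
    exact mul_le_mul (pow_le_pow_left₀ (norm_nonneg _) huv 2) h4 h50 (sq_nonneg _)
  rw [h3] at h2
  linarith

end EmpiricalLowerBound

/-! ### Choice of the block length and of the number of blocks -/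

section BlockParameters

open Real

lemma log_ge_two_of_eight_le {x : ℝ} (hx : 8 ≤ x) : 2 ≤ log x := by
  rw [le_log_iff_exp_le (by linarith)]
  have h : exp 2 = exp 1 * exp 1 := by rw [← exp_add]; norm_num
  have := exp_one_lt_d9
  rw [h]
  nlinarith [exp_pos 1]

lemma half_le_log_inv {δ : ℝ} (hδ : 0 < δ) (hδ1 : δ < 1 / 2) : 1 / 2 ≤ log (1 / δ) ∧
    log 2 ≤ log (1 / δ) := by
  have h : log 2 ≤ log (1 / δ) := by
    refine log_le_log (by norm_num) ?_
    rw [le_div_iff₀ hδ]; linarith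
  have := log_two_gt_d9
  exact ⟨by linarith, h⟩

lemma eight_le_radius_ratio {T d : ℕ} {C σ ρ δ : ℝ} (hd : 1 ≤ d) (hT : 1 ≤ T) (hC : 1 ≤ C)
    (hσ : 0 < σ) (hρ : 0 < ρ) (hρ1 : ρ < 1) (hδ : 0 < δ) (hδ1 : δ < 1 / 2) :
    8 ≤ radiusStar T d C σ ρ δ / σ ^ 2 := by
  have h1 : 0 < 1 - ρ := by linarith
  have e : radiusStar T d C σ ρ δ / σ ^ 2 = 4 * (T * d * C ^ 2) / ((1 - ρ) ^ 2 * δ) := by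
    unfold radiusStar; field_simp
  have hT' : (1 : ℝ) ≤ T := by exact_mod_cast hT
  have hd' : (1 : ℝ) ≤ d := by exact_mod_cast hd
  rw [e, le_div_iff₀ (by positivity)]
  have h2 : (1 - ρ) ^ 2 ≤ 1 := pow_le_one₀ h1.le (by linarith)
  have h3 : (1 : ℝ) ≤ T * d * C ^ 2 := by
    have := one_le_mul_of_one_le_of_one_le hT' hd'
    exact one_le_mul_of_one_le_of_one_le this (one_le_pow₀ hC)
  have h4 : (1 - ρ) ^ 2 * δ ≤ 1 * (1 / 2) := by gcongr
  linarith

lemma pow_le_inv_of_log_div_le {ρ y : ℝ} (hρ : 0 < ρ) (hρ1 : ρ < 1) (hy : 0 < y) {n : ℕ}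
    (hn : log y / log (1 / ρ) ≤ n) : ρ ^ n ≤ 1 / y := by
  have hl : 0 < log (1 / ρ) := log_pos (by rw [lt_div_iff₀ hρ]; linarith)
  rw [div_le_iff₀ hl] at hn
  have h1 : log (ρ ^ n) ≤ log (1 / y) := by
    rw [log_pow, one_div, log_inv]
    rw [one_div, log_inv] at hn
    linarith
  exact (log_le_log_iff (by positivity) (by positivity)).1 h1

lemma variance_bound_le {d : ℕ} {C σ ρ M₄ : ℝ} (hC : 1 ≤ C)
    (hσ : 0 < σ) (hρ : 0 < ρ) (hρ1 : ρ < 1) (hM : (d : ℝ) ^ 2 * σ ^ 4 ≤ M₄) :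
    (24 * (1 / σ ^ 2) * stateSecondMomentBound d C ρ σ * C ^ 2 +
        2 * (1 / σ ^ 2) ^ 2 * C ^ 2 * ((2 * C / (1 - ρ)) ^ 4 * M₄)) / (1 - ρ ^ 2) ≤
      32 * (4 * C ^ 6 * M₄ / ((1 - ρ) ^ 4 * (1 - ρ ^ 2) * σ ^ 4)) := by
  have h1ρ : 0 < 1 - ρ := by linarith
  have h1ρ2 : 0 < 1 - ρ ^ 2 := by nlinarith
  have e3 : (d : ℝ) * σ ^ 4 ≤ M₄ := by
    refine le_trans ?_ hM
    gcongr
    exact_mod_cast Nat.le_self_pow two_ne_zero d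
  have hM0 : 0 ≤ M₄ := le_trans (by positivity) e3
  have e4 : (1 - ρ) ^ 2 ≤ 1 := pow_le_one₀ h1ρ.le (by linarith)
  have e5 : C ^ 4 ≤ C ^ 6 := pow_le_pow_right₀ hC (by norm_num)
  have e6 : C ^ 4 * (1 - ρ) ^ 2 * (d * σ ^ 4) ≤ C ^ 6 * M₄ := by
    calc _ ≤ C ^ 6 * 1 * M₄ := by gcongr
      _ = _ := by ring
  have e7 : 24 * (1 / σ ^ 2) * stateSecondMomentBound d C ρ σ * C ^ 2 =
      96 * (C ^ 4 * (1 - ρ) ^ 2 * (d * σ ^ 4)) / ((1 - ρ) ^ 4 * σ ^ 4) := by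
    unfold stateSecondMomentBound; field_simp; ring
  have e8 : 2 * (1 / σ ^ 2) ^ 2 * C ^ 2 * ((2 * C / (1 - ρ)) ^ 4 * M₄) =
      32 * (C ^ 6 * M₄) / ((1 - ρ) ^ 4 * σ ^ 4) := by
    field_simp; ring
  have e9 : 32 * (4 * C ^ 6 * M₄ / ((1 - ρ) ^ 4 * (1 - ρ ^ 2) * σ ^ 4)) =
      128 * (C ^ 6 * M₄) / ((1 - ρ) ^ 4 * σ ^ 4) / (1 - ρ ^ 2) := by
    field_simp; ring
  rw [e7, e8, e9, ← add_div]
  gcongr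
  linarith

/-- B = ⌈M⌉ + 1 ≤ 2M and N = ⌊T/(2B)⌋. Rounding loses at most half of the time, so T ≤ 4BN ≤ 8MN,
and 500000 = 4000000/8. -/
lemma exists_block_sizes {T : ℕ} {M K : ℝ} (hM : 4 ≤ M) (hK : 1 ≤ K)
    (hT : 4000000 * K * M ≤ T) : ∃ B N : ℕ, 1 ≤ B ∧ 2 * B * N ≤ T ∧ T ≤ 4 * B * N ∧
      M ≤ ((B - 1 : ℕ) : ℝ) ∧ 500000 * K ≤ N := by
  have hBpos : 1 ≤ ⌈M⌉₊ + 1 := by omega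
  have hBM : M ≤ ((⌈M⌉₊ + 1 - 1 : ℕ) : ℝ) := by simpa using Nat.le_ceil M
  have hB2M : ((⌈M⌉₊ + 1 : ℕ) : ℝ) ≤ 2 * M := by
    have := Nat.ceil_lt_add_one (by linarith : 0 ≤ M)
    push_cast; linarith
  generalize ⌈M⌉₊ + 1 = B at hBpos hBM hB2M
  have hKM : M ≤ K * M := le_mul_of_one_le_left (by linarith) hK
  have h2BT : 2 * B ≤ T := by
    have : 2 * (B : ℝ) ≤ T := by linarith
    exact_mod_cast this
  have hN1 : 1 ≤ T / (2 * B) := by rw [Nat.le_div_iff_mul_le (by omega)]; omega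
  have hNT : 2 * B * (T / (2 * B)) ≤ T := Nat.mul_div_le T (2 * B)
  have hTN : T < 2 * B * (T / (2 * B) + 1) := Nat.lt_mul_div_succ T (by omega)
  generalize T / (2 * B) = N at hN1 hNT hTN
  have hTN' : T ≤ 4 * B * N := by
    have h2 : 2 * B * 1 ≤ 2 * B * N := Nat.mul_le_mul_left _ hN1
    linarith
  refine ⟨B, N, hBpos, hNT, hTN', hBM, ?_⟩
  have h1 : (T : ℝ) ≤ 4 * B * N := by exact_mod_cast hTN'
  have h2 : (4 : ℝ) * B * N ≤ 4 * (2 * M) * N := by gcongr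
  have h3 : M * (500000 * K) ≤ M * N := by linarith
  exact le_of_mul_le_mul_left h3 (by linarith)

/-- With K = d log(1/δ) log x, the logarithm of the net size is at most 6K and log(2/δ) is at most
K, while N/56320 exceeds 8K. -/
lemma card_mul_exp_le {d N : ℕ} {x δ : ℝ} (hx : 8 ≤ x) (hδ : 0 < δ)
    (hd : (d : ℝ) * log x ≤ 2 * (d * log (1 / δ) * log x)) (hℓ2 : log 2 ≤ log (1 / δ))
    (hℓ : 2 * log (1 / δ) ≤ d * log (1 / δ) * log x)
    (hN : 500000 * (d * log (1 / δ) * log x) ≤ N) :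
    (x ^ 3) ^ d * exp (-(N / 56320)) ≤ δ / 2 := by
  have hx0 : 0 < x := by linarith
  have h1 : (x ^ 3) ^ d = exp (3 * (d * log x)) := by
    rw [← pow_mul, ← exp_log hx0, ← exp_nat_mul, exp_log hx0]
    push_cast
    ring_nf
  have h2 : δ / 2 = exp (-log (1 / δ) - log 2) := by
    rw [exp_sub, one_div, log_inv, neg_neg, exp_log hδ, exp_log (by norm_num)]
  rw [h1, h2, ← exp_add, exp_le_exp]
  have hℓ0 : 0 ≤ log 2 := log_nonneg (by norm_num)
  linarith

/-- The 4 in 4xC is the constant C₁; it brings the remainder down to 1/(4x), which is where 8 ≤ x is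
needed. -/
lemma block_remainder_le {C ρ σ x : ℝ} (hC : 1 ≤ C) (hσ : 0 < σ) (hρ : 0 < ρ) (hx : 8 ≤ x) {n : ℕ}
    (hn : ρ ^ n ≤ 1 / (4 * x * C)) :
    1 / σ ^ 2 * (C * ρ ^ n) ^ 2 * (4 * (σ ^ 2 * x)) ≤ 1 / 32 := by
  have hθ : C * ρ ^ n ≤ 1 / (4 * x) := by
    calc _ ≤ C * (1 / (4 * x * C)) := by gcongr
      _ = _ := by field_simp
  calc _ ≤ 1 / σ ^ 2 * (1 / (4 * x)) ^ 2 * (4 * (σ ^ 2 * x)) := by gcongr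
    _ = 1 / (4 * x) := by field_simp
    _ ≤ _ := by
        rw [div_le_div_iff₀ (by positivity) (by norm_num)]; linarith

/-- The meaning of R*: the second moment bound times T/δ, the scale at which Markov's inequality
survives a union over T states. -/
lemma stateSecondMomentBound_eq {T d : ℕ} {C σ ρ δ : ℝ} (hT : 1 ≤ T) (hδ : 0 < δ) (hρ1 : ρ < 1) :
    stateSecondMomentBound d C ρ σ = radiusStar T d C σ ρ δ * (δ / T) := by
  have hT0 : (0 : ℝ) < T := by exact_mod_cast hT
  have h1ρ : 0 < 1 - ρ := by linarith
  unfold radiusStar stateSecondMomentBound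
  field_simp
  ring

lemma exists_block_parameters {d T : ℕ} {C σ ρ δ M₄ : ℝ} (hd : 1 ≤ d) (hT : 1 ≤ T) (hC : 1 ≤ C)
    (hσ : 0 < σ) (hρ : 0 < ρ) (hρ1 : ρ < 1) (hδ : 0 < δ) (hδ1 : δ < 1 / 2)
    (hM : (d : ℝ) ^ 2 * σ ^ 4 ≤ M₄)
    (hbig : 4000000 * d * log (1 / δ) * log (radiusStar T d C σ ρ δ / σ ^ 2) *
      max (4 * C ^ 6 * M₄ / ((1 - ρ) ^ 4 * (1 - ρ ^ 2) * σ ^ 4))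
        (log (radiusStar T d C σ ρ δ * 4 * C / σ ^ 2) / log (1 / ρ)) ≤ T) :
    ∃ B N : ℕ, 1 ≤ B ∧ 2 * B * N ≤ T ∧ T ≤ 4 * B * N ∧
      4 * (1 / σ ^ 2) * stateSecondMomentBound d C ρ σ * C ^ 2 * (ρ ^ (B - 1)) ^ 2 ≤ 1 / 2 ∧
      (24 * (1 / σ ^ 2) * stateSecondMomentBound d C ρ σ * C ^ 2 +
        2 * (1 / σ ^ 2) ^ 2 * C ^ 2 * ((2 * C / (1 - ρ)) ^ 4 * M₄)) / (1 - ρ ^ 2) ≤ 104 * B ∧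
      1 / σ ^ 2 * (C * ρ ^ (B - 1)) ^ 2 * (4 * radiusStar T d C σ ρ δ) ≤ 1 / 32 ∧
      ((radiusStar T d C σ ρ δ / σ ^ 2) ^ 3) ^ d * exp (-(N / 56320)) ≤ δ / 2 := by
  have h1ρ : 0 < 1 - ρ := by linarith
  have h1ρ2 : 0 < 1 - ρ ^ 2 := by nlinarith
  have hx8 := eight_le_radius_ratio hd hT hC hσ hρ hρ1 hδ hδ1
  have hD := stateSecondMomentBound_eq (d := d) (C := C) (σ := σ) hT hδ hρ1
  have hvar := variance_bound_le (d := d) hC hσ hρ hρ1 hM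
  generalize hR : radiusStar T d C σ ρ δ = R at *
  have hQ4 : 4 ≤ 4 * C ^ 6 * M₄ / ((1 - ρ) ^ 4 * (1 - ρ ^ 2) * σ ^ 4) := by
    rw [le_div_iff₀ (by positivity)]
    have hM1 : σ ^ 4 ≤ M₄ := le_trans (le_mul_of_one_le_left (by positivity)
      (one_le_pow₀ (by exact_mod_cast hd))) hM
    have hC6 : 1 ≤ C ^ 6 := one_le_pow₀ hC
    have e1 : (1 - ρ) ^ 4 * (1 - ρ ^ 2) ≤ 1 :=
      mul_le_one₀ (pow_le_one₀ h1ρ.le (by linarith)) h1ρ2.le (by nlinarith)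
    have e2 : (1 - ρ) ^ 4 * (1 - ρ ^ 2) * σ ^ 4 ≤ 1 * σ ^ 4 := by gcongr
    have e3 : 1 * σ ^ 4 ≤ C ^ 6 * M₄ := by gcongr
    linarith
  generalize 4 * C ^ 6 * M₄ / ((1 - ρ) ^ 4 * (1 - ρ ^ 2) * σ ^ 4) = Q at *
  have hLx : R * 4 * C / σ ^ 2 = 4 * (R / σ ^ 2) * C := by ring
  have hRx : R = σ ^ 2 * (R / σ ^ 2) := by field_simp
  rw [hLx] at hbig
  generalize hx : R / σ ^ 2 = x at *
  have hlx := log_ge_two_of_eight_le hx8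
  obtain ⟨hℓ, hℓ2⟩ := half_le_log_inv hδ hδ1
  have hd' : (1 : ℝ) ≤ d := by exact_mod_cast hd
  have hT' : (1 : ℝ) ≤ T := by exact_mod_cast hT
  have hdl : 2 ≤ (d : ℝ) * log x := by nlinarith
  have hK1 : (d : ℝ) * log x ≤ 2 * (d * log (1 / δ) * log x) := by nlinarith
  have hK2 : 2 * log (1 / δ) ≤ d * log (1 / δ) * log x := by nlinarith
  obtain ⟨B, N, hB, hNT, hTN, hBM, hN⟩ := exists_block_sizes
    (hQ4.trans (le_max_left Q (log (4 * x * C) / log (1 / ρ)))) (by linarith)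
    (show 4000000 * (d * log (1 / δ) * log x) * max Q (log (4 * x * C) / log (1 / ρ)) ≤ T by
      rw [← mul_assoc, ← mul_assoc]; exact hbig)
  have hrem := block_remainder_le hC hσ hρ hx8
    (pow_le_inv_of_log_div_le hρ hρ1 (by positivity) ((le_max_right Q _).trans hBM))
  rw [← hRx] at hrem
  have hR0 : 0 ≤ R := by rw [hRx]; positivity
  refine ⟨B, N, hB, hNT, hTN, ?_, ?_, hrem, card_mul_exp_le hx8 hδ hK1 hℓ2 hK2 hN⟩
  · have hDR : stateSecondMomentBound d C ρ σ ≤ R := by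
      rw [hD]
      refine mul_le_of_le_one_right hR0 ?_
      rw [div_le_one (by linarith)]; linarith
    calc _ = 1 / σ ^ 2 * (C * ρ ^ (B - 1)) ^ 2 * (4 * stateSecondMomentBound d C ρ σ) := by ring
      _ ≤ 1 / σ ^ 2 * (C * ρ ^ (B - 1)) ^ 2 * (4 * R) := by gcongr
      _ ≤ _ := by linarith
  · have h1 : ((B - 1 : ℕ) : ℝ) ≤ B := by exact_mod_cast Nat.sub_le _ _
    have h2 := (le_max_left Q (log (4 * x * C) / log (1 / ρ))).trans (hBM.trans h1)
    linarith

end BlockParameters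

/-! ### The good event -/

section Event

variable {d : ℕ} {φ : ℝ → ℝ} {A : Matrix (Fin d) (Fin d) ℝ} {T : ℕ}

/-- The states are bounded and all directions in `S` collect enough energy over the blocks. -/
def energyEvent {Ω : Type*} (φ : ℝ → ℝ) (A : Matrix (Fin d) (Fin d) ℝ) (T B N : ℕ) (R : ℝ)
    (S : Finset (EuclideanSpace ℝ (Fin d))) (X₀ : Ω → EuclideanSpace ℝ (Fin d))
    (η : ℕ → Ω → EuclideanSpace ℝ (Fin d)) : Set Ω :=
  {ω | (∀ t ∈ Finset.range T, ‖nldsTraj φ A (X₀ ω) (fun s => η s ω) t‖ ^ 2 ≤ R) ∧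
    ∀ u ∈ S, N * B / 8 ≤
      ∑ j ∈ Finset.range N, blockEnergy φ A (fun s => η s ω) u.ofLp B (2 * B * j)}

lemma measurableSet_energyEvent {Ω : Type*} {_ : MeasurableSpace Ω} (hφ : Continuous φ)
    {B N : ℕ} (hN : 2 * B * N ≤ T) (R : ℝ)
    (S : Finset (EuclideanSpace ℝ (Fin d))) {X₀ : Ω → EuclideanSpace ℝ (Fin d)}
    {η : ℕ → Ω → EuclideanSpace ℝ (Fin d)} (hX₀ : Measurable X₀)
    (hη : ∀ t < T, Measurable (η t)) : MeasurableSet (energyEvent φ A T B N R S X₀ η) := by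
  have h1 : MeasurableSet (⋂ t ∈ Finset.range T,
      {ω | ‖nldsTraj φ A (X₀ ω) (fun s => η s ω) t‖ ^ 2 ≤ R}) :=
    Finset.measurableSet_biInter _ fun t ht => measurableSet_le
      ((measurable_nldsTraj hφ hX₀ fun i hi => hη i (by simp at ht; omega)).norm.pow_const 2)
      measurable_const
  have h2 : MeasurableSet (⋂ u ∈ S, {ω | (N * B / 8 : ℝ) ≤
      ∑ j ∈ Finset.range N, blockEnergy φ A (fun s => η s ω) u.ofLp B (2 * B * j)}) :=
    Finset.measurableSet_biInter _ fun u _ => measurableSet_le measurable_const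
      (Finset.measurable_sum _ fun j hj => measurable_blockEnergy hφ _ fun t _ ht => hη t (by
        have hj' : 2 * B * (j + 1) ≤ 2 * B * N := Nat.mul_le_mul_left _ (Finset.mem_range.1 hj)
        linarith))
  convert h1.inter h2 using 1
  ext ω
  simp [energyEvent]

end Event

/-! ### Probability of the good event, and Ĝ ≽ G/512 on it -/

section EventProbability

variable {d : ℕ} {φ : ℝ → ℝ} {A : Matrix (Fin d) (Fin d) ℝ} {T : ℕ} {C ρ σ δ : ℝ}
  {μ π : Measure (EuclideanSpace ℝ (Fin d))}
  {Ω : Type*} [mΩ : MeasurableSpace Ω] {P : Measure Ω} [IsProbabilityMeasure P]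
  {X₀ : Ω → EuclideanSpace ℝ (Fin d)} {η : ℕ → Ω → EuclideanSpace ℝ (Fin d)}

namespace IsRegularSystem

variable (hs : IsRegularSystem φ A C ρ σ μ π) (h : IsDriving T μ π P X₀ η)
include hs

lemma sq_le_form (u : Fin d → ℝ) : σ ^ 2 * ∑ i, u i ^ 2 ≤ ∫ x, (u ⬝ᵥ x.ofLp) ^ 2 ∂π :=
  hs.stationary.sq_le_form hs.noise hs.continuous hs.map_zero hs.regular hs.stationary_sq.1 u

include h

/-- E‖X‖² ≤ 2R*δ/T, so Markov's inequality at level 4R* leaves δ/(2T) for each time. -/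
lemma measure_norm_sq_gt_le (hT : 1 ≤ T) (hδ : 0 < δ) (hR : 0 < radiusStar T d C σ ρ δ) :
    P.real (⋃ t ∈ Finset.range T, {ω | 4 * radiusStar T d C σ ρ δ ≤
      ‖nldsTraj φ A (X₀ ω) (fun s => η s ω) t‖ ^ 2}) ≤ δ / 2 := by
  have hT0 : (0 : ℝ) < T := by exact_mod_cast hT
  have hD := stateSecondMomentBound_eq (d := d) (C := C) (σ := σ) hT hδ hs.rho_lt_one
  set R := radiusStar T d C σ ρ δ
  refine (measureReal_biUnion_finset_le _ _).trans ?_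
  have hle : ∀ t ∈ Finset.range T, P.real {ω | 4 * R ≤
      ‖nldsTraj φ A (X₀ ω) (fun s => η s ω) t‖ ^ 2} ≤ δ / 2 / T := by
    intro t ht
    have htT : t ≤ T := (Finset.mem_range.1 ht).le
    have h1 := mul_meas_ge_le_integral_of_nonneg (μ := P)
      (f := fun ω => ‖nldsTraj φ A (X₀ ω) (fun s => η s ω) t‖ ^ 2)
      (ae_of_all _ fun ω => sq_nonneg _)
      (h.integrable_traj_comp hs.continuous hs.stationary htT hs.stationary_sq.1) (4 * R)
    have h2 := h.integral_traj_comp hs.continuous hs.stationary htT (f := fun x => ‖x‖ ^ 2)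
      (by fun_prop)
    have h3 := hs.stationary_sq.2
    rw [← h2, hD] at h3
    have h4 : 4 * R * P.real {ω | 4 * R ≤ ‖nldsTraj φ A (X₀ ω) (fun s => η s ω) t‖ ^ 2} ≤
        4 * R * (δ / 2 / T) := by
      refine h1.trans (h3.trans (le_of_eq ?_))
      ring
    exact le_of_mul_le_mul_left h4 (by positivity)
  refine (Finset.sum_le_sum hle).trans (le_of_eq ?_)
  rw [Finset.sum_const, Finset.card_range, nsmul_eq_mul]
  field_simp

lemma exists_event (hd : 1 ≤ d) (hT : 1 ≤ T) (hδ : 0 < δ) (hδ1 : δ < 1 / 2)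
    (hbig : 4000000 * d * Real.log (1 / δ) * Real.log (radiusStar T d C σ ρ δ / σ ^ 2) *
      max (4 * C ^ 6 * fourthMoment μ / ((1 - ρ) ^ 4 * (1 - ρ ^ 2) * σ ^ 4))
        (Real.log (radiusStar T d C σ ρ δ * 4 * C / σ ^ 2) / Real.log (1 / ρ)) ≤ T) :
    ∃ W : Set Ω, MeasurableSet[MeasurableSpace.comap X₀ inferInstance ⊔
        ⨆ t : Fin T, MeasurableSpace.comap (η t) inferInstance] W ∧ 1 - δ ≤ P.real W ∧
      ∀ ω ∈ W, ∀ v : Fin d → ℝ, 1 / 512 * (v ⬝ᵥ (secondMoment π).mulVec v) ≤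
        empiricalForm T (nldsTraj φ A (X₀ ω) fun s => η s ω) v := by
  have hσ := hs.noise.sigma_pos
  obtain ⟨B, N, hB, hNT, hTN, hB1, hB2, hrem, hcard⟩ := exists_block_parameters hd hT hs.one_le hσ
    hs.rho_pos hs.rho_lt_one hδ hδ1 hs.noise.sq_le_fourthMoment hbig
  have hx8 := eight_le_radius_ratio hd hT hs.one_le hσ hs.rho_pos hs.rho_lt_one hδ hδ1
  have hRpos : 0 < radiusStar T d C σ ρ δ := by
    have := (by linarith : 0 < radiusStar T d C σ ρ δ / σ ^ 2)
    exact (div_pos_iff_of_pos_right (by positivity)).1 this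
  have hbound := hs.measure_norm_sq_gt_le h hT hδ hRpos
  set R := radiusStar T d C σ ρ δ with hR
  set x := R / σ ^ 2 with hx
  have hx0 : 0 < x := by linarith
  -- Chosen so that ε² · 4R = 1/(64x) ≤ 1/512. On a ball of radius 1/σ the net then has at most (1 +
  -- 32x)ᵈ ≤ (x³)ᵈ points, as x ≥ 8.
  set ε := 1 / (16 * σ * x) with hε
  have hε0 : 0 < ε := by positivity
  have hεR : ε ^ 2 * (4 * R) ≤ 1 / 512 := by
    have hRx : R = σ ^ 2 * x := by rw [hx]; field_simp
    have : ε ^ 2 * (4 * R) = 1 / (64 * x) := by rw [hε, hRx]; field_simp; norm_num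
    rw [this, div_le_div_iff₀ (by positivity) (by norm_num)]
    linarith
  have hnorm : ∀ v : EuclideanSpace ℝ (Fin d), ∫ y, (v.ofLp ⬝ᵥ y.ofLp) ^ 2 ∂π = 1 →
      ∑ i, v.ofLp i ^ 2 ≤ 1 / σ ^ 2 := by
    intro v hv
    have := hs.sq_le_form v.ofLp
    rw [hv] at this
    rw [le_div_iff₀ (by positivity)]
    linarith
  -- The net consists of points of the ellipsoid itself, so the block estimates apply to each of
  -- them.
  obtain ⟨S, hS1, hS2, hS3⟩ := exists_finset_net (d := d)
    (s := {v | ∫ y, (v.ofLp ⬝ᵥ y.ofLp) ^ 2 ∂π = 1}) (R := 1 / σ) (ε := ε) (by positivity) hε0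
    (fun v hv => by
      refine abs_le_of_sq_le_sq' ?_ (by positivity) |>.2
      rw [EuclideanSpace.norm_sq_eq, one_div, inv_pow, ← one_div]
      simpa using hnorm v hv)
  have hScard : (S.card : ℝ) ≤ (x ^ 3) ^ d := by
    refine hS3.trans (pow_le_pow_left₀ (by positivity) ?_ d)
    have : 1 + 2 * (1 / σ) / ε = 1 + 32 * x := by rw [hε]; field_simp; ring
    rw [this]
    nlinarith [mul_nonneg hx0.le (mul_nonneg (by linarith : 0 ≤ x - 8) (by linarith : 0 ≤ x + 8))]
  refine ⟨energyEvent φ A T B N (4 * R) S X₀ η, ?_, ?_, ?_⟩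
  -- Measurability is with respect to the σ-algebra of the data, not the ambient one.
  · have m1 : Measurable[MeasurableSpace.comap X₀ inferInstance ⊔
        ⨆ t : Fin T, MeasurableSpace.comap (η t) inferInstance] X₀ :=
      Measurable.of_comap_le le_sup_left
    have m2 : ∀ t < T, Measurable[MeasurableSpace.comap X₀ inferInstance ⊔
        ⨆ t : Fin T, MeasurableSpace.comap (η t) inferInstance] (η t) := fun t ht =>
      Measurable.of_comap_le (le_sup_of_le_right (le_iSup
        (fun t : Fin T => MeasurableSpace.comap (η t) inferInstance) ⟨t, ht⟩))
    exact measurableSet_energyEvent hs.continuous hNT _ S m1 m2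
  · have hmeas : MeasurableSet (energyEvent φ A T B N (4 * R) S X₀ η) :=
      measurableSet_energyEvent hs.continuous hNT _ S h.measurable_init h.measurable_noise
    have hcompl : (energyEvent φ A T B N (4 * R) S X₀ η)ᶜ ⊆
        (⋃ t ∈ Finset.range T, {ω | 4 * R ≤
          ‖nldsTraj φ A (X₀ ω) (fun s => η s ω) t‖ ^ 2}) ∪
        ⋃ u ∈ S, {ω | ∑ j ∈ Finset.range N,
          blockEnergy φ A (fun s => η s ω) u.ofLp B (2 * B * j) ≤ N * B / 8} := by
      intro ω hω
      by_contra hn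
      simp only [Set.mem_union, Set.mem_iUnion, not_or, not_exists] at hn
      exact hω ⟨fun t ht => (not_le.1 (hn.1 t ht)).le, fun u hu => (not_le.1 (hn.2 u hu)).le⟩
    have hdir : P.real (⋃ u ∈ S, {ω | ∑ j ∈ Finset.range N,
          blockEnergy φ A (fun s => η s ω) u.ofLp B (2 * B * j) ≤ N * B / 8}) ≤ δ / 2 := by
      refine (measureReal_biUnion_finset_le _ _).trans ?_
      refine (Finset.sum_le_sum fun u hu => hs.measure_sum_blockEnergy_le h (hnorm u (hS1 hu))
        (hS1 hu) hB1 hB hNT hB2).trans ?_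
      rw [Finset.sum_const, nsmul_eq_mul]
      exact (mul_le_mul_of_nonneg_right hScard (Real.exp_nonneg _)).trans hcard
    have h1 := (measureReal_mono (μ := P) hcompl).trans (measureReal_union_le _ _)
    rw [probReal_compl_eq_one_sub hmeas] at h1
    linarith
  · rintro ω ⟨hω1, hω2⟩ v
    rw [secondMoment_form hs.stationary_sq.1]
    set g := ∫ y, (v ⬝ᵥ y.ofLp) ^ 2 ∂π with hg
    have hg0 : 0 ≤ g := integral_nonneg fun _ => sq_nonneg _
    rcases hg0.eq_or_lt with hg0 | hg0
    · rw [← hg0, mul_zero]; exact empiricalForm_nonneg _ _ _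
    have hgs : 0 < √g := Real.sqrt_pos.2 hg0
    set v' : EuclideanSpace ℝ (Fin d) := WithLp.toLp 2 ((√g)⁻¹ • v) with hv'
    have hv'1 : ∫ y, (v'.ofLp ⬝ᵥ y.ofLp) ^ 2 ∂π = 1 := by
      simp only [hv', smul_dotProduct, smul_eq_mul, mul_pow]
      rw [integral_const_mul, ← hg, inv_pow, Real.sq_sqrt hg0.le, inv_mul_cancel₀ hg0.ne']
    obtain ⟨u, huS, huv⟩ := hS2 v' hv'1
    have hb : ∀ t < T, ‖nldsTraj φ A (X₀ ω) (fun s => η s ω) t‖ ^ 2 ≤ 4 * R := fun t ht =>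
      hω1 t (Finset.mem_range.2 ht)
    have hu := le_empiricalForm_of_blockEnergy hs.regular hs.one_le hs.rho_pos hs.rho_lt_one
      (hnorm u (hS1 huS)) hB hT hNT hTN hb hrem (hω2 u huS)
    have hv := le_empiricalForm_of_net hT hb hεR huv hu
    have hvv : v = √g • v'.ofLp := by
      simp only [hv', smul_smul, mul_inv_cancel₀ hgs.ne', one_smul]
    rw [hvv, empiricalForm_smul, Real.sq_sqrt hg0.le, mul_comm]
    exact mul_le_mul_of_nonneg_left hv hg0.le

end IsRegularSystem

end EventProbability

/-! ### Measurability of the estimator -/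

section Measurability

variable {d : ℕ} {φ : ℝ → ℝ} {T : ℕ} {Ω : Type*} [MeasurableSpace Ω]

lemma measurable_det_of_entries {M : Ω → Matrix (Fin d) (Fin d) ℝ}
    (hM : ∀ i j, Measurable fun ω => M ω i j) : Measurable fun ω => (M ω).det := by
  simp only [Matrix.det_apply']
  exact Finset.measurable_sum _ fun s _ =>
    measurable_const.mul (Finset.measurable_prod _ fun i _ => hM _ _)

/-- Cramer's rule; the convention 0⁻¹ = 0 agrees with the inverse of a singular matrix being 0, so
no case distinction arises. -/
lemma measurable_inv_of_entries {M : Ω → Matrix (Fin d) (Fin d) ℝ}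
    (hM : ∀ i j, Measurable fun ω => M ω i j) (i j : Fin d) :
    Measurable fun ω => (M ω)⁻¹ i j := by
  simp only [Matrix.inv_def, Matrix.smul_apply, smul_eq_mul, Ring.inverse_eq_inv',
    Matrix.adjugate_apply]
  refine (measurable_det_of_entries hM).inv.mul (measurable_det_of_entries fun k l => ?_)
  by_cases hk : k = j
  · subst hk; simp
  · simpa [Matrix.updateRow_ne hk] using hM k l

variable {x : ℕ → Ω → EuclideanSpace ℝ (Fin d)} (hφ : Continuous φ)
  (hx : ∀ t ≤ T, Measurable (x t))
include hx

lemma measurable_empiricalSecondMoment (i j : Fin d) :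
    Measurable fun ω => empiricalSecondMoment T (fun t => x t ω) i j := by
  simp only [empiricalSecondMoment, Matrix.smul_apply, Matrix.sum_apply, Matrix.vecMulVec_apply,
    smul_eq_mul]
  exact (Finset.measurable_sum _ fun t ht =>
    (measurable_coord (hx t (by simp at ht; omega)) i).mul
      (measurable_coord (hx t (by simp at ht; omega)) j)).const_mul _

include hφ

lemma measurable_quasiNewtonIter (γ : ℝ) (m : ℕ) (i j : Fin d) :
    Measurable fun ω => quasiNewtonIter φ T γ (fun t => x t ω) m i j := by
  induction m generalizing i j with
  | zero => exact measurable_const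
  | succ m ih =>
    have hgrad : ∀ i j, Measurable fun ω =>
        proxyGrad φ T (fun t => x t ω) (quasiNewtonIter φ T γ (fun t => x t ω) m) i j := by
      intro i j
      simp only [proxyGrad, Matrix.smul_apply, Matrix.sum_apply, Matrix.vecMulVec_apply,
        smul_eq_mul, PiLp.sub_apply, nldsMap, Matrix.mulVec, dotProduct]
      refine (Finset.measurable_sum _ fun t ht => ?_).const_mul _
      have ht' : t < T := Finset.mem_range.1 ht
      refine Measurable.mul (Measurable.sub (hφ.measurable.comp
        (Finset.measurable_sum _ fun k _ => (ih i k).mul (measurable_coord (hx t ht'.le) k)))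
        (measurable_coord (hx (t + 1) ht') i)) (measurable_coord (hx t ht'.le) j)
    simp only [quasiNewtonIter, Matrix.sub_apply, Matrix.smul_apply, smul_eq_mul, Matrix.mul_apply]
    exact (ih i j).sub ((Finset.measurable_sum _ fun k _ => (hgrad i k).mul
      (measurable_inv_of_entries (measurable_empiricalSecondMoment hx) k j)).const_mul _)

lemma measurable_quasiNewton (γ : ℝ) (m : ℕ) (i j : Fin d) :
    Measurable fun ω => quasiNewton φ T γ (fun t => x t ω) m i j := by
  classical
  have hset : MeasurableSet {ω | IsUnit (empiricalSecondMoment T fun t => x t ω)} := by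
    have : {ω | IsUnit (empiricalSecondMoment T fun t => x t ω)} =
        {ω | (empiricalSecondMoment T fun t => x t ω).det = 0}ᶜ := by
      ext ω; simp [Matrix.isUnit_iff_isUnit_det]
    rw [this]
    exact (measurableSet_eq_fun
      (measurable_det_of_entries (measurable_empiricalSecondMoment hx)) measurable_const).compl
  have : (fun ω => quasiNewton φ T γ (fun t => x t ω) m i j) = fun ω =>
      if IsUnit (empiricalSecondMoment T fun t => x t ω) then
        quasiNewtonIter φ T γ (fun t => x t ω) m i j else 0 := by
    ext ω
    unfold quasiNewton
    split_ifs <;> rfl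
  rw [this]
  exact Measurable.ite hset (measurable_quasiNewtonIter hφ hx γ m i j) measurable_const

end Measurability

/-! ### The bias term and the conclusion -/

section Main

/-- Let y be the argument of the logarithm. If y ≤ 1, which includes F = 0, no contraction is
needed; otherwise (1 − ζ/2)ᵐ ≤ e^(−ζm/2) ≤ y⁻⁵ ≤ y⁻¹. -/
lemma contraction_pow_mul_le {d T m : ℕ} {ζ σ F R : ℝ} (hd : 1 ≤ d) (hT : 1 ≤ T) (hζ : 0 < ζ)
    (hζ1 : ζ ≤ 1) (hσ : 0 < σ) (hF : 0 ≤ F) (hR : 0 ≤ R)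
    (hm : 10 / ζ * Real.log (F * (T * R) / (σ ^ 2 * d ^ 2)) ≤ m) :
    (1 - ζ / 2) ^ m * (F * R) ≤ d ^ 2 * σ ^ 2 / T := by
  have hT0 : (0 : ℝ) < T := by exact_mod_cast hT
  have hd0 : (0 : ℝ) < d := by exact_mod_cast hd
  have hq0 : 0 ≤ 1 - ζ / 2 := by linarith
  have hFR : 0 ≤ F * R := mul_nonneg hF hR
  set y := F * (T * R) / (σ ^ 2 * d ^ 2) with hy
  have hFy : F * R = y * (d ^ 2 * σ ^ 2 / T) := by rw [hy]; field_simp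
  have hb : 0 ≤ (d : ℝ) ^ 2 * σ ^ 2 / T := by positivity
  rcases le_or_gt y 1 with hy1 | hy1
  · calc _ ≤ 1 * (F * R) := by
          gcongr
          exact pow_le_one₀ hq0 (by linarith)
      _ = y * (d ^ 2 * σ ^ 2 / T) := by rw [one_mul, hFy]
      _ ≤ 1 * (d ^ 2 * σ ^ 2 / T) := by gcongr
      _ = _ := one_mul _
  · have hl : 0 < Real.log y := Real.log_pos hy1
    have h1 : (1 - ζ / 2) ^ m ≤ Real.exp (-(ζ / 2 * m)) := by
      have : 1 - ζ / 2 ≤ Real.exp (-(ζ / 2)) := by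
        have := Real.add_one_le_exp (-(ζ / 2)); linarith
      calc _ ≤ Real.exp (-(ζ / 2)) ^ m := pow_le_pow_left₀ hq0 this m
        _ = _ := by rw [← Real.exp_nat_mul]; ring_nf
    have h2 : Real.log y ≤ ζ / 2 * m := by
      have h3 : ζ / 2 * (10 / ζ * Real.log y) ≤ ζ / 2 * m := by gcongr
      have h4 : ζ / 2 * (10 / ζ * Real.log y) = 5 * Real.log y := by field_simp; norm_num
      linarith
    have h5 : Real.exp (-(ζ / 2 * m)) ≤ y⁻¹ := by
      rw [← Real.exp_log (by linarith : 0 < y), ← Real.exp_neg, Real.exp_le_exp]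
      linarith
    calc _ ≤ y⁻¹ * (F * R) := by gcongr; exact h1.trans h5
      _ = _ := by rw [hFy, ← mul_assoc, inv_mul_cancel₀ (by linarith), one_mul]

lemma frobeniusSq_nonneg {d : ℕ} (M : Matrix (Fin d) (Fin d) ℝ) : 0 ≤ frobeniusSq M :=
  Finset.sum_nonneg fun _ _ => Finset.sum_nonneg fun _ _ => sq_nonneg _

lemma frobeniusSq_zero_sub {d : ℕ} (M : Matrix (Fin d) (Fin d) ℝ) :
    frobeniusSq (0 - M) = frobeniusSq M := by
  simp [frobeniusSq]

end Main

theorem theorem2 :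
    ∃ C C₁ C₀ : ℝ, 0 < C ∧ 0 < C₁ ∧ 0 < C₀ ∧
      ∀ (d T m : ℕ) (φ : ℝ → ℝ) (A : Matrix (Fin d) (Fin d) ℝ) (ζ σ Cρ ρ δ : ℝ)
        (μ π : Measure (EuclideanSpace ℝ (Fin d)))
        (Ω : Type*) [MeasurableSpace Ω] (P : Measure Ω) [IsProbabilityMeasure P]
        (X₀ : Ω → EuclideanSpace ℝ (Fin d)) (η : ℕ → Ω → EuclideanSpace ℝ (Fin d)),
        1 ≤ d → 1 ≤ T →
        IsExpansiveLink φ ζ →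
        1 ≤ Cρ → 0 < ρ → ρ < 1 →
        IsExpRegular φ A Cρ ρ →
        IsNoiseLaw μ σ →
        IsStationaryLaw φ A μ π →
        IsDriving T μ π P X₀ η →
        0 < δ → δ < 1 / 2 →
        C * d * Real.log (1 / δ) * Real.log (radiusStar T d Cρ σ ρ δ / σ ^ 2) *
            max (4 * Cρ ^ 6 * fourthMoment μ / ((1 - ρ) ^ 4 * (1 - ρ ^ 2) * σ ^ 4))
              (Real.log (radiusStar T d Cρ σ ρ δ * C₁ * Cρ / σ ^ 2) / Real.log (1 / ρ)) ≤ T →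
        10 / ζ * Real.log (frobeniusSq (0 - A) * (T * radiusStar T d Cρ σ ρ δ) /
            (σ ^ 2 * d ^ 2)) ≤ m →
        Integrable (fun x => ‖x‖ ^ 2) π ∧
        ∃ W : Set Ω,
          MeasurableSet[MeasurableSpace.comap X₀ inferInstance ⊔
            ⨆ t : Fin T, MeasurableSpace.comap (η t) inferInstance] W ∧
          1 - δ ≤ P.real W ∧
          Integrable (W.indicator fun ω => frobeniusSq
            (quasiNewton φ T (1 / 4) (nldsTraj φ A (X₀ ω) fun s => η s ω) m - A)) P ∧
          ∫ ω, W.indicator (fun ω => frobeniusSq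
            (quasiNewton φ T (1 / 4) (nldsTraj φ A (X₀ ω) fun s => η s ω) m - A)) ω ∂P ≤
            C₀ * d ^ 2 * σ ^ 2 / (ζ ^ 2 * T * lambdaMin (secondMoment π)) := by
  -- The first two constants are those of `exists_block_parameters`. In the third, 512 comes from
  -- passing to λ_min(G), and 513 = 1 + 512 adds the bias to the noise term.
  refine ⟨4000000, 4, 512 * 513, by norm_num, by norm_num, by norm_num, ?_⟩
  intro d T m φ A ζ σ Cρ ρ δ μ π Ω _ P _ X₀ η hd hT hφ hC hρ hρ1 hreg hμ hπ hD hδ hδ1 hbig hm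
  have hcont : Continuous φ := hφ.lipschitz.continuous
  have hs : IsRegularSystem φ A Cρ ρ σ μ π :=
    ⟨hcont, hφ.map_zero, hreg, hC, hρ, hρ1, hμ, hπ⟩
  have hπ2 := hs.stationary_sq
  refine ⟨hπ2.1, ?_⟩
  obtain ⟨W, hWm, hWP, hW⟩ := hs.exists_event hD hd hT hδ hδ1 hbig
  have hζ := hφ.zeta_pos
  have hζ1 := hφ.zeta_le_one
  have hσ := hμ.sigma_pos
  have hT0 : (0 : ℝ) < T := by exact_mod_cast hT
  have hT1 : (1 : ℝ) ≤ T := by exact_mod_cast hT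
  have hG : (secondMoment π).PosDef := posDef_secondMoment hπ2.1 hσ hs.sq_le_form
  have hl := hG.lambdaMin_pos hd
  set l := lambdaMin (secondMoment π) with hldef
  set R := radiusStar T d Cρ σ ρ δ with hR
  have h1ρ : 0 < 1 - ρ := by linarith
  have hR0 : 0 ≤ R := by rw [hR]; unfold radiusStar; positivity
  rw [frobeniusSq_zero_sub] at hm
  have hWm' : MeasurableSet W := by
    refine (sup_le hD.measurable_init.comap_le (iSup_le fun t => ?_)) W hWm
    exact (hD.measurable_noise t t.2).comap_le
  -- A nonnegative majorant on all of Ω, so that expectations are taken without the indicator of W,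
  -- which is not independent of the noise.
  set g : Ω → ℝ := fun ω => 1 / (1 / 512 * l) * ((1 - ζ / 2) ^ m * (frobeniusSq A *
    ((1 / (T : ℝ)) * ∑ t ∈ Finset.range T, ‖nldsTraj φ A (X₀ ω) (fun s => η s ω) t‖ ^ 2)) +
      1 / (1 / 512 * ζ ^ 2) *
        (noiseCorrelation φ A T (nldsTraj φ A (X₀ ω) fun s => η s ω) * (secondMoment π)⁻¹ *
          (noiseCorrelation φ A T (nldsTraj φ A (X₀ ω) fun s => η s ω)).transpose).trace) with hg
  obtain ⟨htr, htr'⟩ := hD.integral_trace_noiseCorrelation hcont hπ hμ hπ2.1 hT hG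
  have hnormi : ∀ t ∈ Finset.range T,
      Integrable (fun ω => ‖nldsTraj φ A (X₀ ω) (fun s => η s ω) t‖ ^ 2) P := fun t ht =>
    hD.integrable_traj_comp hcont hπ (Finset.mem_range.1 ht).le hπ2.1
  have hgi1 := (((integrable_finsetSum _ hnormi).const_mul (1 / (T : ℝ))).const_mul
    (frobeniusSq A)).const_mul ((1 - ζ / 2) ^ m)
  have hgi2 := htr.const_mul (1 / (1 / 512 * ζ ^ 2))
  have hgi : Integrable g P := (hgi1.add hgi2).const_mul _
  have hFA := frobeniusSq_nonneg A
  have hq0 : 0 ≤ 1 - ζ / 2 := by linarith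
  have hg0 : ∀ ω, 0 ≤ g ω := by
    intro ω
    have := (hG.inv.posSemidef.mul_mul_conjTranspose_same
      (noiseCorrelation φ A T (nldsTraj φ A (X₀ ω) fun s => η s ω))).trace_nonneg
    rw [Matrix.conjTranspose_eq_transpose_of_trivial] at this
    simp only [hg]
    positivity
  have hle : ∀ ω, W.indicator (fun ω => frobeniusSq
      (quasiNewton φ T (1 / 4) (nldsTraj φ A (X₀ ω) fun s => η s ω) m - A)) ω ≤ g ω := by
    intro ω
    by_cases hω : ω ∈ W
    · rw [Set.indicator_of_mem hω]
      exact quasiNewton_error_le hφ hG (by norm_num) hl (hW ω hω) (hG.1.lambdaMin_mul_le) m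
    · rw [Set.indicator_of_notMem hω]; exact hg0 ω
  have hmeas : Measurable fun ω => frobeniusSq
      (quasiNewton φ T (1 / 4) (nldsTraj φ A (X₀ ω) fun s => η s ω) m - A) := by
    unfold frobeniusSq
    refine Finset.measurable_sum _ fun i _ => Finset.measurable_sum _ fun j _ => ?_
    exact ((measurable_quasiNewton (x := fun t ω => nldsTraj φ A (X₀ ω) (fun s => η s ω) t) hcont
      (fun t ht => hD.measurable_traj hcont ht) (1 / 4) m i j).sub_const _).pow_const 2
  have hfi : Integrable (W.indicator fun ω => frobeniusSq
      (quasiNewton φ T (1 / 4) (nldsTraj φ A (X₀ ω) fun s => η s ω) m - A)) P := by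
    refine hgi.mono' (hmeas.indicator hWm').aestronglyMeasurable (ae_of_all _ fun ω => ?_)
    rw [Real.norm_of_nonneg (Set.indicator_nonneg (fun _ _ => frobeniusSq_nonneg _) ω)]
    exact hle ω
  refine ⟨W, hWm, hWP, hfi, (integral_mono hfi hgi hle).trans ?_⟩
  -- The bound 2R*δ/T of the second moment is at most R*, since 2δ ≤ 1 ≤ T.
  have hEX : ∫ x, ‖x‖ ^ 2 ∂π ≤ R := by
    have hDeq := stateSecondMomentBound_eq (d := d) (C := Cρ) (σ := σ) hT hδ hρ1
    rw [← hR] at hDeq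
    refine hπ2.2.trans ?_
    rw [hDeq, mul_left_comm]
    refine mul_le_of_le_one_right hR0 ?_
    rw [← mul_div_assoc, div_le_one hT0]
    linarith
  have hg1 : ∫ ω, g ω ∂P = 1 / (1 / 512 * l) * ((1 - ζ / 2) ^ m * (frobeniusSq A *
      ∫ x, ‖x‖ ^ 2 ∂π) + 1 / (1 / 512 * ζ ^ 2) * (d ^ 2 * σ ^ 2 / T)) := by
    simp only [hg]
    rw [integral_const_mul, integral_add hgi1 hgi2, integral_const_mul, integral_const_mul,
      integral_const_mul, integral_const_mul, htr', integral_finsetSum _ hnormi,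
      Finset.sum_congr rfl fun t ht => hD.integral_traj_comp hcont hπ (Finset.mem_range.1 ht).le
        (f := fun x => ‖x‖ ^ 2) (by fun_prop), Finset.sum_const, Finset.card_range, nsmul_eq_mul]
    congr 4
    field_simp
  have hbias : (1 - ζ / 2) ^ m * (frobeniusSq A * ∫ x, ‖x‖ ^ 2 ∂π) ≤
      1 / ζ ^ 2 * (d ^ 2 * σ ^ 2 / T) := by
    have h1 := contraction_pow_mul_le hd hT hζ hζ1 hσ hFA hR0 hm
    have h2 : (1 - ζ / 2) ^ m * (frobeniusSq A * ∫ x, ‖x‖ ^ 2 ∂π) ≤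
        (1 - ζ / 2) ^ m * (frobeniusSq A * R) := by gcongr
    refine h2.trans (h1.trans (le_mul_of_one_le_left (by positivity) ?_))
    rw [le_div_iff₀ (by positivity), one_mul]
    exact pow_le_one₀ hζ.le hζ1
  rw [hg1]
  calc _ ≤ 1 / (1 / 512 * l) * (1 / ζ ^ 2 * (d ^ 2 * σ ^ 2 / T) +
        1 / (1 / 512 * ζ ^ 2) * (d ^ 2 * σ ^ 2 / T)) := by gcongr
    _ = _ := by field_simp; norm_num
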